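/- **Setting.** Points of $\mathbb R^2$ are written $\vec x=(z,x)$. Let $\Omega\subset\mathbb R^2$ be a terminating waveguide: $\Omega$ is open, $\Omega\cap\{z<L\}=(-\infty,L)\times(0,D)$ with $D>0$, and $\Omega\cap\{z\ge L\}$ is bounded. Let $\eta:\Omega\to\mathbb R$ be bounded and measurable with $\eta=1$ on $\{z<L\}$. For $n\ge 1$ put $\mu_n=(n\pi/D)^2$ and $X_n(x)=\sqrt{2/D}\,\sin(n\pi x/D)$; let $k\in\mathbb R$ and $M$ satisfy $\mu_M<k^2<\mu_{M+1}$ (with $\mu_0=0$), and let $\beta_n=\sqrt{k^2-\mu_n}$ for $n\le M$, $\beta_n=i\sqrt{\mu_n-k^2}$ for $n\ge M+1$. Assume that the Green's function $G(\cdot,\vec s)$ exists for every source $\vec s=(z_s,x_s)\in\Omega$. By this is meant: $G(\vec x,\vec s)=-\frac1{2\pi}\log|\vec x-\vec s|+h(\vec x)$ with $h$ continuous on $\Omega$; $-\Delta G(\cdot,\vec s)-k^2\eta\,G(\cdot,\vec s)=\delta_{\vec s}$ in $\Omega$ in the sense of distributions; $G(\cdot,\vec s)=0$ on $\partial\Omega$,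 in the sense that $\chi\,G(\cdot,\vec s)\in H^1_0(\Omega)$ for every $\chi\in C_c^\infty(\mathbb R^2)$ vanishing near $\vec s$; and $G(\cdot,\vec s)$ is outgoing: on every cross-section $\{z\}\times(0,D)$ with $z<\min(L,z_s)$ it satisfies the Dirichlet-to-Neumann condition $-\partial_zG=\sum_{n\ge1}i\beta_nG_n(z,\vec s)X_n$, understood coefficient by coefficient, i.e. $\partial_z G_n(z,\vec s)=-i\beta_n G_n(z,\vec s)$ for all $n\ge 1$, where $G_n(z,\vec s)=\int_0^D G((z,x),\vec s)\,X_n(x)\,dx$. Let $z_a<L$, let $\mathcal A=\{z_a\}\times[0,D]$ be a full-aperture vertical array, and let $\nu=(-1,0)$. For $\vec x_s,\vec y\in\Omega$ with ranges larger than $z_a$ put $$\mathcal I(\vec y)=\int_{\mathcal A}\Big(\overline{G(\cdot,\vec x_s)}\,\partial_\nu G(\cdot,\vec y)-G(\cdot,\vec y)\,\overline{\partial_\nu G(\cdot,\vec x_s)}\Big)\,dx .$$ **Proposition (Kirchhoff-Helmholtz identity).** For all $\vec x_s,\vec y\in\Omega$ with ranges larger than $z_a$, the derivatives in $\mathcal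 I(\vec y)$ exist, all integrals below converge absolutely, and $$\mathcal I(\vec y)=G(\vec y,\vec x_s)-\overline{G(\vec y,\vec x_s)}=2i\,\mathrm{Im}\,G(\vec y,\vec x_s)=G(\vec x_s,\vec y)-\overline{G(\vec x_s,\vec y)}\qquad(\vec y\ne\vec x_s),$$ $$\mathcal I(\vec y)=2i\sum_{n=1}^M\beta_n\,\overline{G_n(z_a,\vec x_s)}\,G_n(z_a,\vec y)\qquad(\text{for all }\vec y,\ \text{including }\vec y=\vec x_s).$$ If $\vec y=\vec x_s$, then $2i\,\mathrm{Im}\,G(\vec p,\vec x_s)\to\mathcal I(\vec x_s)$ as $\vec p\to\vec x_s$, $\vec p\neq\vec x_s$. Consequently, with the passive data $Q_n=\int_0^D G((z_a,x),\vec x_s)X_n(x)\,dx$, the passive imaging functional satisfies $$\mathcal I^{\rm p}(\vec y):=\sum_{n=1}^M\beta_n\overline{Q_n}\,G_n(z_a,\vec y)=\mathrm{Im}\,G(\vec y,\vec x_s).$$ For a point scatterer at $\vec x^*\in\Omega$ with range larger than $z_a$, and the active data $Q_{nm}=\int_0^D\!\int_0^D G(\vec x^*,(z_a,x))\,G((z_a,x'),\vec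 x^*)\,X_n(x)X_m(x')\,dx\,dx'$, the active imaging functional satisfies $$\mathcal I^{\rm a}(\vec y):=\sum_{n=1}^M\sum_{m=1}^M\beta_n\beta_m\overline{Q_{nm}}\,G_n(z_a,\vec y)\,G_m(z_a,\vec y)=\big(\mathrm{Im}\,G(\vec y,\vec x^*)\big)^2.$$ In the last two formulas $\mathrm{Im}\,G(\vec y,\vec y)$, at $\vec y=\vec x_s$ and $\vec y=\vec x^*$ respectively, denotes the limit of $\mathrm{Im}\,G(\vec p,\vec y)$ as $\vec p\to\vec y$, $\vec p\neq\vec y$, which exists. -/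

import Mathlib

open MeasureTheory Filter Topology Set
open scoped ContDiff ComplexConjugate

noncomputable section

namespace Waveguide

/-- Points of the plane are pairs `p = (z, x)`: range `z = p.1`, cross-range `x = p.2`.
`Ω` is a terminating waveguide: an open set whose part to the left of `z = L` is the semi-infinite
strip `(-∞, L) × (0, D)` and whose remaining part is bounded (and otherwise arbitrary). -/
structure IsTerminating (Ω : Set (ℝ × ℝ)) (L D : ℝ) : Prop where
  isOpen : IsOpen Ω
  width_pos : 0 < D
  strip : Ω ∩ {p | p.1 < L} = Iio L ×ˢ Ioo 0 D
  bounded : Bornology.IsBounded (Ω ∩ {p | L ≤ p.1})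

/-- The (real) index of refraction: bounded and measurable in the waveguide, and equal to `1` in the
semi-infinite strip. -/
structure IsIndex (Ω : Set (ℝ × ℝ)) (L : ℝ) (η : ℝ × ℝ → ℝ) : Prop where
  measurable : Measurable η
  bounded : ∃ C, ∀ p ∈ Ω, |η p| ≤ C
  homogeneous : ∀ p ∈ Ω, p.1 < L → η p = 1

/-- Eigenvalues `μ_n = (nπ/D)²` (`n ≥ 1`) of `-d²/dx²` on `(0, D)` with Dirichlet conditions. -/
def mu (D : ℝ) (n : ℕ) : ℝ := (n * Real.pi / D) ^ 2

/-- The orthonormal eigenfunctions `X_n(x) = √(2/D) sin(nπx/D)` (`n ≥ 1`). -/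
def X (D : ℝ) (n : ℕ) (x : ℝ) : ℝ := √(2 / D) * Real.sin (n * Real.pi * x / D)

/-- Horizontal wavenumbers: `√(k² - μ_n)` for the propagating modes, `i √(μ_n - k²)` for the
evanescent ones. -/
def beta (D k : ℝ) (n : ℕ) : ℂ :=
  if mu D n < k ^ 2 then (√(k ^ 2 - mu D n) : ℂ) else Complex.I * (√(mu D n - k ^ 2) : ℂ)

/-- Fourier coefficient `u_n(z) = ∫₀ᴰ u(z, x) X_n(x) dx`. -/
def coeff (D : ℝ) (u : ℝ × ℝ → ℂ) (n : ℕ) (z : ℝ) : ℂ :=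
  ∫ x in (0 : ℝ)..D, u (z, x) * (X D n x : ℂ)

/-- `∂φ/∂z`. -/
def dz (φ : ℝ × ℝ → ℂ) (p : ℝ × ℝ) : ℂ := fderiv ℝ φ p (1, 0)

/-- `∂φ/∂x`. -/
def dx (φ : ℝ × ℝ → ℂ) (p : ℝ × ℝ) : ℂ := fderiv ℝ φ p (0, 1)

/-- The Laplacian `∂²φ/∂z² + ∂²φ/∂x²` (applied to smooth functions only). -/
def lap (φ : ℝ × ℝ → ℂ) (p : ℝ × ℝ) : ℂ := dz (dz φ) p + dx (dx φ) p

/-- `φ ∈ C_c^∞(Ω)`. -/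
structure IsTest (Ω : Set (ℝ × ℝ)) (φ : ℝ × ℝ → ℂ) : Prop where
  smooth : ContDiff ℝ ∞ φ
  compact : HasCompactSupport φ
  support : tsupport φ ⊆ Ω

/-- `w ∈ H¹₀(Ω)`: `w` is the limit in `L²(Ω)` of test functions whose first partial derivatives
converge in `L²(Ω)` too. -/
def MemH10 (Ω : Set (ℝ × ℝ)) (w : ℝ × ℝ → ℂ) : Prop :=
  ∃ (φ : ℕ → ℝ × ℝ → ℂ) (gz gx : ℝ × ℝ → ℂ),
    (∀ j, IsTest Ω (φ j)) ∧
    MemLp w 2 (volume.restrict Ω) ∧ MemLp gz 2 (volume.restrict Ω) ∧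
    MemLp gx 2 (volume.restrict Ω) ∧
    Tendsto (fun j => eLpNorm (φ j - w) 2 (volume.restrict Ω)) atTop (𝓝 0) ∧
    Tendsto (fun j => eLpNorm (dz (φ j) - gz) 2 (volume.restrict Ω)) atTop (𝓝 0) ∧
    Tendsto (fun j => eLpNorm (dx (φ j) - gx) 2 (volume.restrict Ω)) atTop (𝓝 0)

/-- Euclidean distance in the plane. -/
def edist2 (p q : ℝ × ℝ) : ℝ := √((p.1 - q.1) ^ 2 + (p.2 - q.2) ^ 2)

/-- `u` is the outgoing Dirichlet Green's function of `-Δ - k² η` in the waveguide `Ω`, with a point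
source at `s`. -/
structure IsGreen (Ω : Set (ℝ × ℝ)) (L D k : ℝ) (η : ℝ × ℝ → ℝ) (s : ℝ × ℝ)
    (u : ℝ × ℝ → ℂ) : Prop where
  /-- `u` is a genuine function with the logarithmic singularity of a point source in the plane:
  `u(p) = -(1/2π) log |p - s| + h(p)` with `h` continuous in `Ω`. -/
  singularity : ∃ h : ℝ × ℝ → ℂ, ContinuousOn h Ω ∧
    ∀ p ∈ Ω, p ≠ s → u p = ((-(1 / (2 * Real.pi)) * Real.log (edist2 p s) : ℝ) : ℂ) + h p
  /-- `-Δu - k² η u = δ_s` in `Ω`, in the sense of distributions. -/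
  helmholtz : ∀ φ, IsTest Ω φ →
    ∫ p in Ω, u p * (-lap φ p - (k : ℂ) ^ 2 * (η p : ℂ) * φ p) = φ s
  /-- `u = 0` on `∂Ω`: away from the source, `u` is locally (up to the boundary) in `H¹₀(Ω)`. -/
  dirichlet : ∀ χ : ℝ × ℝ → ℂ, ContDiff ℝ ∞ χ → HasCompactSupport χ → s ∉ tsupport χ →
    MemH10 Ω (fun p => χ p * u p)
  /-- Radiation condition: on every cross-section of the homogeneous strip to the left of the source,
  `∂_ν u = T u` with `T u = ∑ i β_n u_n X_n` the Dirichlet-to-Neumann map and `∂_ν = -∂_z`; that is,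
  `u_n' = -i β_n u_n` for every mode `n ≥ 1`. -/
  outgoing : ∀ n : ℕ, 1 ≤ n → ∀ z < min L s.1,
    HasDerivAt (coeff D u n) (-(Complex.I * beta D k n * coeff D u n z)) z

/-- `∇u · ν` at a point of a vertical array, where `ν = (-1, 0)` is the unit normal to the array that
points out of the part of the waveguide to the right of it. -/
def dnu (u : ℝ × ℝ → ℂ) (p : ℝ × ℝ) : ℂ := fderiv ℝ u p (-1, 0)

/-- The integrand `conj(G(x_r, s)) ∂_ν G(x_r, y) - G(x_r, y) conj(∂_ν G(x_r, s))`, `x_r = (z_a, x)`. -/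
def khIntegrand (za : ℝ) (G : ℝ × ℝ → ℝ × ℝ → ℂ) (s y : ℝ × ℝ) (x : ℝ) : ℂ :=
  conj (G (za, x) s) * dnu (fun p => G p y) (za, x)
    - G (za, x) y * conj (dnu (fun p => G p s) (za, x))

/-- The boundary functional `I(y)` of the full-aperture array `{z_a} × [0, D]`, for a source at `s`. -/
def khFunctional (D za : ℝ) (G : ℝ × ℝ → ℝ × ℝ → ℂ) (s y : ℝ × ℝ) : ℂ :=
  ∫ x in (0 : ℝ)..D, khIntegrand za G s y x

/-- `G_n(z_a, y) = ∫₀ᴰ G((z_a, x), y) X_n(x) dx`. -/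
def greenCoeff (D za : ℝ) (G : ℝ × ℝ → ℝ × ℝ → ℂ) (n : ℕ) (y : ℝ × ℝ) : ℂ :=
  coeff D (fun p => G p y) n za

/-- Passive array data: the field at `(z_a, x)` due to the point source at `s`. -/
def passiveData (za : ℝ) (G : ℝ × ℝ → ℝ × ℝ → ℂ) (s : ℝ × ℝ) (x : ℝ) : ℂ := G (za, x) s

/-- Projection of the passive data on the mode `n`. -/
def passiveQ (D za : ℝ) (G : ℝ × ℝ → ℝ × ℝ → ℂ) (s : ℝ × ℝ) (n : ℕ) : ℂ :=
  ∫ x in (0 : ℝ)..D, passiveData za G s x * (X D n x : ℂ)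

/-- The passive imaging functional `∑_{n ≤ M} β_n conj(Q_n) G_n(z_a, y)`. -/
def passiveImage (D k za : ℝ) (M : ℕ) (G : ℝ × ℝ → ℝ × ℝ → ℂ) (s y : ℝ × ℝ) : ℂ :=
  ∑ n ∈ Finset.Icc 1 M, beta D k n * conj (passiveQ D za G s n) * greenCoeff D za G n y

/-- Active array data: the signal received at `(z_a, xr)` when the point scatterer (of unit
reflectivity) at `t` is illuminated by a unit point source at `(z_a, xs)`. -/
def activeData (za : ℝ) (G : ℝ × ℝ → ℝ × ℝ → ℂ) (t : ℝ × ℝ) (xs xr : ℝ) : ℂ :=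
  G t (za, xs) * G (za, xr) t

/-- Projection of the active data on the pair of modes `n`, `m`. -/
def activeQ (D za : ℝ) (G : ℝ × ℝ → ℝ × ℝ → ℂ) (t : ℝ × ℝ) (n m : ℕ) : ℂ :=
  ∫ xr in (0 : ℝ)..D, ∫ xs in (0 : ℝ)..D,
    activeData za G t xs xr * (X D n xs : ℂ) * (X D m xr : ℂ)

/-- The active imaging functional
`∑_{n ≤ M} ∑_{m ≤ M} β_n β_m conj(Q_nm) G_n(z_a, y) G_m(z_a, y)`. -/
def activeImage (D k za : ℝ) (M : ℕ) (G : ℝ × ℝ → ℝ × ℝ → ℂ) (t y : ℝ × ℝ) : ℂ :=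
  ∑ n ∈ Finset.Icc 1 M, ∑ m ∈ Finset.Icc 1 M,
    beta D k n * beta D k m * conj (activeQ D za G t n m)
      * greenCoeff D za G n y * greenCoeff D za G m y

end Waveguide

end

/-! The theorem is Green's second identity for two fields driven by point charges. Let `p` have
charge `a` at `s` and `q` charge `b` at `y`, both with Dirichlet conditions. If the flux `∫₀ᴰ (q ∂_z
p - p ∂_z q) dx` takes the same value `W` on all cross-sections to the left of `L` and of the
sources, then `W = a q(s) - b p(y)` (`IsField.flux_eq`). Three choices of the pair give everything.

For `p = G(·,s)`, `q = G(·,y)` both fields are outgoing, each mode is multiplied by the same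
exponent under `∂_z`, and `W = 0`: this is reciprocity (`green_symm`). For `p = conj G(·,s)`, a
solution of the same equation because `k` and `η` are real, `W` is the boundary functional, so it
equals `G(s,y) - conj G(y,s)` (`khFunctional_eq`). Its modal form (`IsGreen.flux_conj`) keeps only
propagating modes, since evanescent exponents are real and cancel against their conjugates. For `y =
s`, the logarithm in `G - conj G` cancels, and this difference extends to a continuous source-free
field; its flux against `G(·,s)` gives its value at `s` (`IsField.flux_eq_of_continuousOn`,
`tendsto_im_green`). Active imaging reduces to passive imaging: by reciprocity the active data
factor, and the double sum is a square.

The closed end of the guide is an arbitrary bounded open set and `η` is only bounded and measurable,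
so Green's identity has to be proved weakly. Testing the equation of `P` with `χ Q` and conversely,
and subtracting, leaves `∫ ∇χ·(Q∇P - P∇Q) = 0` for cutoffs `χ` supported away from the sources
(`IsH10.integral_flux_eq_zero`). With `χ` a step in range minus bumps at the sources, the step
yields `W` averaged over cross-sections and the bumps yield the source terms
(`IsField.exists_flux`). A source term is computed by mollifying the field that is regular there, so
that it becomes a legitimate test function for the singular one (`integral_flux_source`).

On the array, classical derivatives come from the modes and not from elliptic regularity: the
radiation condition is an ODE for each sine coefficient, so an `L²` slice determines an
exponentially convergent series to its left, which is identified with `G` by completeness of the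
sines and continuity (`IsGreen.exists_eq_modalSum`). -/

namespace Waveguide

/-! ### The sine basis of the cross-section -/

lemma X_zero (D x : ℝ) : X D 0 x = 0 := by simp [X]

lemma abs_X_le (D : ℝ) (n : ℕ) (x : ℝ) : |X D n x| ≤ √(2 / D) := by
  rw [X, abs_mul, abs_of_nonneg (Real.sqrt_nonneg _)]
  exact mul_le_of_le_one_right (Real.sqrt_nonneg _) (Real.abs_sin_le_one _)

@[fun_prop]
lemma continuous_X (D : ℝ) (n : ℕ) : Continuous (X D n) := by unfold X; fun_prop

lemma integral_cos_int_mul {D : ℝ} (hD : 0 < D) (j : ℤ) :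
    ∫ x in (0 : ℝ)..D, Real.cos (j * Real.pi * x / D) = if j = 0 then D else 0 := by
  split_ifs with h
  · simp [h]
  · have hj : (j : ℝ) ≠ 0 := by exact_mod_cast h
    have hne : (j : ℝ) * Real.pi / D ≠ 0 := by positivity
    have : ∀ x : ℝ, Real.cos (j * Real.pi * x / D) = Real.cos (j * Real.pi / D * x) := by
      intro x; congr 1; ring
    simp_rw [this]
    rw [intervalIntegral.integral_comp_mul_left (fun x => Real.cos x) hne, integral_cos,
      div_mul_cancel₀ _ hD.ne', Real.sin_int_mul_pi]
    simp

lemma integral_X_mul_X {D : ℝ} (hD : 0 < D) (n m : ℕ) :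
    ∫ x in (0 : ℝ)..D, X D n x * X D m x = if n = m ∧ n ≠ 0 then 1 else 0 := by
  have key : ∀ x, X D n x * X D m x = (1 / D) * (Real.cos (((n : ℤ) - m : ℤ) * Real.pi * x / D)
      - Real.cos (((n : ℤ) + m : ℤ) * Real.pi * x / D)) := by
    intro x
    have e1 : (((n : ℤ) - m : ℤ) : ℝ) * Real.pi * x / D
      = n * Real.pi * x / D - m * Real.pi * x / D := by push_cast; ring
    have e2 : (((n : ℤ) + m : ℤ) : ℝ) * Real.pi * x / D
      = n * Real.pi * x / D + m * Real.pi * x / D := by push_cast; ring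
    rw [e1, e2, Real.cos_sub, Real.cos_add]
    have h2 : √(2 / D) * √(2 / D) = 2 / D := Real.mul_self_sqrt (by positivity)
    unfold X
    linear_combination (Real.sin (n * Real.pi * x / D) * Real.sin (m * Real.pi * x / D)) * h2
  simp_rw [key]
  rw [intervalIntegral.integral_const_mul, intervalIntegral.integral_sub
    (by apply Continuous.intervalIntegrable; fun_prop)
    (by apply Continuous.intervalIntegrable; fun_prop),
    integral_cos_int_mul hD, integral_cos_int_mul hD]
  by_cases h : n = m
  · subst h
    by_cases h0 : n = 0
    · simp [h0]
    · have : ¬ ((n : ℤ) + n = 0) := by omega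
      simp [h0, this, hD.ne']
  · have h1 : ¬ ((n : ℤ) - m = 0) := by omega
    have h2 : ¬ ((n : ℤ) + m = 0) := by omega
    simp [h, h1, h2]

/-- A square-integrable function on `(0, D)` all of whose sine coefficients vanish is zero. -/
lemma ae_eq_zero_of_sine_coeff_eq_zero {D : ℝ} (hD : 0 < D) {f : ℝ → ℂ}
    (hf : MemLp f 2 (volume.restrict (Ioc 0 D)))
    (h : ∀ n : ℕ, ∫ x in (0 : ℝ)..D, f x * (X D n x : ℂ) = 0) :
    f =ᵐ[volume.restrict (Ioc 0 D)] 0 := by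
  -- The odd extension to `(-D, D]`. Its Fourier coefficients are multiples of the sine coefficients
  -- of `f`, so completeness of the exponentials transfers to the sines.
  set g : ℝ → ℂ := fun x => if 0 < x then f x else -f (-x) with hg
  have hab : -D < D := by linarith
  have hg1 : EqOn g f (Ioc 0 D) := fun x hx => by simp [hg, hx.1]
  have hg2 : EqOn g (fun x => -f (-x)) (Ioc (-D) 0) := fun x hx => by simp [hg, not_lt.2 hx.2]
  have hIoc : Ioc (-D) D = Ioc (-D) 0 ∪ Ioc 0 D := (Ioc_union_Ioc_eq_Ioc (by linarith) hD.le).symm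
  have hneg : MemLp (fun x => f (-x)) 2 (volume.restrict (Ioc (-D) 0)) := by
    -- The endpoints are exchanged, up to a null set, so that the preimage under negation is exactly
    -- `(-D, 0]`.
    have hf' : MemLp f 2 (volume.restrict (Ico 0 D)) := by
      rw [Measure.restrict_congr_set Ico_ae_eq_Ioc]; exact hf
    have := hf'.comp_measurePreserving ((Measure.measurePreserving_neg
      (volume : Measure ℝ)).restrict_preimage (measurableSet_Ico (a := (0 : ℝ)) (b := D)))
    have h2 : (Neg.neg : ℝ → ℝ) ⁻¹' (Ico 0 D) = Ioc (-D) 0 := by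
      ext x; simp only [mem_preimage, mem_Ico, mem_Ioc]; constructor <;> intro hx <;>
        constructor <;> linarith [hx.1, hx.2]
    rw [h2] at this
    exact this
  have hgL : MemLp g 2 (volume.restrict (Ioc (-D) D)) := by
    have a1 : MemLp g 2 (volume.restrict (Ioc 0 D)) :=
      hf.ae_eq ((ae_restrict_iff' measurableSet_Ioc).2 (ae_of_all _ fun x hx => (hg1 hx).symm))
    have a2 : MemLp g 2 (volume.restrict (Ioc (-D) 0)) :=
      hneg.neg.ae_eq
        ((ae_restrict_iff' measurableSet_Ioc).2 (ae_of_all _ fun x hx => (hg2 hx).symm))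
    rw [hIoc]
    have am := aestronglyMeasurable_union_iff.2 ⟨a2.1, a1.1⟩
    rw [memLp_two_iff_integrable_sq_norm am]
    exact IntegrableOn.union a2.integrable_norm_pow' a1.integrable_norm_pow'
  have hfi : IntervalIntegrable f volume 0 D := by
    rw [intervalIntegrable_iff_integrableOn_Ioc_of_le hD.le]
    exact hf.integrable (by norm_num)
  have hgi : IntegrableOn g (Ioc (-D) D) := hgL.integrable (by norm_num)
  have hcoef : ∀ n : ℤ, fourierCoeffOn hab g n = 0 := by
    intro n
    rw [fourierCoeffOn_eq_integral]
    have hT : Fact (0 < D - -D) := ⟨by linarith⟩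
    have hcont : Continuous fun x : ℝ => fourier (-n) (x : AddCircle (D - -D)) :=
      (fourier (-n)).continuous.comp (AddCircle.continuous_mk' _)
    have hi1 : IntervalIntegrable (fun x : ℝ => fourier (-n) (x : AddCircle (D - -D)) • g x)
        volume (-D) 0 := by
      simp_rw [smul_eq_mul]
      refine IntervalIntegrable.continuousOn_mul ?_ hcont.continuousOn
      rw [intervalIntegrable_iff_integrableOn_Ioc_of_le (by linarith)]
      exact hgi.mono_set (by rw [hIoc]; exact subset_union_left)
    have hi2 : IntervalIntegrable (fun x : ℝ => fourier (-n) (x : AddCircle (D - -D)) • g x)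
        volume 0 D := by
      simp_rw [smul_eq_mul]
      refine IntervalIntegrable.continuousOn_mul ?_ hcont.continuousOn
      rw [intervalIntegrable_iff_integrableOn_Ioc_of_le hD.le]
      exact hgi.mono_set (by rw [hIoc]; exact subset_union_right)
    rw [← intervalIntegral.integral_add_adjacent_intervals hi1 hi2]
    have e1 : ∫ x in (-D)..0, fourier (-n) (x : AddCircle (D - -D)) • g x
        = ∫ x in (0 : ℝ)..D, fourier (-n) ((-x : ℝ) : AddCircle (D - -D)) * (-f x) := by
      have := intervalIntegral.integral_comp_neg (a := 0) (b := D)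
        (fun x => fourier (-n) ((x : ℝ) : AddCircle (D - -D)) * (-f (-x)))
      simp only [neg_neg, neg_zero] at this
      rw [this]
      refine intervalIntegral.integral_congr_ae (ae_of_all _ fun x hx => ?_)
      rw [uIoc_of_le (by linarith)] at hx
      simp only [smul_eq_mul]
      rw [hg2 hx]
    have e2 : ∫ x in (0 : ℝ)..D, fourier (-n) (x : AddCircle (D - -D)) • g x
        = ∫ x in (0 : ℝ)..D, fourier (-n) (x : AddCircle (D - -D)) * f x := by
      refine intervalIntegral.integral_congr_ae (ae_of_all _ fun x hx => ?_)
      rw [uIoc_of_le hD.le] at hx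
      simp only [smul_eq_mul]
      rw [hg1 hx]
    rw [e1, e2, ← intervalIntegral.integral_add
      (by
        refine IntervalIntegrable.continuousOn_mul hfi.neg ?_
        exact (hcont.comp continuous_neg).continuousOn)
      (IntervalIntegrable.continuousOn_mul hfi hcont.continuousOn)]
    have hsq : (√(2 / D) : ℝ) ≠ 0 := (Real.sqrt_pos.2 (by positivity)).ne'
    -- The two halves combine to `-2i sin(nπx/D) f(x)`. A negative `n` only changes the sign of the
    -- sine, which `c` absorbs together with the normalisation `√(2/D)`.
    obtain ⟨c, hc⟩ : ∃ c : ℂ, ∀ x : ℝ, fourier (-n) ((-x : ℝ) : AddCircle (D - -D)) * (-f x)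
        + fourier (-n) (x : AddCircle (D - -D)) * f x = c * (f x * (X D n.natAbs x : ℂ)) := by
      have hD' : (D : ℂ) ≠ 0 := by exact_mod_cast hD.ne'
      have hsq' : ((√(2 / D) : ℝ) : ℂ) ≠ 0 := by exact_mod_cast hsq
      have hsin : ∃ e : ℂ, ∀ x : ℝ, Complex.sin ((n : ℂ) * Real.pi * x / D)
          = e * (X D n.natAbs x : ℂ) := by
        rcases Int.natAbs_eq n with hn | hn
        · refine ⟨1 / (√(2 / D) : ℝ), fun x => ?_⟩
          have : (n : ℂ) = (n.natAbs : ℂ) := by simpa using congrArg (Int.cast (R := ℂ)) hn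
          rw [X, this]
          push_cast
          field_simp
        · refine ⟨-1 / (√(2 / D) : ℝ), fun x => ?_⟩
          have : (n : ℂ) = -(n.natAbs : ℂ) := by simpa using congrArg (Int.cast (R := ℂ)) hn
          rw [X, this, show -(n.natAbs : ℂ) * Real.pi * x / D = -(n.natAbs * Real.pi * x / D) by ring,
            Complex.sin_neg]
          push_cast
          field_simp
      obtain ⟨e, he⟩ := hsin
      refine ⟨-2 * Complex.I * e, fun x => ?_⟩
      have hx := he x
      rw [Complex.sin] at hx
      rw [fourier_coe_apply, fourier_coe_apply]
      have a1 : (2 * Real.pi * Complex.I * ((-n : ℤ) : ℂ) * ((-x : ℝ) : ℂ) / ((D - -D : ℝ) : ℂ))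
          = n * Real.pi * x / D * Complex.I := by push_cast; field_simp; ring
      have a2 : (2 * Real.pi * Complex.I * ((-n : ℤ) : ℂ) * ((x : ℝ) : ℂ) / ((D - -D : ℝ) : ℂ))
          = -(n * Real.pi * x / D) * Complex.I := by push_cast; field_simp; ring
      rw [a1, a2]
      linear_combination (-2 * Complex.I * f x) * hx
        + (Complex.exp (-(n * Real.pi * x / D) * Complex.I)
          - Complex.exp (n * Real.pi * x / D * Complex.I)) * f x * Complex.I_sq
    simp_rw [hc]
    rw [intervalIntegral.integral_const_mul, h]
    simp
  -- Parseval: vanishing coefficients force the `L²` norm of `g` to vanish.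
  have hsum := hasSum_sq_fourierCoeffOn hab hgL
  simp only [hcoef, norm_zero, ne_eq, OfNat.ofNat_ne_zero, not_false_eq_true, zero_pow] at hsum
  have h0 := hsum.unique hasSum_zero
  have hint : ∫ x in (-D)..D, ‖g x‖ ^ 2 = 0 := by
    have : (D - -D)⁻¹ ≠ 0 := inv_ne_zero (by linarith)
    rw [smul_eq_mul] at h0
    exact (mul_eq_zero.1 h0).resolve_left this
  rw [intervalIntegral.integral_of_le hab.le, integral_eq_zero_iff_of_nonneg
    (fun x => by positivity) hgL.integrable_norm_pow'] at hint
  have hint2 : (fun x => ‖g x‖ ^ 2) =ᵐ[volume.restrict (Ioc 0 D)] 0 :=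
    (ae_mono (Measure.restrict_mono (by rw [hIoc]; exact subset_union_right) le_rfl)) hint
  filter_upwards [hint2, ae_restrict_mem measurableSet_Ioc] with x hx hx2
  have : g x = 0 := by simpa using hx
  rw [← hg1 hx2, this]; rfl

/-- Bilinear Parseval identity for absolutely convergent sine series. -/
lemma hasSum_integral_sine_mul {D : ℝ} (hD : 0 < D) {a b : ℕ → ℂ} (ha : Summable fun n => ‖a n‖)
    (hb : Summable fun n => ‖b n‖) (h0 : a 0 = 0) :
    ∫ x in (0 : ℝ)..D, (∑' n, a n * (X D n x : ℂ)) * (∑' n, b n * (X D n x : ℂ))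
      = ∑' n, a n * b n := by
  have hbd : ∀ (c : ℕ → ℂ) (n : ℕ) (x : ℝ), ‖c n * (X D n x : ℂ)‖ ≤ ‖c n‖ * √(2 / D) := by
    intro c n x
    rw [norm_mul, Complex.norm_real, Real.norm_eq_abs]
    exact mul_le_mul_of_nonneg_left (abs_X_le D n x) (norm_nonneg _)
  have hsm : ∀ (c : ℕ → ℂ), (Summable fun n => ‖c n‖) → ∀ x : ℝ,
      Summable fun n => ‖c n * (X D n x : ℂ)‖ := fun c hc x =>
    Summable.of_nonneg_of_le (fun _ => norm_nonneg _) (hbd c · x) (hc.mul_right _)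
  have hprod : ∀ x : ℝ, (∑' n, a n * (X D n x : ℂ)) * (∑' n, b n * (X D n x : ℂ))
      = ∑' q : ℕ × ℕ, a q.1 * (X D q.1 x : ℂ) * (b q.2 * (X D q.2 x : ℂ)) := fun x =>
    tsum_mul_tsum_of_summable_norm (hsm a ha x) (hsm b hb x)
  simp_rw [hprod]
  -- The sines are uniformly bounded, so this product series dominates the double series and allows
  -- termwise integration.
  have hsab : Summable fun q : ℕ × ℕ => ‖a q.1‖ * ‖b q.2‖ :=
    (ha.mul_of_nonneg hb (fun _ => norm_nonneg _) (fun _ => norm_nonneg _))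
  have := intervalIntegral.hasSum_integral_of_dominated_convergence (μ := volume) (a := 0) (b := D)
    (F := fun (q : ℕ × ℕ) (x : ℝ) => a q.1 * (X D q.1 x : ℂ) * (b q.2 * (X D q.2 x : ℂ)))
    (f := fun x => ∑' q : ℕ × ℕ, a q.1 * (X D q.1 x : ℂ) * (b q.2 * (X D q.2 x : ℂ)))
    (fun q _ => (‖a q.1‖ * √(2 / D)) * (‖b q.2‖ * √(2 / D)))
    (fun q => by apply Continuous.aestronglyMeasurable; fun_prop)
    (fun q => ae_of_all _ fun x _ => by
      rw [norm_mul]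
      exact mul_le_mul (hbd a _ x) (hbd b _ x) (norm_nonneg _) (by positivity))
    (ae_of_all _ fun x _ => (hsab.mul_right (√(2 / D) * √(2 / D))).congr fun q => by ring)
    (by simp)
    (ae_of_all _ fun x _ => by
      refine Summable.hasSum (Summable.of_norm ?_)
      refine Summable.of_nonneg_of_le (fun _ => norm_nonneg _) (fun q => ?_)
        (hsab.mul_right (√(2 / D) * √(2 / D)))
      rw [norm_mul]
      calc _ ≤ (‖a q.1‖ * √(2 / D)) * (‖b q.2‖ * √(2 / D)) :=
            mul_le_mul (hbd a _ x) (hbd b _ x) (norm_nonneg _) (by positivity)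
        _ = _ := by ring)
  rw [← this.tsum_eq]
  have hterm : ∀ q : ℕ × ℕ, ∫ x in (0 : ℝ)..D, a q.1 * (X D q.1 x : ℂ) * (b q.2 * (X D q.2 x : ℂ))
      = if q.1 = q.2 then a q.1 * b q.2 else 0 := by
    intro q
    have : ∀ x : ℝ, a q.1 * (X D q.1 x : ℂ) * (b q.2 * (X D q.2 x : ℂ))
        = a q.1 * b q.2 * ((X D q.1 x * X D q.2 x : ℝ) : ℂ) := by intro x; push_cast; ring
    simp_rw [this]
    rw [intervalIntegral.integral_const_mul, intervalIntegral.integral_ofReal, integral_X_mul_X hD]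
    by_cases h : q.1 = q.2
    -- `X D 0` is the zero function, not a unit vector: the diagonal formula holds at index `0` only
    -- because `a 0 = 0`.
    · by_cases h1 : q.1 = 0
      · rw [h1, h0]; simp
      · simp [h, h ▸ h1]
    · simp [h]
  simp_rw [hterm]
  have hinj : Function.Injective (fun n : ℕ => (n, n)) := fun n m h => (Prod.ext_iff.1 h).1
  rw [← hinj.tsum_eq (f := fun q : ℕ × ℕ => if q.1 = q.2 then a q.1 * b q.2 else 0)]
  · simp
  · intro q hq
    by_cases h : q.1 = q.2
    · exact ⟨q.1, Prod.ext rfl h⟩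
    · simp [h] at hq

/-! ### Modal series -/

/-- Longitudinal exponents: the modes of an outgoing field to the left of its source satisfy
`u_n' = modeExp n * u_n`. -/
noncomputable def modeExp (D k : ℝ) (n : ℕ) : ℂ := -(Complex.I * beta D k n)

/-- A propagating mode has real part `0`, but then `nπ/D < |k|`; for an evanescent one, `√μ_n ≤
√(μ_n - k²) + |k|`. One linear lower bound thus covers both kinds and gives decay like `exp(-δnπ/D)`
at distance `δ`. -/
lemma le_modeExp_re {D : ℝ} (hD : 0 < D) (k : ℝ) (n : ℕ) :
    n * Real.pi / D - |k| ≤ (modeExp D k n).re := by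
  have h0 : 0 ≤ n * Real.pi / D := by positivity
  unfold modeExp beta
  split_ifs with h
  · have : n * Real.pi / D < |k| := by
      have := Real.sqrt_lt_sqrt (by unfold mu; positivity) h
      rwa [mu, Real.sqrt_sq h0, Real.sqrt_sq_eq_abs] at this
    simp
    linarith
  · have h1 : k ^ 2 ≤ mu D n := not_lt.1 h
    have : n * Real.pi / D ≤ √(mu D n - k ^ 2) + |k| := by
      rw [← Real.sqrt_sq h0]
      rw [Real.sqrt_le_left (by positivity)]
      have h2 := Real.sq_sqrt (sub_nonneg.2 h1)
      have h3 := sq_abs k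
      have h4 : 0 ≤ √(mu D n - k ^ 2) * |k| := by positivity
      unfold mu at h2 h4 ⊢
      nlinarith
    simp
    linarith

lemma modeExp_re_nonneg (D k : ℝ) (n : ℕ) : 0 ≤ (modeExp D k n).re := by
  unfold modeExp beta
  split_ifs with h <;> simp

lemma norm_modeExp_le {D : ℝ} (hD : 0 < D) (k : ℝ) (n : ℕ) :
    ‖modeExp D k n‖ ≤ |k| + n * Real.pi / D := by
  have h0 : 0 ≤ n * Real.pi / D := by positivity
  have hk := abs_nonneg k
  unfold modeExp beta
  split_ifs with h
  · have : √(k ^ 2 - mu D n) ≤ |k| := by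
      rw [← Real.sqrt_sq_eq_abs]
      exact Real.sqrt_le_sqrt (by unfold mu; nlinarith [sq_nonneg (n * Real.pi / D)])
    simp [abs_of_nonneg (Real.sqrt_nonneg _)]
    linarith
  · have : √(mu D n - k ^ 2) ≤ n * Real.pi / D := by
      conv_rhs => rw [← Real.sqrt_sq h0]
      exact Real.sqrt_le_sqrt (by unfold mu; nlinarith [sq_nonneg k])
    simp [abs_of_nonneg (Real.sqrt_nonneg _)]
    linarith

/-- The majorant of the modal series and of its gradient. -/
noncomputable def modalBound (D k δ : ℝ) (n : ℕ) : ℝ :=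
  (1 + |k| + 2 * (n * Real.pi / D)) * Real.exp (δ * |k|) * Real.exp (-(δ * Real.pi / D) * n)

lemma summable_modalBound {D : ℝ} (hD : 0 < D) (k : ℝ) {δ : ℝ} (hδ : 0 < δ) :
    Summable (modalBound D k δ) := by
  have hr : 0 < δ * Real.pi / D := by positivity
  have h0 := Real.summable_pow_mul_exp_neg_nat_mul 0 hr
  have h1 := Real.summable_pow_mul_exp_neg_nat_mul 1 hr
  refine ((h0.mul_left ((1 + |k|) * Real.exp (δ * |k|))).add
    (h1.mul_left (2 * (Real.pi / D) * Real.exp (δ * |k|)))).congr fun n => ?_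
  unfold modalBound
  ring

lemma modalBound_nonneg {D : ℝ} (hD : 0 < D) (k δ : ℝ) (n : ℕ) : 0 ≤ modalBound D k δ n := by
  unfold modalBound; positivity

/-- The weight dominates all the factors met later: `1` for the term itself, `|k| + nπ/D` for its
range derivative and `nπ/D` for its cross-range derivative. -/
lemma norm_exp_modeExp_le {D : ℝ} (hD : 0 < D) (k : ℝ) {δ t : ℝ} (hδ : 0 < δ) (ht : t ≤ -δ)
    (n : ℕ) : (1 + |k| + 2 * (n * Real.pi / D)) * ‖Complex.exp (modeExp D k n * t)‖
      ≤ modalBound D k δ n := by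
  have h0 : 0 ≤ n * Real.pi / D := by positivity
  rw [Complex.norm_exp, modalBound, mul_assoc, ← Real.exp_add]
  refine mul_le_mul_of_nonneg_left (Real.exp_le_exp.2 ?_) (by positivity)
  have h1 := le_modeExp_re hD k n
  have h2 := modeExp_re_nonneg D k n
  have : (modeExp D k n * t).re = (modeExp D k n).re * t := by simp
  rw [this]
  have h3 : (modeExp D k n).re * t ≤ (modeExp D k n).re * (-δ) :=
    mul_le_mul_of_nonneg_left ht h2
  have h4 : (n * Real.pi / D - |k|) * δ ≤ (modeExp D k n).re * δ :=
    mul_le_mul_of_nonneg_right h1 hδ.le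
  have h5 : -(δ * Real.pi / D) * n = -(n * Real.pi / D * δ) := by ring
  rw [h5]
  nlinarith

/-- A mode with amplitude `c` at range `z'`. -/
noncomputable def modalTerm (D k z' : ℝ) (c : ℕ → ℂ) (n : ℕ) (p : ℝ × ℝ) : ℂ :=
  c n * Complex.exp (modeExp D k n * ((p.1 - z' : ℝ) : ℂ)) * (X D n p.2 : ℂ)

/-- The derivative of `modalTerm`. -/
noncomputable def modalTermDeriv (D k z' : ℝ) (c : ℕ → ℂ) (n : ℕ) (p : ℝ × ℝ) : ℝ × ℝ →L[ℝ] ℂ :=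
  (ContinuousLinearMap.fst ℝ ℝ ℝ).smulRight
      (c n * (modeExp D k n * Complex.exp (modeExp D k n * ((p.1 - z' : ℝ) : ℂ))) * (X D n p.2 : ℂ))
    + (ContinuousLinearMap.snd ℝ ℝ ℝ).smulRight
      (c n * Complex.exp (modeExp D k n * ((p.1 - z' : ℝ) : ℂ)) *
        ((√(2 / D) * (Real.cos (n * Real.pi * p.2 / D) * (n * Real.pi / D)) : ℝ) : ℂ))

lemma hasFDerivAt_modalTerm (D k z' : ℝ) (c : ℕ → ℂ) (n : ℕ) (p : ℝ × ℝ) :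
    HasFDerivAt (modalTerm D k z' c n) (modalTermDeriv D k z' c n p) p := by
  have h1 : HasDerivAt (fun z : ℝ => Complex.exp (modeExp D k n * ((z - z' : ℝ) : ℂ)))
      (modeExp D k n * Complex.exp (modeExp D k n * ((p.1 - z' : ℝ) : ℂ))) p.1 := by
    have : HasDerivAt (fun z : ℝ => modeExp D k n * ((z - z' : ℝ) : ℂ)) (modeExp D k n * 1) p.1 := by
      refine HasDerivAt.const_mul _ ?_
      have := ((hasDerivAt_id p.1).sub_const z').ofReal_comp
      simpa using this
    have := this.cexp
    rw [mul_one] at this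
    rwa [mul_comm (modeExp D k n) (Complex.exp _)]
  have h2 : HasDerivAt (fun x : ℝ => (X D n x : ℂ))
      ((√(2 / D) * (Real.cos (n * Real.pi * p.2 / D) * (n * Real.pi / D)) : ℝ) : ℂ) p.2 := by
    refine HasDerivAt.ofReal_comp ?_
    unfold X
    refine HasDerivAt.const_mul _ (HasDerivAt.sin ?_)
    have := ((hasDerivAt_id p.2).const_mul (n * Real.pi)).div_const D
    simpa using this
  have h1' := (h1.hasFDerivAt.comp p (hasFDerivAt_fst (𝕜 := ℝ) (p := p)))
  have h2' := (h2.hasFDerivAt.comp p (hasFDerivAt_snd (𝕜 := ℝ) (p := p)))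
  have := (h1'.const_mul (c n)).mul h2'
  refine this.congr_fderiv ?_
  ext
  · simp [modalTermDeriv]
    ring
  · simp [modalTermDeriv]

lemma norm_modalTerm_le {D : ℝ} (hD : 0 < D) (k z' : ℝ) {c : ℕ → ℂ} {C : ℝ} (hC : ∀ n, ‖c n‖ ≤ C)
    {δ : ℝ} (hδ : 0 < δ) (n : ℕ) {p : ℝ × ℝ} (hp : p.1 ≤ z' - δ) :
    ‖modalTerm D k z' c n p‖ ≤ C * √(2 / D) * modalBound D k δ n := by
  have hC0 : 0 ≤ C := (norm_nonneg _).trans (hC 0)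
  have h := norm_exp_modeExp_le hD k hδ (t := p.1 - z') (by linarith) n
  have h0 : 0 ≤ n * Real.pi / D := by positivity
  have h1 : ‖Complex.exp (modeExp D k n * ((p.1 - z' : ℝ) : ℂ))‖ ≤ modalBound D k δ n :=
    le_trans (le_mul_of_one_le_left (norm_nonneg _) (by nlinarith [abs_nonneg k])) h
  have h2 := abs_X_le D n p.2
  rw [modalTerm, norm_mul, norm_mul, Complex.norm_real, Real.norm_eq_abs]
  calc _ ≤ C * modalBound D k δ n * √(2 / D) :=
        mul_le_mul (mul_le_mul (hC n) h1 (norm_nonneg _) hC0) h2 (abs_nonneg _)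
          (mul_nonneg hC0 (modalBound_nonneg hD k δ n))
    _ = _ := by ring

lemma norm_modalTermDeriv_le {D : ℝ} (hD : 0 < D) (k z' : ℝ) {c : ℕ → ℂ} {C : ℝ}
    (hC : ∀ n, ‖c n‖ ≤ C) {δ : ℝ} (hδ : 0 < δ) (n : ℕ) {p : ℝ × ℝ} (hp : p.1 ≤ z' - δ) :
    ‖modalTermDeriv D k z' c n p‖ ≤ C * √(2 / D) * modalBound D k δ n := by
  have hC0 : 0 ≤ C := (norm_nonneg _).trans (hC 0)
  have h := norm_exp_modeExp_le hD k hδ (t := p.1 - z') (by linarith) n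
  set E := ‖Complex.exp (modeExp D k n * ((p.1 - z' : ℝ) : ℂ))‖ with hE
  have hE0 : 0 ≤ E := norm_nonneg _
  have h0 : 0 ≤ n * Real.pi / D := by positivity
  have hS := Real.sqrt_nonneg (2 / D)
  have h2 := abs_X_le D n p.2
  have hl := norm_modeExp_le hD k n
  have b1 : ‖(ContinuousLinearMap.fst ℝ ℝ ℝ).smulRight
      (c n * (modeExp D k n * Complex.exp (modeExp D k n * ((p.1 - z' : ℝ) : ℂ)))
        * (X D n p.2 : ℂ))‖ ≤ C * ((|k| + n * Real.pi / D) * E) * √(2 / D) := by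
    rw [ContinuousLinearMap.norm_smulRight_apply]
    calc _ ≤ 1 * _ := mul_le_mul_of_nonneg_right (ContinuousLinearMap.norm_fst_le ..) (norm_nonneg _)
      _ ≤ _ := by
        rw [one_mul, norm_mul, norm_mul, norm_mul, Complex.norm_real, Real.norm_eq_abs, ← hE]
        gcongr
        exact hC n
  have b2 : ‖(ContinuousLinearMap.snd ℝ ℝ ℝ).smulRight
      (c n * Complex.exp (modeExp D k n * ((p.1 - z' : ℝ) : ℂ)) *
        ((√(2 / D) * (Real.cos (n * Real.pi * p.2 / D) * (n * Real.pi / D)) : ℝ) : ℂ))‖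
      ≤ C * E * (√(2 / D) * (1 * (n * Real.pi / D))) := by
    rw [ContinuousLinearMap.norm_smulRight_apply]
    calc _ ≤ 1 * _ := mul_le_mul_of_nonneg_right (ContinuousLinearMap.norm_snd_le ..) (norm_nonneg _)
      _ ≤ _ := by
        rw [one_mul, norm_mul, norm_mul, Complex.norm_real, Real.norm_eq_abs, ← hE, abs_mul,
          abs_mul, abs_of_nonneg h0, abs_of_nonneg hS]
        gcongr
        · exact hC n
        · exact Real.abs_cos_le_one _
  calc _ ≤ _ := norm_add_le _ _
    _ ≤ C * ((|k| + n * Real.pi / D) * E) * √(2 / D)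
        + C * E * (√(2 / D) * (1 * (n * Real.pi / D))) := add_le_add b1 b2
    _ = C * √(2 / D) * ((|k| + 2 * (n * Real.pi / D)) * E) := by ring
    _ ≤ C * √(2 / D) * modalBound D k δ n := by
      refine mul_le_mul_of_nonneg_left (le_trans ?_ h) (mul_nonneg hC0 hS)
      nlinarith

/-- A modal series with bounded amplitudes. -/
noncomputable def modalSum (D k z' : ℝ) (c : ℕ → ℂ) (p : ℝ × ℝ) : ℂ :=
  ∑' n, modalTerm D k z' c n p

lemma isPreconnected_left (a : ℝ) : IsPreconnected {p : ℝ × ℝ | p.1 < a} := by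
  have : {p : ℝ × ℝ | p.1 < a} = Iio a ×ˢ univ := by ext; simp
  rw [this]
  exact isPreconnected_Iio.prod isPreconnected_univ

lemma isOpen_left (a : ℝ) : IsOpen {p : ℝ × ℝ | p.1 < a} :=
  isOpen_lt continuous_fst continuous_const

lemma hasFDerivAt_modalSum {D : ℝ} (hD : 0 < D) (k z' : ℝ) {c : ℕ → ℂ} {C : ℝ}
    (hC : ∀ n, ‖c n‖ ≤ C) {p : ℝ × ℝ} (hp : p.1 < z') :
    HasFDerivAt (modalSum D k z' c) (∑' n, modalTermDeriv D k z' c n p) p := by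
  -- Half the distance to `z'`: the point then lies in the open half-plane `z < z' - δ`, where the
  -- majorant is uniform.
  set δ := (z' - p.1) / 2 with hδ
  have hδ0 : 0 < δ := by rw [hδ]; linarith
  have hp' : p ∈ {p : ℝ × ℝ | p.1 < z' - δ} := by simp only [mem_ofPred_eq, hδ]; linarith
  have hs := (summable_modalBound hD k hδ0).mul_left (C * √(2 / D))
  exact hasFDerivAt_tsum_of_isPreconnected hs (isOpen_left (z' - δ)) (isPreconnected_left _)
    (fun n q _ => hasFDerivAt_modalTerm D k z' c n q)
    (fun n q hq => norm_modalTermDeriv_le hD k z' hC hδ0 n (le_of_lt hq)) hp'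
    (Summable.of_norm_bounded hs fun n => norm_modalTerm_le hD k z' hC hδ0 n (le_of_lt hp')) hp'

/-- Continuity of the derivative is what later allows weak range derivatives to be replaced by
classical ones in the strip. -/
lemma continuousOn_fderiv_modalSum {D : ℝ} (hD : 0 < D) (k z' : ℝ) {c : ℕ → ℂ} {C : ℝ}
    (hC : ∀ n, ‖c n‖ ≤ C) :
    ContinuousOn (fun p => fderiv ℝ (modalSum D k z' c) p) {p | p.1 < z'} := by
  intro p hp
  set δ := (z' - p.1) / 2 with hδ
  have hδ0 : 0 < δ := by rw [hδ]; linarith [show p.1 < z' from hp]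
  have hp' : p ∈ {p : ℝ × ℝ | p.1 < z' - δ} := by
    simp only [mem_ofPred_eq, hδ]; linarith [show p.1 < z' from hp]
  have hs := (summable_modalBound hD k hδ0).mul_left (C * √(2 / D))
  have hc : ContinuousOn (fun p => ∑' n, modalTermDeriv D k z' c n p)
      {p : ℝ × ℝ | p.1 < z' - δ} := by
    refine continuousOn_tsum (fun n => ?_) hs
      (fun n q hq => norm_modalTermDeriv_le hD k z' hC hδ0 n (le_of_lt hq))
    unfold modalTermDeriv
    apply Continuous.continuousOn
    refine Continuous.add ?_ ?_
    · exact ((ContinuousLinearMap.smulRightL ℝ (ℝ × ℝ) ℂ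
        (ContinuousLinearMap.fst ℝ ℝ ℝ)).continuous).comp (by fun_prop)
    · exact ((ContinuousLinearMap.smulRightL ℝ (ℝ × ℝ) ℂ
        (ContinuousLinearMap.snd ℝ ℝ ℝ)).continuous).comp (by fun_prop)
  refine ContinuousAt.continuousWithinAt ?_
  refine (hc.continuousAt ((isOpen_left _).mem_nhds hp')).congr ?_
  filter_upwards [(isOpen_left _).mem_nhds hp'] with q hq
  exact ((hasFDerivAt_modalSum hD k z' hC (lt_trans hq (by linarith))).fderiv).symm

lemma summable_modalTerm {D : ℝ} (hD : 0 < D) (k z' : ℝ) {c : ℕ → ℂ} {C : ℝ}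
    (hC : ∀ n, ‖c n‖ ≤ C) {z : ℝ} (hz : z < z') :
    (Summable fun n => ‖c n * Complex.exp (modeExp D k n * ((z - z' : ℝ) : ℂ))‖) ∧
    Summable fun n => ‖modeExp D k n *
      (c n * Complex.exp (modeExp D k n * ((z - z' : ℝ) : ℂ)))‖ := by
  have hC0 : 0 ≤ C := (norm_nonneg _).trans (hC 0)
  have hδ : 0 < z' - z := by linarith
  have hs := (summable_modalBound hD k hδ).mul_left C
  have key : ∀ n, (1 + |k| + 2 * (n * Real.pi / D)) *
      ‖c n * Complex.exp (modeExp D k n * ((z - z' : ℝ) : ℂ))‖ ≤ C * modalBound D k (z' - z) n := by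
    intro n
    have h := norm_exp_modeExp_le hD k hδ (t := z - z') (by linarith) n
    rw [norm_mul]
    calc _ = ‖c n‖ * ((1 + |k| + 2 * (n * Real.pi / D)) *
          ‖Complex.exp (modeExp D k n * ((z - z' : ℝ) : ℂ))‖) := by ring
      _ ≤ _ := mul_le_mul (hC n) h (by positivity) hC0
  constructor
  · refine Summable.of_nonneg_of_le (fun _ => norm_nonneg _) (fun n => le_trans ?_ (key n)) hs
    have h0 : 0 ≤ n * Real.pi / D := by positivity
    exact le_mul_of_one_le_left (norm_nonneg _) (by nlinarith [abs_nonneg k])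
  · refine Summable.of_nonneg_of_le (fun _ => norm_nonneg _) (fun n => le_trans ?_ (key n)) hs
    have h0 : 0 ≤ n * Real.pi / D := by positivity
    rw [norm_mul]
    exact mul_le_mul_of_nonneg_right ((norm_modeExp_le hD k n).trans (by linarith)) (norm_nonneg _)

lemma dz_modalSum {D : ℝ} (hD : 0 < D) (k z' : ℝ) {c : ℕ → ℂ} {C : ℝ}
    (hC : ∀ n, ‖c n‖ ≤ C) {p : ℝ × ℝ} (hp : p.1 < z') :
    dz (modalSum D k z' c) p = ∑' n, modeExp D k n *
      (c n * Complex.exp (modeExp D k n * ((p.1 - z' : ℝ) : ℂ))) * (X D n p.2 : ℂ) := by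
  have hδ0 : 0 < z' - p.1 := by linarith
  have hs := (summable_modalBound hD k hδ0).mul_left (C * √(2 / D))
  have hsum : Summable fun n => modalTermDeriv D k z' c n p :=
    Summable.of_norm_bounded hs fun n => norm_modalTermDeriv_le hD k z' hC hδ0 n (by linarith)
  rw [dz, (hasFDerivAt_modalSum hD k z' hC hp).fderiv]
  have := (ContinuousLinearMap.apply ℝ ℂ ((1, 0) : ℝ × ℝ)).map_tsum hsum
  simp only [ContinuousLinearMap.apply_apply] at this
  rw [this]
  refine tsum_congr fun n => ?_
  simp [modalTermDeriv]
  left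
  ring

/-! ### Modal expansion of the Green's function in the strip -/

/-- Bilinear Parseval with the second series reduced to the single sine `X D m`. -/
lemma integral_modalSum_mul_X {D : ℝ} (hD : 0 < D) (k z' : ℝ) {c : ℕ → ℂ} {C : ℝ}
    (hC : ∀ n, ‖c n‖ ≤ C) (h0 : c 0 = 0) {z : ℝ} (hz : z < z') (m : ℕ) :
    ∫ x in (0 : ℝ)..D, modalSum D k z' c (z, x) * (X D m x : ℂ)
      = c m * Complex.exp (modeExp D k m * ((z - z' : ℝ) : ℂ)) := by
  have hb : Summable fun n => ‖(Pi.single m 1 : ℕ → ℂ) n‖ :=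
    summable_of_ne_finset_zero (s := {m}) fun n hn => by
      simp [Finset.mem_singleton.not.1 hn]
  have := hasSum_integral_sine_mul hD (summable_modalTerm hD k z' hC hz).1 hb (by simp [h0])
  have e1 : ∀ x : ℝ, ∑' n, (Pi.single m 1 : ℕ → ℂ) n * (X D n x : ℂ) = (X D m x : ℂ) := by
    intro x
    rw [tsum_eq_single m (fun n hn => by simp [hn])]
    simp
  simp_rw [e1] at this
  have e2 : ∀ x : ℝ, modalSum D k z' c (z, x) = ∑' n, c n *
      Complex.exp (modeExp D k n * ((z - z' : ℝ) : ℂ)) * (X D n x : ℂ) := fun x => rfl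
  simp_rw [e2, this]
  rw [tsum_eq_single m (fun n hn => by simp [hn])]
  simp

section

variable {Ω : Set (ℝ × ℝ)} {L D k : ℝ} {η : ℝ × ℝ → ℝ} {s : ℝ × ℝ} {u : ℝ × ℝ → ℂ}

lemma IsTerminating.strip_mem (hΩ : IsTerminating Ω L D) {z x : ℝ} (hz : z < L)
    (hx : x ∈ Ioo 0 D) : (z, x) ∈ Ω := by
  have : (z, x) ∈ Ω ∩ {p | p.1 < L} := by rw [hΩ.strip]; exact ⟨hz, hx⟩
  exact this.1

lemma edist2_pos {p q : ℝ × ℝ} (h : p ≠ q) : 0 < edist2 p q := by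
  refine Real.sqrt_pos.2 ?_
  by_cases h1 : p.1 = q.1
  · have h2 : p.2 - q.2 ≠ 0 := fun h2 => h (Prod.ext h1 (sub_eq_zero.1 h2))
    positivity
  · have h2 : p.1 - q.1 ≠ 0 := sub_ne_zero.2 h1
    positivity

lemma continuousOn_log_edist2 (s : ℝ × ℝ) :
    ContinuousOn (fun p => ((-(1 / (2 * Real.pi)) * Real.log (edist2 p s) : ℝ) : ℂ)) {s}ᶜ := by
  refine Complex.continuous_ofReal.comp_continuousOn (continuousOn_const.mul ?_)
  refine ContinuousOn.log ?_ fun p hp => (edist2_pos hp).ne'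
  unfold edist2
  fun_prop

lemma IsGreen.continuousOn (h : IsGreen Ω L D k η s u) : ContinuousOn u (Ω \ {s}) := by
  obtain ⟨g, hg, hu⟩ := h.singularity
  refine (((continuousOn_log_edist2 s).mono fun p hp => hp.2).add
    (hg.mono sdiff_subset)).congr fun p hp => hu p hp.1 hp.2

/-- Ranges to the left of the source and of the end of the strip. -/
lemma IsGreen.continuousOn_strip (hΩ : IsTerminating Ω L D) (h : IsGreen Ω L D k η s u) :
    ContinuousOn u (Iio (min L s.1) ×ˢ Ioo 0 D) := by
  refine h.continuousOn.mono fun p hp => ⟨?_, fun hps => ?_⟩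
  · exact hΩ.strip_mem (lt_of_lt_of_le hp.1 (min_le_left _ _)) hp.2
  · have h1 : p.1 < s.1 := lt_of_lt_of_le hp.1 (min_le_right _ _)
    rw [mem_singleton_iff.1 hps] at h1
    exact lt_irrefl _ h1

lemma IsGreen.continuousOn_slice (hΩ : IsTerminating Ω L D) (h : IsGreen Ω L D k η s u) {z : ℝ}
    (hz : z < min L s.1) : ContinuousOn (fun x => u (z, x)) (Ioo 0 D) :=
  (h.continuousOn_strip hΩ).comp (by fun_prop) fun x hx => ⟨hz, hx⟩

/-- Continuity inside `Ω` says nothing at the walls. Square integrability up to them comes from the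
Dirichlet condition, applied to a cutoff that is `1` on the rectangle and vanishes near the source.
-/
lemma IsGreen.memLp_strip (hΩ : IsTerminating Ω L D) (h : IsGreen Ω L D k η s u) {a b : ℝ}
    (hb : b < min L s.1) : MemLp u 2 (volume.restrict (Ioo a b ×ˢ Ioo 0 D)) := by
  have hD := hΩ.width_pos
  by_cases hab : b ≤ a
  · simp [Ioo_eq_empty (not_lt.2 hab)]
  rw [not_le] at hab
  set N := (b - a) + D with hN
  have hN0 : 0 < N := by rw [hN]; linarith
  have hbs : b < s.1 := lt_of_lt_of_le hb (min_le_right _ _)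
  -- Balls are squares here. The inner one reaches from `b - 2N` to `b` in range and covers the
  -- rectangle; the outer one stops halfway between `b` and the range of the source.
  let χ : ContDiffBump ((b - N, D / 2) : ℝ × ℝ) :=
    ⟨N, N + (s.1 - b) / 2, hN0, by linarith⟩
  have hχ1 : ∀ p ∈ Ioo a b ×ˢ Ioo 0 D, χ p = 1 := by
    intro p hp
    refine χ.one_of_mem_closedBall ?_
    obtain ⟨⟨h1, h2⟩, h3, h4⟩ := hp
    rw [Metric.mem_closedBall, Prod.dist_eq, Real.dist_eq, Real.dist_eq]
    refine max_le (abs_le.2 ?_) (abs_le.2 ?_) <;> constructor <;> simp only [χ, hN] <;> linarith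
  have hs : s ∉ tsupport (fun p => ((χ p : ℝ) : ℂ)) := by
    intro hmem
    have hsub : tsupport (fun p => ((χ p : ℝ) : ℂ)) ⊆ tsupport (χ : ℝ × ℝ → ℝ) :=
      closure_mono fun p hp => by
        simp only [Function.mem_support, ne_eq, Complex.ofReal_eq_zero] at hp ⊢
        exact hp
    have := hsub hmem
    rw [χ.tsupport_eq, Metric.mem_closedBall, Prod.dist_eq, Real.dist_eq] at this
    have h1 := (abs_le.1 ((le_max_left _ _).trans this)).2
    simp only [χ] at h1
    linarith
  have hc : HasCompactSupport (fun p => ((χ p : ℝ) : ℂ)) :=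
    χ.hasCompactSupport.comp_left (g := fun r : ℝ => (r : ℂ)) Complex.ofReal_zero
  obtain ⟨-, -, -, -, hL, -⟩ := h.dirichlet (fun p => ((χ p : ℝ) : ℂ))
    (Complex.ofRealCLM.contDiff.comp χ.contDiff) hc hs
  have hsub : Ioo a b ×ˢ Ioo 0 D ⊆ Ω := fun p hp =>
    hΩ.strip_mem (hp.1.2.trans (lt_of_lt_of_le hb (min_le_left _ _))) hp.2
  refine (hL.mono_measure (Measure.restrict_mono hsub le_rfl)).ae_eq ?_
  filter_upwards [ae_restrict_mem (measurableSet_Ioo.prod measurableSet_Ioo)] with p hp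
  simp [hχ1 p hp]

lemma IsGreen.ae_memLp_slice (hΩ : IsTerminating Ω L D) (h : IsGreen Ω L D k η s u) {a b : ℝ}
    (hb : b < min L s.1) :
    ∀ᵐ z ∂volume.restrict (Ioo a b), MemLp (fun x => u (z, x)) 2 (volume.restrict (Ioc 0 D)) := by
  have h1 := (h.memLp_strip hΩ (a := a) hb).integrable_norm_pow (p := 2) two_ne_zero
  rw [Measure.volume_eq_prod, ← Measure.prod_restrict] at h1
  filter_upwards [h1.prod_right_ae, ae_restrict_mem measurableSet_Ioo] with z hz hzm
  rw [← restrict_Ioo_eq_restrict_Ioc]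
  rw [memLp_two_iff_integrable_sq_norm
    ((h.continuousOn_slice hΩ (hzm.2.trans hb)).aestronglyMeasurable measurableSet_Ioo)]
  exact hz

lemma coeff_zero (D : ℝ) (u : ℝ × ℝ → ℂ) (z : ℝ) : coeff D u 0 z = 0 := by
  simp [coeff, X_zero]

/-- The radiation condition is a linear ODE in range; multiplying by the integrating factor gives a
function with zero derivative. -/
lemma IsGreen.coeff_eq (h : IsGreen Ω L D k η s u) (n : ℕ) {z z' : ℝ} (hz : z < min L s.1)
    (hz' : z' < min L s.1) :
    coeff D u n z = coeff D u n z' * Complex.exp (modeExp D k n * ((z - z' : ℝ) : ℂ)) := by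
  -- The radiation condition starts at `n = 1`; the coefficient of index `0` vanishes because `X D 0
  -- = 0`.
  rcases Nat.eq_zero_or_pos n with rfl | hn
  · simp [coeff_zero]
  set F : ℝ → ℂ := fun t => coeff D u n t * Complex.exp (-modeExp D k n * (t : ℂ)) with hF
  have hder : ∀ t ∈ Iio (min L s.1), HasDerivAt F 0 t := by
    intro t ht
    have h1 := h.outgoing n hn t ht
    have h2 : HasDerivAt (fun t : ℝ => Complex.exp (-modeExp D k n * (t : ℂ)))
        (Complex.exp (-modeExp D k n * (t : ℂ)) * (-modeExp D k n * 1)) t := by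
      refine HasDerivAt.cexp (HasDerivAt.const_mul _ ?_)
      simpa using (hasDerivAt_id t).ofReal_comp
    refine (h1.mul h2).congr_deriv ?_
    unfold modeExp
    ring
  have hFe : F z = F z' :=
    (convex_Iio (min L s.1)).is_const_of_fderivWithin_eq_zero (𝕜 := ℝ)
      (fun t ht => (hder t ht).differentiableAt.differentiableWithinAt)
      (fun t ht => by
        rw [fderivWithin_of_isOpen isOpen_Iio ht]
        ext
        simp [(hder t ht).deriv]) hz hz'
  simp only [hF] at hFe
  have e : (modeExp D k n * ((z - z' : ℝ) : ℂ))
      = -modeExp D k n * (z' : ℂ) - -modeExp D k n * (z : ℂ) := by push_cast; ring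
  rw [e, Complex.exp_sub, ← mul_div_assoc, ← hFe, mul_div_assoc, div_self (Complex.exp_ne_zero _),
    mul_one]

lemma norm_coeff_le (D : ℝ) (hD : 0 < D) (u : ℝ × ℝ → ℂ) (z : ℝ)
    (hu : IntegrableOn (fun x => u (z, x)) (Ioc 0 D)) (n : ℕ) :
    ‖coeff D u n z‖ ≤ ∫ x in Ioc 0 D, ‖u (z, x)‖ * √(2 / D) := by
  rw [coeff, intervalIntegral.integral_of_le hD.le]
  refine norm_integral_le_of_norm_le (hu.norm.mul_const _) (ae_of_all _ fun x => ?_)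
  rw [norm_mul, Complex.norm_real, Real.norm_eq_abs]
  exact mul_le_mul_of_nonneg_left (abs_X_le D n x) (norm_nonneg _)

/-- To the left of the source, the Green's function is a modal series with bounded amplitudes at some
range to the right of any given one. -/
lemma IsGreen.exists_eq_modalSum (hΩ : IsTerminating Ω L D) (h : IsGreen Ω L D k η s u) {z₀ : ℝ}
    (hz₀ : z₀ < min L s.1) :
    ∃ z', z₀ < z' ∧ z' < min L s.1 ∧ (∃ C, ∀ n, ‖coeff D u n z'‖ ≤ C) ∧
      EqOn u (modalSum D k z' (fun n => coeff D u n z')) (Iio z' ×ˢ Ioo 0 D) := by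
  have hD := hΩ.width_pos
  obtain ⟨b, hb1, hb2⟩ := exists_between hz₀
  have hne : (ae (volume.restrict (Ioo z₀ b))).NeBot := by
    rw [ae_neBot, Ne, Measure.restrict_eq_zero]
    simp [hb1]
  -- By Fubini almost every slice is in `L²`, so a reference range with bounded sine coefficients
  -- exists between `z₀` and `b`.
  obtain ⟨z', hz'L, hz'm⟩ := ((h.ae_memLp_slice hΩ (a := z₀) hb2).and
    (ae_restrict_mem measurableSet_Ioo)).exists
  have hz'm2 : z' < min L s.1 := hz'm.2.trans hb2
  have hC := norm_coeff_le D hD u z' (hz'L.integrable (by norm_num))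
  set C := ∫ x in Ioc 0 D, ‖u (z', x)‖ * √(2 / D)
  set c : ℕ → ℂ := fun n => coeff D u n z' with hc
  refine ⟨z', hz'm.1, hz'm2, ⟨_, hC⟩, ?_⟩
  have hvc : ContinuousOn (modalSum D k z' c) {p | p.1 < z'} := fun p hp =>
    (hasFDerivAt_modalSum hD k z' hC hp).continuousAt.continuousWithinAt
  -- On an `L²` slice both sides have the same sine coefficients, hence agree almost everywhere, and
  -- then everywhere by continuity in `x`.
  have good : ∀ z, z < z' → MemLp (fun x => u (z, x)) 2 (volume.restrict (Ioc 0 D)) →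
      EqOn (fun x => u (z, x)) (fun x => modalSum D k z' c (z, x)) (Ioo 0 D) := by
    intro z hz hL
    have hvz : Continuous fun x => modalSum D k z' c (z, x) :=
      hvc.comp_continuous (by fun_prop) (fun x => hz)
    have hvL : MemLp (fun x => modalSum D k z' c (z, x)) 2 (volume.restrict (Ioc 0 D)) := by
      obtain ⟨B, hB⟩ := (isCompact_Icc (a := (0 : ℝ)) (b := D)).exists_bound_of_continuousOn
        hvz.continuousOn
      refine MemLp.of_bound hvz.aestronglyMeasurable B ?_
      filter_upwards [ae_restrict_mem measurableSet_Ioc] with x hx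
      exact hB x (Ioc_subset_Icc_self hx)
    have hui : IntervalIntegrable (fun x => u (z, x)) volume 0 D := by
      rw [intervalIntegrable_iff_integrableOn_Ioc_of_le hD.le]
      exact hL.integrable (by norm_num)
    have h0 := ae_eq_zero_of_sine_coeff_eq_zero hD (hL.sub hvL) (fun n => by
      have e : ∀ x, ((fun x => u (z, x)) - fun x => modalSum D k z' c (z, x)) x * (X D n x : ℂ)
          = u (z, x) * (X D n x : ℂ) - modalSum D k z' c (z, x) * (X D n x : ℂ) := fun x => by
        simp [sub_mul]
      simp_rw [e]
      rw [intervalIntegral.integral_sub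
        (hui.mul_continuousOn (by fun_prop))
        (by apply Continuous.intervalIntegrable; fun_prop),
        integral_modalSum_mul_X hD k z' hC (coeff_zero D u z') hz, sub_eq_zero]
      exact h.coeff_eq n (hz.trans hz'm2) hz'm2)
    rw [← restrict_Ioo_eq_restrict_Ioc] at h0
    refine Measure.eqOn_open_of_ae_eq (μ := volume) ?_ isOpen_Ioo
      (h.continuousOn_slice hΩ (hz.trans hz'm2)) hvz.continuousOn
    filter_upwards [h0] with x hx
    exact sub_eq_zero.1 hx
  rintro ⟨z, x⟩ ⟨hz, hx⟩
  have hae := h.ae_memLp_slice hΩ (a := z - 1) hz'm2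
  -- Only almost every slice is known to be in `L²`; at fixed `x`, continuity in range fills in the
  -- others.
  have hEq : EqOn (fun t => u (t, x)) (fun t => modalSum D k z' c (t, x)) (Ioo (z - 1) z') := by
    refine Measure.eqOn_open_of_ae_eq (μ := volume) ?_ isOpen_Ioo ?_ ?_
    · filter_upwards [hae, ae_restrict_mem measurableSet_Ioo] with t ht htm
      exact good t htm.2 ht hx
    · exact (h.continuousOn_strip hΩ).comp (by fun_prop) fun t ht => ⟨ht.2.trans hz'm2, hx⟩
    · exact hvc.comp (by fun_prop) fun t ht => ht.2
  exact hEq ⟨by linarith, hz⟩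

/-- Summability and modal expansion of the Green's function and of its range derivative. -/
lemma IsGreen.modal_expansion (hΩ : IsTerminating Ω L D) (h : IsGreen Ω L D k η s u) {z : ℝ}
    (hz : z < min L s.1) :
    (Summable fun n => ‖coeff D u n z‖) ∧ (Summable fun n => ‖modeExp D k n * coeff D u n z‖) ∧
    ∀ x ∈ Ioo 0 D, u (z, x) = ∑' n, coeff D u n z * (X D n x : ℂ) ∧
      dz u (z, x) = ∑' n, modeExp D k n * coeff D u n z * (X D n x : ℂ) ∧
      DifferentiableAt ℝ u (z, x) ∧ ContinuousAt (dz u) (z, x) := by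
  have hD := hΩ.width_pos
  obtain ⟨z', h1, h2, ⟨C, hC⟩, heq⟩ := h.exists_eq_modalSum hΩ hz
  have hco : ∀ n, coeff D u n z' * Complex.exp (modeExp D k n * ((z - z' : ℝ) : ℂ))
      = coeff D u n z := fun n => (h.coeff_eq n hz h2).symm
  have hs := summable_modalTerm hD k z' hC h1
  simp_rw [hco] at hs
  refine ⟨hs.1, hs.2, fun x hx => ?_⟩
  have hU : IsOpen (Iio z' ×ˢ Ioo 0 D) := isOpen_Iio.prod isOpen_Ioo
  have hmem : (z, x) ∈ Iio z' ×ˢ Ioo 0 D := ⟨h1, hx⟩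
  have hev : ∀ p ∈ Iio z' ×ˢ Ioo 0 D, u =ᶠ[𝓝 p] modalSum D k z' (fun n => coeff D u n z') :=
    fun p hp => heq.eventuallyEq_of_mem (hU.mem_nhds hp)
  refine ⟨?_, ?_, ?_, ?_⟩
  · rw [heq hmem, modalSum]
    simp_rw [modalTerm, hco]
  · rw [dz, (hev _ hmem).fderiv_eq]
    change dz _ _ = _
    rw [dz_modalSum hD k z' hC h1]
    simp_rw [hco]
  · exact (hasFDerivAt_modalSum hD k z' hC h1).differentiableAt.congr_of_eventuallyEq (hev _ hmem)
  · have hc : ContinuousAt (dz (modalSum D k z' (fun n => coeff D u n z'))) (z, x) :=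
      ((continuousOn_fderiv_modalSum hD k z' hC).continuousAt ((isOpen_left z').mem_nhds h1)).clm_apply
        continuousAt_const
    refine hc.congr ?_
    filter_upwards [hU.mem_nhds hmem] with p hp
    rw [dz, dz, (hev p hp).fderiv_eq]

end

/-! ### Test functions and `H¹₀` -/

lemma dz_mul {f g : ℝ × ℝ → ℂ} {p : ℝ × ℝ} (hf : DifferentiableAt ℝ f p)
    (hg : DifferentiableAt ℝ g p) : dz (fun q => f q * g q) p = dz f p * g p + f p * dz g p := by
  have := (hf.hasFDerivAt.mul hg.hasFDerivAt).fderiv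
  simp only [dz]
  erw [this]
  simp
  ring

lemma dx_mul {f g : ℝ × ℝ → ℂ} {p : ℝ × ℝ} (hf : DifferentiableAt ℝ f p)
    (hg : DifferentiableAt ℝ g p) : dx (fun q => f q * g q) p = dx f p * g p + f p * dx g p := by
  have := (hf.hasFDerivAt.mul hg.hasFDerivAt).fderiv
  simp only [dx]
  erw [this]
  simp
  ring

lemma dz_add {f g : ℝ × ℝ → ℂ} {p : ℝ × ℝ} (hf : DifferentiableAt ℝ f p)
    (hg : DifferentiableAt ℝ g p) : dz (fun q => f q + g q) p = dz f p + dz g p := by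
  unfold dz
  rw [fderiv_fun_add hf hg]
  rfl

lemma dx_add {f g : ℝ × ℝ → ℂ} {p : ℝ × ℝ} (hf : DifferentiableAt ℝ f p)
    (hg : DifferentiableAt ℝ g p) : dx (fun q => f q + g q) p = dx f p + dx g p := by
  unfold dx
  rw [fderiv_fun_add hf hg]
  rfl

lemma contDiff_fderiv_apply {f : ℝ × ℝ → ℂ} (hf : ContDiff ℝ ∞ f) (v : ℝ × ℝ) :
    ContDiff ℝ ∞ (fun p => fderiv ℝ f p v) :=
  (hf.fderiv_right (m := ∞) le_rfl).clm_apply contDiff_const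

lemma contDiff_dz {f : ℝ × ℝ → ℂ} (hf : ContDiff ℝ ∞ f) : ContDiff ℝ ∞ (dz f) :=
  contDiff_fderiv_apply hf _

lemma contDiff_dx {f : ℝ × ℝ → ℂ} (hf : ContDiff ℝ ∞ f) : ContDiff ℝ ∞ (dx f) :=
  contDiff_fderiv_apply hf _

lemma differentiable_of_contDiff {f : ℝ × ℝ → ℂ} (hf : ContDiff ℝ ∞ f) : Differentiable ℝ f :=
  hf.differentiable (by simp)

lemma lap_mul {f g : ℝ × ℝ → ℂ} (hf : ContDiff ℝ ∞ f) (hg : ContDiff ℝ ∞ g) (p : ℝ × ℝ) :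
    lap (fun q => f q * g q) p
      = lap f p * g p + 2 * (dz f p * dz g p + dx f p * dx g p) + f p * lap g p := by
  have df := differentiable_of_contDiff hf
  have dg := differentiable_of_contDiff hg
  have e1 : dz (fun q => f q * g q) = fun q => dz f q * g q + f q * dz g q :=
    funext fun q => dz_mul (df q) (dg q)
  have e2 : dx (fun q => f q * g q) = fun q => dx f q * g q + f q * dx g q :=
    funext fun q => dx_mul (df q) (dg q)
  have dfz := differentiable_of_contDiff (contDiff_dz hf)
  have dfx := differentiable_of_contDiff (contDiff_dx hf)
  have dgz := differentiable_of_contDiff (contDiff_dz hg)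
  have dgx := differentiable_of_contDiff (contDiff_dx hg)
  rw [lap, e1, e2, dz_add ((dfz p).fun_mul (dg p)) ((df p).fun_mul (dgz p)),
    dx_add ((dfx p).fun_mul (dg p)) ((df p).fun_mul (dgx p)), dz_mul (dfz p) (dg p), dz_mul (df p) (dgz p), dx_mul (dfx p) (dg p),
    dx_mul (df p) (dgx p), lap, lap]
  ring

lemma dz_eq_zero_of_notMem {f : ℝ × ℝ → ℂ} {p : ℝ × ℝ} (h : p ∉ tsupport f) : dz f p = 0 := by
  rw [dz, fderiv_of_notMem_tsupport ℝ h]; rfl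

lemma dx_eq_zero_of_notMem {f : ℝ × ℝ → ℂ} {p : ℝ × ℝ} (h : p ∉ tsupport f) : dx f p = 0 := by
  rw [dx, fderiv_of_notMem_tsupport ℝ h]; rfl

lemma tsupport_dz_subset (f : ℝ × ℝ → ℂ) : tsupport (dz f) ⊆ tsupport f :=
  closure_minimal (fun _ hp => by_contra fun h => hp (dz_eq_zero_of_notMem h)) (isClosed_tsupport f)

lemma tsupport_dx_subset (f : ℝ × ℝ → ℂ) : tsupport (dx f) ⊆ tsupport f :=
  closure_minimal (fun _ hp => by_contra fun h => hp (dx_eq_zero_of_notMem h)) (isClosed_tsupport f)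

/-! ### Calculus of test functions. -/

namespace IsTest

variable {Ω V : Set (ℝ × ℝ)} {φ χ : ℝ × ℝ → ℂ}

lemma dz (h : IsTest Ω φ) : IsTest Ω (dz φ) :=
  ⟨contDiff_dz h.smooth, h.compact.of_isClosed_subset (isClosed_tsupport _) (tsupport_dz_subset φ),
    (tsupport_dz_subset φ).trans h.support⟩

lemma dx (h : IsTest Ω φ) : IsTest Ω (dx φ) :=
  ⟨contDiff_dx h.smooth, h.compact.of_isClosed_subset (isClosed_tsupport _) (tsupport_dx_subset φ),
    (tsupport_dx_subset φ).trans h.support⟩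

lemma mono (h : IsTest Ω φ) (hV : Ω ⊆ V) : IsTest V φ := ⟨h.smooth, h.compact, h.support.trans hV⟩

lemma smul_contDiff (h : IsTest Ω φ) (hχ : ContDiff ℝ ∞ χ) (hV : tsupport χ ⊆ V) :
    IsTest (Ω ∩ V) (fun p => χ p * φ p) :=
  ⟨hχ.mul h.smooth, h.compact.mul_left, subset_inter ((tsupport_mul_subset_right).trans h.support)
    ((tsupport_mul_subset_left).trans hV)⟩

lemma continuous (h : IsTest Ω φ) : Continuous φ := h.smooth.continuous

lemma memLp (h : IsTest Ω φ) {μ : Measure (ℝ × ℝ)} [IsFiniteMeasureOnCompacts μ] :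
    MemLp φ 2 μ := h.continuous.memLp_of_hasCompactSupport h.compact

lemma eq_zero (h : IsTest Ω φ) {p : ℝ × ℝ} (hp : p ∉ Ω) : φ p = 0 :=
  image_eq_zero_of_notMem_tsupport fun h' => hp (h.support h')

lemma exists_bound (h : IsTest Ω φ) : ∃ C, ∀ p, ‖φ p‖ ≤ C :=
  h.compact.exists_bound_of_continuous h.continuous

lemma mul_memLp (h : IsTest Ω φ) {μ : Measure (ℝ × ℝ)} {f : ℝ × ℝ → ℂ} (hf : MemLp f 2 μ) :
    MemLp (fun p => φ p * f p) 2 μ := by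
  obtain ⟨C, hC⟩ := h.exists_bound
  exact hf.of_le_mul (c := C) (h.continuous.aestronglyMeasurable.mul hf.1)
    (ae_of_all _ fun p => by
      rw [norm_mul]; exact mul_le_mul_of_nonneg_right (hC p) (norm_nonneg _))

end IsTest

lemma setIntegral_dz_mul_add {Ω : Set (ℝ × ℝ)} {φ ψ : ℝ × ℝ → ℂ} (hφ : IsTest Ω φ)
    (hψ : IsTest univ ψ) : ∫ p in Ω, (dz ψ p * φ p + ψ p * dz φ p) = 0 := by
  rw [setIntegral_eq_integral_of_forall_compl_eq_zero fun p hp => by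
    rw [hφ.eq_zero hp, hφ.dz.eq_zero hp]; simp]
  have i1 : Integrable (fun p => dz ψ p * φ p) :=
    (hψ.dz.continuous.mul hφ.continuous).integrable_of_hasCompactSupport hφ.compact.mul_left
  have i2 : Integrable (fun p => ψ p * dz φ p) :=
    (hψ.continuous.mul hφ.dz.continuous).integrable_of_hasCompactSupport hφ.dz.compact.mul_left
  have i3 : Integrable (fun p => ψ p * φ p) :=
    (hψ.continuous.mul hφ.continuous).integrable_of_hasCompactSupport hφ.compact.mul_left
  rw [integral_add i1 i2]
  have := integral_mul_fderiv_eq_neg_fderiv_mul_of_integrable (μ := (volume : Measure (ℝ × ℝ)))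
    (v := ((1, 0) : ℝ × ℝ)) i1 i2 i3 (fun p _ => differentiable_of_contDiff hψ.smooth p)
    (fun p _ => differentiable_of_contDiff hφ.smooth p)
  simp only [dz] at this ⊢
  rw [this, add_neg_cancel]

lemma setIntegral_dx_mul_add {Ω : Set (ℝ × ℝ)} {φ ψ : ℝ × ℝ → ℂ} (hφ : IsTest Ω φ)
    (hψ : IsTest univ ψ) : ∫ p in Ω, (dx ψ p * φ p + ψ p * dx φ p) = 0 := by
  rw [setIntegral_eq_integral_of_forall_compl_eq_zero fun p hp => by
    rw [hφ.eq_zero hp, hφ.dx.eq_zero hp]; simp]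
  have i1 : Integrable (fun p => dx ψ p * φ p) :=
    (hψ.dx.continuous.mul hφ.continuous).integrable_of_hasCompactSupport hφ.compact.mul_left
  have i2 : Integrable (fun p => ψ p * dx φ p) :=
    (hψ.continuous.mul hφ.dx.continuous).integrable_of_hasCompactSupport hφ.dx.compact.mul_left
  have i3 : Integrable (fun p => ψ p * φ p) :=
    (hψ.continuous.mul hφ.continuous).integrable_of_hasCompactSupport hφ.compact.mul_left
  rw [integral_add i1 i2]
  have := integral_mul_fderiv_eq_neg_fderiv_mul_of_integrable (μ := (volume : Measure (ℝ × ℝ)))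
    (v := ((0, 1) : ℝ × ℝ)) i1 i2 i3 (fun p _ => differentiable_of_contDiff hψ.smooth p)
    (fun p _ => differentiable_of_contDiff hφ.smooth p)
  simp only [dx] at this ⊢
  rw [this, add_neg_cancel]

lemma memLp_two_mul_integrable {μ : Measure (ℝ × ℝ)} {f g : ℝ × ℝ → ℂ} (hf : MemLp f 2 μ)
    (hg : MemLp g 2 μ) : Integrable (fun p => f p * g p) μ := hf.integrable_mul hg

lemma integral_mul_add_mul_add_mul {μ : Measure (ℝ × ℝ)} {f₀ f₁ f₂ g₀ g₁ g₂ : ℝ × ℝ → ℂ}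
    (hf₀ : MemLp f₀ 2 μ) (hf₁ : MemLp f₁ 2 μ) (hf₂ : MemLp f₂ 2 μ) (hg₀ : MemLp g₀ 2 μ)
    (hg₁ : MemLp g₁ 2 μ) (hg₂ : MemLp g₂ 2 μ) :
    ∫ p, (f₀ p * g₀ p + f₁ p * g₁ p + f₂ p * g₂ p) ∂μ
      = ∫ p, f₀ p * g₀ p ∂μ + ∫ p, f₁ p * g₁ p ∂μ + ∫ p, f₂ p * g₂ p ∂μ := by
  have h0 := memLp_two_mul_integrable hf₀ hg₀
  have h1 := memLp_two_mul_integrable hf₁ hg₁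
  have h01 : Integrable (fun p => f₀ p * g₀ p + f₁ p * g₁ p) μ := h0.add h1
  rw [integral_add h01 (memLp_two_mul_integrable hf₂ hg₂), integral_add h0 h1]

lemma tendsto_integral_mul_of_tendsto_eLpNorm {μ : Measure (ℝ × ℝ)} {g f : ℝ × ℝ → ℂ}
    {F : ℕ → ℝ × ℝ → ℂ} (hg : MemLp g 2 μ) (hf : MemLp f 2 μ) (hF : ∀ j, MemLp (F j) 2 μ)
    (h : Tendsto (fun j => eLpNorm (F j - f) 2 μ) atTop (𝓝 0)) :
    Tendsto (fun j => ∫ p, g p * F j p ∂μ) atTop (𝓝 (∫ p, g p * f p ∂μ)) := by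
  refine tendsto_integral_of_L1' _ (memLp_two_mul_integrable hg hf).1
    (Eventually.of_forall fun j => memLp_two_mul_integrable hg (hF j)) ?_
  have hle : ∀ j, eLpNorm ((fun p => g p * F j p) - fun p => g p * f p) 1 μ
      ≤ eLpNorm g 2 μ * eLpNorm (F j - f) 2 μ := by
    intro j
    have e : ((fun p => g p * F j p) - fun p => g p * f p) = g • (F j - f) := by
      ext p; simp [mul_sub]
    rw [e]
    exact eLpNorm_smul_le_mul_eLpNorm ((hF j).1.sub hf.1) hg.1
  refine tendsto_of_tendsto_of_tendsto_of_le_of_le tendsto_const_nhds ?_ (fun _ => zero_le)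
    hle
  have := ENNReal.Tendsto.const_mul (a := eLpNorm g 2 μ) h (Or.inr hg.2.ne)
  simpa using this

/-- `w ∈ H¹₀(Ω)` with gradient `(gz, gx)`, approximated by the test functions `φ j`. -/
structure IsH10 (Ω : Set (ℝ × ℝ)) (w gz gx : ℝ × ℝ → ℂ) (φ : ℕ → ℝ × ℝ → ℂ) : Prop where
  test : ∀ j, IsTest Ω (φ j)
  memLp : MemLp w 2 (volume.restrict Ω)
  memLp_z : MemLp gz 2 (volume.restrict Ω)
  memLp_x : MemLp gx 2 (volume.restrict Ω)
  lim : Tendsto (fun j => eLpNorm (φ j - w) 2 (volume.restrict Ω)) atTop (𝓝 0)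
  lim_z : Tendsto (fun j => eLpNorm (dz (φ j) - gz) 2 (volume.restrict Ω)) atTop (𝓝 0)
  lim_x : Tendsto (fun j => eLpNorm (dx (φ j) - gx) 2 (volume.restrict Ω)) atTop (𝓝 0)

lemma MemH10.exists_isH10 {Ω : Set (ℝ × ℝ)} {w : ℝ × ℝ → ℂ} (h : MemH10 Ω w) :
    ∃ gz gx φ, IsH10 Ω w gz gx φ := by
  obtain ⟨φ, gz, gx, h1, h2, h3, h4, h5, h6, h7⟩ := h
  exact ⟨gz, gx, φ, h1, h2, h3, h4, h5, h6, h7⟩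

namespace IsH10

variable {Ω V : Set (ℝ × ℝ)} {P Pz Px Q Qz Qx : ℝ × ℝ → ℂ} {Φ Ψ : ℕ → ℝ × ℝ → ℂ}

lemma tendsto_pairing (h : IsH10 Ω P Pz Px Φ) {f₀ f₁ f₂ : ℝ × ℝ → ℂ}
    (h₀ : MemLp f₀ 2 (volume.restrict Ω)) (h₁ : MemLp f₁ 2 (volume.restrict Ω))
    (h₂ : MemLp f₂ 2 (volume.restrict Ω)) :
    Tendsto (fun j => ∫ p in Ω, (f₀ p * Φ j p + f₁ p * dz (Φ j) p + f₂ p * dx (Φ j) p)) atTop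
      (𝓝 (∫ p in Ω, (f₀ p * P p + f₁ p * Pz p + f₂ p * Px p))) := by
  have t0 := tendsto_integral_mul_of_tendsto_eLpNorm h₀ h.memLp (fun j => (h.test j).memLp) h.lim
  have t1 := tendsto_integral_mul_of_tendsto_eLpNorm h₁ h.memLp_z
    (fun j => (h.test j).dz.memLp) h.lim_z
  have t2 := tendsto_integral_mul_of_tendsto_eLpNorm h₂ h.memLp_x
    (fun j => (h.test j).dx.memLp) h.lim_x
  have := (t0.add t1).add t2
  rw [← integral_mul_add_mul_add_mul h₀ h₁ h₂ h.memLp h.memLp_z h.memLp_x] at this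
  exact this.congr fun j => (integral_mul_add_mul_add_mul h₀ h₁ h₂ (h.test j).memLp
    (h.test j).dz.memLp (h.test j).dx.memLp).symm

/-- The pairing is continuous in the `H¹` norm, so an identity linear in an `H¹₀` function need only
be checked on its approximating test functions. -/
lemma integral_pairing_eq_zero (h : IsH10 Ω P Pz Px Φ) {f₀ f₁ f₂ : ℝ × ℝ → ℂ}
    (h₀ : MemLp f₀ 2 (volume.restrict Ω)) (h₁ : MemLp f₁ 2 (volume.restrict Ω))
    (h₂ : MemLp f₂ 2 (volume.restrict Ω))
    (hz : ∀ j, ∫ p in Ω, (f₀ p * Φ j p + f₁ p * dz (Φ j) p + f₂ p * dx (Φ j) p) = 0) :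
    ∫ p in Ω, (f₀ p * P p + f₁ p * Pz p + f₂ p * Px p) = 0 :=
  tendsto_nhds_unique (h.tendsto_pairing h₀ h₁ h₂) (by simp [hz])

lemma integral_dz (h : IsH10 Ω P Pz Px Φ) {ψ : ℝ × ℝ → ℂ} (hψ : IsTest univ ψ) :
    ∫ p in Ω, (dz ψ p * P p + ψ p * Pz p) = 0 := by
  have := h.integral_pairing_eq_zero hψ.dz.memLp hψ.memLp (MemLp.zero (ε := ℂ))
    (fun j => by simpa using setIntegral_dz_mul_add (h.test j) hψ)
  simpa using this

lemma integral_dx (h : IsH10 Ω P Pz Px Φ) {ψ : ℝ × ℝ → ℂ} (hψ : IsTest univ ψ) :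
    ∫ p in Ω, (dx ψ p * P p + ψ p * Px p) = 0 := by
  have := h.integral_pairing_eq_zero hψ.dx.memLp (MemLp.zero (ε := ℂ)) hψ.memLp
    (fun j => by simpa using setIntegral_dx_mul_add (h.test j) hψ)
  simpa using this

/-- The weak product rule. With `Q` replaced by a test function `Ψ j`, the product `ψ * Ψ j` is
itself admissible in the weak derivative of `P`; the limit in `j` does the rest. -/
lemma integral_dz_mul (hP : IsH10 Ω P Pz Px Φ) (hQ : IsH10 Ω Q Qz Qx Ψ) {ψ : ℝ × ℝ → ℂ}
    (hψ : IsTest univ ψ) :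
    ∫ p in Ω, (dz ψ p * (P p * Q p) + ψ p * (Pz p * Q p + P p * Qz p)) = 0 := by
  have := hQ.integral_pairing_eq_zero
    ((hψ.dz.mul_memLp hP.memLp).add (hψ.mul_memLp hP.memLp_z)) (hψ.mul_memLp hP.memLp)
    (MemLp.zero (ε := ℂ)) (fun j => by
      have t := hP.integral_dz (((hQ.test j).smul_contDiff hψ.smooth (subset_univ _)).mono
        (subset_univ _))
      rw [← t]
      refine integral_congr_ae (ae_of_all _ fun p => ?_)
      simp only
      rw [dz_mul (differentiable_of_contDiff hψ.smooth p)
        (differentiable_of_contDiff (hQ.test j).smooth p)]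
      simp
      ring)
  rw [← this]
  refine integral_congr_ae (ae_of_all _ fun p => ?_)
  simp
  ring

lemma integral_dx_mul (hP : IsH10 Ω P Pz Px Φ) (hQ : IsH10 Ω Q Qz Qx Ψ) {ψ : ℝ × ℝ → ℂ}
    (hψ : IsTest univ ψ) :
    ∫ p in Ω, (dx ψ p * (P p * Q p) + ψ p * (Px p * Q p + P p * Qx p)) = 0 := by
  have := hQ.integral_pairing_eq_zero
    ((hψ.dx.mul_memLp hP.memLp).add (hψ.mul_memLp hP.memLp_x))
    (MemLp.zero (ε := ℂ)) (hψ.mul_memLp hP.memLp) (fun j => by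
      have t := hP.integral_dx (((hQ.test j).smul_contDiff hψ.smooth (subset_univ _)).mono
        (subset_univ _))
      rw [← t]
      refine integral_congr_ae (ae_of_all _ fun p => ?_)
      simp only
      rw [dx_mul (differentiable_of_contDiff hψ.smooth p)
        (differentiable_of_contDiff (hQ.test j).smooth p)]
      simp
      ring)
  rw [← this]
  refine integral_congr_ae (ae_of_all _ fun p => ?_)
  simp
  ring

end IsH10

/-- The Helmholtz operator `-Δ - k² η`. -/
noncomputable def helm (k : ℝ) (η : ℝ × ℝ → ℝ) (φ : ℝ × ℝ → ℂ) (p : ℝ × ℝ) : ℂ :=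
  -lap φ p - (k : ℂ) ^ 2 * (η p : ℂ) * φ p

lemma IsIndex.mul_memLp {Ω : Set (ℝ × ℝ)} {L k : ℝ} {η : ℝ × ℝ → ℝ} (hη : IsIndex Ω L η)
    (hΩ : MeasurableSet Ω) {f : ℝ × ℝ → ℂ} (hf : MemLp f 2 (volume.restrict Ω)) :
    MemLp (fun p => (k : ℂ) ^ 2 * (η p : ℂ) * f p) 2 (volume.restrict Ω) := by
  obtain ⟨C, hC⟩ := hη.bounded
  have hm : Measurable fun p => (k : ℂ) ^ 2 * (η p : ℂ) :=
    (Complex.measurable_ofReal.comp hη.measurable).const_mul _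
  refine hf.of_le_mul (c := k ^ 2 * C) (hm.aestronglyMeasurable.mul hf.1) ?_
  filter_upwards [ae_restrict_mem hΩ] with p hp
  rw [norm_mul, norm_mul, norm_pow, Complex.norm_real, Complex.norm_real, Real.norm_eq_abs,
    Real.norm_eq_abs, sq_abs]
  exact mul_le_mul_of_nonneg_right (mul_le_mul_of_nonneg_left (hC p hp) (sq_nonneg k))
    (norm_nonneg _)

/-! ### Weak Helmholtz equation and conservation of flux. -/

namespace IsH10

variable {Ω V W : Set (ℝ × ℝ)} {P Pz Px Q Qz Qx : ℝ × ℝ → ℂ} {Φ Ψ : ℕ → ℝ × ℝ → ℂ}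
  {L k : ℝ} {η : ℝ × ℝ → ℝ}

/-- The variational form of the Helmholtz equation. -/
lemma integral_weak (h : IsH10 Ω P Pz Px Φ) (hΩ : MeasurableSet Ω) (hη : IsIndex Ω L η)
    {φ : ℝ × ℝ → ℂ} (hφ : IsTest Ω φ) (heq : ∫ p in Ω, P p * helm k η φ p = 0) :
    ∫ p in Ω, (Pz p * dz φ p + Px p * dx φ p - (k : ℂ) ^ 2 * (η p : ℂ) * P p * φ p) = 0 := by
  have t1 := h.integral_dz (hφ.dz.mono (subset_univ _))
  have t2 := h.integral_dx (hφ.dx.mono (subset_univ _))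
  have m := hφ.memLp (μ := volume.restrict Ω)
  have i1 : Integrable (fun p => dz (dz φ) p * P p + dz φ p * Pz p) (volume.restrict Ω) :=
    (memLp_two_mul_integrable hφ.dz.dz.memLp h.memLp).add (memLp_two_mul_integrable hφ.dz.memLp h.memLp_z)
  have i2 : Integrable (fun p => dx (dx φ) p * P p + dx φ p * Px p) (volume.restrict Ω) :=
    (memLp_two_mul_integrable hφ.dx.dx.memLp h.memLp).add (memLp_two_mul_integrable hφ.dx.memLp h.memLp_x)
  have mh : MemLp (helm k η φ) 2 (volume.restrict Ω) :=
    (hφ.dz.dz.memLp.add hφ.dx.dx.memLp).neg.sub (hη.mul_memLp hΩ m)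
  have i3 := memLp_two_mul_integrable h.memLp mh
  have := congrArg₂ (· + ·) (congrArg₂ (· + ·) t1 t2) heq
  simp only [add_zero] at this
  have i12 : Integrable (fun p => (dz (dz φ) p * P p + dz φ p * Pz p)
    + (dx (dx φ) p * P p + dx φ p * Px p)) (volume.restrict Ω) := i1.add i2
  rw [← integral_add i1 i2, ← integral_add i12 i3] at this
  rw [← this]
  refine integral_congr_ae (ae_of_all _ fun p => ?_)
  simp only [helm, lap]
  ring

/-- This is the equation of `P` tested with `χ Q`. The functions `χ * Ψ j` are admissible: `χ` keeps
them where `P` solves the equation, and `Q ∈ H¹₀` supplies the boundary condition with no regularity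
of `∂Ω`. -/
lemma integral_weak_mul (hP : IsH10 Ω P Pz Px Φ) (hQ : IsH10 Ω Q Qz Qx Ψ) (hΩ : MeasurableSet Ω)
    (hη : IsIndex Ω L η) (heq : ∀ φ, IsTest (Ω ∩ V) φ → ∫ p in Ω, P p * helm k η φ p = 0)
    {χ : ℝ × ℝ → ℂ} (hχ : IsTest V χ) :
    ∫ p in Ω, ((dz χ p * Pz p + dx χ p * Px p - χ p * ((k : ℂ) ^ 2 * (η p : ℂ) * P p)) * Q p
      + χ p * Pz p * Qz p + χ p * Px p * Qx p) = 0 := by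
  refine hQ.integral_pairing_eq_zero
    (((hχ.dz.mul_memLp hP.memLp_z).add (hχ.dx.mul_memLp hP.memLp_x)).sub
      (hχ.mul_memLp (hη.mul_memLp hΩ hP.memLp))) (hχ.mul_memLp hP.memLp_z)
    (hχ.mul_memLp hP.memLp_x) (fun j => ?_)
  have hT := (hQ.test j).smul_contDiff hχ.smooth hχ.support
  rw [← hP.integral_weak hΩ hη (hT.mono inter_subset_left) (heq _ hT)]
  refine integral_congr_ae (ae_of_all _ fun p => ?_)
  beta_reduce
  rw [dz_mul (differentiable_of_contDiff hχ.smooth p)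
    (differentiable_of_contDiff (hQ.test j).smooth p), dx_mul
    (differentiable_of_contDiff hχ.smooth p) (differentiable_of_contDiff (hQ.test j).smooth p)]
  ring

/-- Conservation of the flux of a pair of solutions. -/
lemma integral_flux_eq_zero (hP : IsH10 Ω P Pz Px Φ) (hQ : IsH10 Ω Q Qz Qx Ψ)
    (hΩ : MeasurableSet Ω) (hη : IsIndex Ω L η)
    (heqP : ∀ φ, IsTest (Ω ∩ V) φ → ∫ p in Ω, P p * helm k η φ p = 0)
    (heqQ : ∀ φ, IsTest (Ω ∩ V) φ → ∫ p in Ω, Q p * helm k η φ p = 0)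
    {χ : ℝ × ℝ → ℂ} (hχ : IsTest V χ) :
    ∫ p in Ω, (dz χ p * (Q p * Pz p - P p * Qz p) + dx χ p * (Q p * Px p - P p * Qx p)) = 0 := by
  have t1 := hP.integral_weak_mul hQ hΩ hη heqP hχ
  have t2 := hQ.integral_weak_mul hP hΩ hη heqQ hχ
  have i1 := memLp_two_mul_integrable (((hχ.dz.mul_memLp hP.memLp_z).add
    (hχ.dx.mul_memLp hP.memLp_x)).sub (hχ.mul_memLp (hη.mul_memLp (k := k) hΩ hP.memLp))) hQ.memLp
  have i2 := memLp_two_mul_integrable (hχ.mul_memLp hP.memLp_z) hQ.memLp_z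
  have i3 := memLp_two_mul_integrable (hχ.mul_memLp hP.memLp_x) hQ.memLp_x
  have j1 := memLp_two_mul_integrable (((hχ.dz.mul_memLp hQ.memLp_z).add
    (hχ.dx.mul_memLp hQ.memLp_x)).sub (hχ.mul_memLp (hη.mul_memLp (k := k) hΩ hQ.memLp))) hP.memLp
  have j2 := memLp_two_mul_integrable (hχ.mul_memLp hQ.memLp_z) hP.memLp_z
  have j3 := memLp_two_mul_integrable (hχ.mul_memLp hQ.memLp_x) hP.memLp_x
  -- The terms `χ ∇P·∇Q` and `χ k² η P Q` are symmetric in the pair and cancel; only those with `∇χ`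
  -- survive.
  have := congrArg₂ (· - ·) t1 t2
  simp only [sub_zero] at this
  have ii := integral_sub ((i1.add i2).add i3) ((j1.add j2).add j3)
  simp only [Pi.add_apply, Pi.sub_apply] at ii
  rw [← ii] at this
  rw [← this]
  refine integral_congr_ae (ae_of_all _ fun p => ?_)
  simp only
  ring

end IsH10

/-! ### Mollification -/

/-- Convolution with a test function. -/
noncomputable def conv (g ρ : ℝ × ℝ → ℂ) (x : ℝ × ℝ) : ℂ := ∫ t, g t * ρ (x - t)

section Convolution

variable {g ρ : ℝ × ℝ → ℂ}

lemma conv_eq_convolution (g ρ : ℝ × ℝ → ℂ) :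
    conv g ρ = convolution g ρ (ContinuousLinearMap.mul ℝ ℂ) volume := rfl

lemma contDiff_conv (hg : LocallyIntegrable g) (hρ : IsTest univ ρ) : ContDiff ℝ ∞ (conv g ρ) :=
  hρ.compact.contDiff_convolution_right (n := ⊤) (ContinuousLinearMap.mul ℝ ℂ) hg hρ.smooth

lemma fderiv_conv_apply (hg : LocallyIntegrable g) (hρ : IsTest univ ρ) (x v : ℝ × ℝ) :
    fderiv ℝ (conv g ρ) x v = conv g (fun t => fderiv ℝ ρ t v) x := by
  rw [conv_eq_convolution, (hρ.compact.hasFDerivAt_convolution_right _ hg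
    (hρ.smooth.of_le (by simp)) x).fderiv]
  exact convolution_precompR_apply _ hg (hρ.compact.fderiv ℝ)
    (hρ.smooth.continuous_fderiv (by simp)) x v

lemma dz_conv (hg : LocallyIntegrable g) (hρ : IsTest univ ρ) :
    dz (conv g ρ) = conv g (dz ρ) := funext fun x => fderiv_conv_apply hg hρ x _

lemma dx_conv (hg : LocallyIntegrable g) (hρ : IsTest univ ρ) :
    dx (conv g ρ) = conv g (dx ρ) := funext fun x => fderiv_conv_apply hg hρ x _

lemma integrable_mul_comp_sub (hg : LocallyIntegrable g) (hρ : IsTest univ ρ) (x : ℝ × ℝ) :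
    Integrable fun t => g t * ρ (x - t) := by
  have := hρ.compact.convolutionExists_right (ContinuousLinearMap.mul ℝ ℂ) hg hρ.continuous x
  exact this

lemma lap_conv (hg : LocallyIntegrable g) (hρ : IsTest univ ρ) (x : ℝ × ℝ) :
    lap (conv g ρ) x = ∫ t, g t * lap ρ (x - t) := by
  rw [lap, dz_conv hg hρ, dx_conv hg hρ, dz_conv hg hρ.dz, dx_conv hg hρ.dx, conv, conv,
    ← integral_add (integrable_mul_comp_sub hg hρ.dz.dz x) (integrable_mul_comp_sub hg hρ.dx.dx x)]
  refine integral_congr_ae (ae_of_all _ fun t => ?_)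
  simp only [lap]
  ring

lemma fderiv_comp_const_sub_apply {f : ℝ × ℝ → ℂ} (hf : Differentiable ℝ f) (x t v : ℝ × ℝ) :
    fderiv ℝ (fun t => f (x - t)) t v = -fderiv ℝ f (x - t) v := by
  have h := ((hf (x - t)).hasFDerivAt.comp t ((hasFDerivAt_id t).const_sub x)).fderiv
  change fderiv ℝ (fun t => f (x - t)) t = _ at h
  rw [h]
  simp

/-- The reflection changes sign twice. This lets the kernel `ρ (x - ·)` of a convolution serve as a
test function. -/
lemma lap_comp_const_sub (hρ : ContDiff ℝ ∞ ρ) (x t : ℝ × ℝ) :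
    lap (fun t => ρ (x - t)) t = lap ρ (x - t) := by
  have e1 : dz (fun t => ρ (x - t)) = fun t => -dz ρ (x - t) := funext fun t =>
    fderiv_comp_const_sub_apply (differentiable_of_contDiff hρ) x t _
  have e2 : dx (fun t => ρ (x - t)) = fun t => -dx ρ (x - t) := funext fun t =>
    fderiv_comp_const_sub_apply (differentiable_of_contDiff hρ) x t _
  rw [lap, e1, e2, lap]
  have a1 := fderiv_comp_const_sub_apply (differentiable_of_contDiff (contDiff_dz hρ)) x t (1, 0)
  have a2 := fderiv_comp_const_sub_apply (differentiable_of_contDiff (contDiff_dx hρ)) x t (0, 1)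
  have b1 : dz (fun t => -dz ρ (x - t)) t = -dz (fun t => dz ρ (x - t)) t := by
    rw [dz, dz, fderiv_fun_neg]; rfl
  have b2 : dx (fun t => -dx ρ (x - t)) t = -dx (fun t => dx ρ (x - t)) t := by
    rw [dx, dx, fderiv_fun_neg]; rfl
  rw [b1, b2]
  change -(fderiv ℝ (fun t => dz ρ (x - t)) t (1, 0)) + -(fderiv ℝ (fun t => dx ρ (x - t)) t (0, 1))
    = _
  rw [a1, a2, neg_neg, neg_neg]
  rfl

end Convolution

/-- An approximate identity made of test functions. -/
structure IsMollifier (r : ℝ) (ρ : ℕ → ℝ × ℝ → ℂ) : Prop where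
  test : ∀ j, IsTest univ (ρ j)
  tsupport_subset : ∀ j, tsupport (ρ j) ⊆ Metric.closedBall 0 r
  norm_conv_le : ∀ (g : ℝ × ℝ → ℂ) (C : ℝ), (∀ x, ‖g x‖ ≤ C) → ∀ j x, ‖conv g (ρ j) x‖ ≤ C
  ae_tendsto : ∀ g : ℝ × ℝ → ℂ, LocallyIntegrable g →
    ∀ᵐ x, Tendsto (fun j => conv g (ρ j) x) atTop (𝓝 (g x))
  tendsto : ∀ (g : ℝ × ℝ → ℂ) (x : ℝ × ℝ), AEStronglyMeasurable g volume → ContinuousAt g x →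
    Tendsto (fun j => conv g (ρ j) x) atTop (𝓝 (g x))

lemma exists_isMollifier {r : ℝ} (hr : 0 < r) : ∃ ρ, IsMollifier r ρ := by
  -- The outer radius is exactly twice the inner one: a bounded ratio is needed for almost
  -- everywhere convergence on merely locally integrable functions.
  let β : ℕ → ContDiffBump (0 : ℝ × ℝ) := fun j =>
    ⟨r / (j + 1) / 2, r / (j + 1), by positivity, half_lt_self (by positivity)⟩
  have hout : ∀ j, (β j).rOut = r / (j + 1) := fun j => rfl
  have hlim : Tendsto (fun j => (β j).rOut) atTop (𝓝 0) := by
    simp_rw [hout]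
    have := (tendsto_one_div_add_atTop_nhds_zero_nat (𝕜 := ℝ)).const_mul r
    simpa [div_eq_mul_inv] using this
  have hconv : ∀ (g : ℝ × ℝ → ℂ) (j : ℕ) (x : ℝ × ℝ),
      convolution ((β j).normed volume) g (ContinuousLinearMap.lsmul ℝ ℝ) volume x
        = conv g (fun x => (((β j).normed volume x : ℝ) : ℂ)) x := by
    intro g j x
    rw [convolution_lsmul_swap, conv]
    refine integral_congr_ae (ae_of_all _ fun t => ?_)
    simp [mul_comm]
  refine ⟨fun j x => (((β j).normed volume x : ℝ) : ℂ), ⟨fun j => ⟨?_, ?_, subset_univ _⟩,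
    fun j => ?_, ?_, ?_, ?_⟩⟩
  · exact Complex.ofRealCLM.contDiff.comp (β j).contDiff_normed
  · exact (β j).hasCompactSupport_normed.comp_left (g := fun r : ℝ => (r : ℂ)) Complex.ofReal_zero
  · have h1 : tsupport (fun x => (((β j).normed volume x : ℝ) : ℂ))
        ⊆ tsupport ((β j).normed volume) := closure_mono fun p hp => by
      simp only [Function.mem_support, ne_eq, Complex.ofReal_eq_zero] at hp ⊢
      exact hp
    refine h1.trans ?_
    rw [(β j).tsupport_normed_eq]
    refine Metric.closedBall_subset_closedBall ?_
    rw [hout]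
    exact div_le_self hr.le (by linarith [(Nat.cast_nonneg j : (0 : ℝ) ≤ j)])
  · intro g C hC j x
    rw [← hconv, convolution_def]
    have hi : Integrable (fun t => (β j).normed volume t * C) := (β j).integrable_normed.mul_const C
    refine (norm_integral_le_of_norm_le hi (ae_of_all _ fun t => ?_)).trans ?_
    · simp only [ContinuousLinearMap.lsmul_apply, norm_smul, Real.norm_eq_abs,
        abs_of_nonneg ((β j).nonneg_normed t)]
      exact mul_le_mul_of_nonneg_left (hC _) ((β j).nonneg_normed t)
    · rw [integral_mul_const, (β j).integral_normed, one_mul]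
  · intro g hg
    have := ContDiffBump.ae_convolution_tendsto_right_of_locallyIntegrable (μ := volume) (K := 2)
      hlim (Eventually.of_forall fun j => le_of_eq (by simp only [β]; ring)) hg
    filter_upwards [this] with x hx
    exact hx.congr fun j => hconv g j x
  · intro g x hg hc
    have := ContDiffBump.convolution_tendsto_right (μ := volume) (g := fun _ => g)
      (k := fun _ => x) (x₀ := x) (z₀ := g x) hlim (Eventually.of_forall fun _ => hg)
      (hc.tendsto.comp tendsto_snd) tendsto_const_nhds
    exact this.congr fun j => hconv g j x

lemma lap_eq_zero_of_notMem {f : ℝ × ℝ → ℂ} {p : ℝ × ℝ} (h : p ∉ tsupport f) : lap f p = 0 := by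
  rw [lap, dz_eq_zero_of_notMem fun h' => h (tsupport_dz_subset f h'),
    dx_eq_zero_of_notMem fun h' => h (tsupport_dx_subset f h'), add_zero]

lemma dz_eq_zero_of_eqOn_const {f : ℝ × ℝ → ℂ} {U : Set (ℝ × ℝ)} (hU : IsOpen U) {c : ℂ}
    (h : ∀ x ∈ U, f x = c) {p : ℝ × ℝ} (hp : p ∈ U) : dz f p = 0 := by
  have : f =ᶠ[𝓝 p] fun _ => c := by filter_upwards [hU.mem_nhds hp] with x hx using h x hx
  rw [dz, this.fderiv_eq]
  simp

lemma dx_eq_zero_of_eqOn_const {f : ℝ × ℝ → ℂ} {U : Set (ℝ × ℝ)} (hU : IsOpen U) {c : ℂ}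
    (h : ∀ x ∈ U, f x = c) {p : ℝ × ℝ} (hp : p ∈ U) : dx f p = 0 := by
  have : f =ᶠ[𝓝 p] fun _ => c := by filter_upwards [hU.mem_nhds hp] with x hx using h x hx
  rw [dx, this.fderiv_eq]
  simp

lemma lap_eq_zero_of_eqOn_const {f : ℝ × ℝ → ℂ} {U : Set (ℝ × ℝ)} (hU : IsOpen U) {c : ℂ}
    (h : ∀ x ∈ U, f x = c) {p : ℝ × ℝ} (hp : p ∈ U) : lap f p = 0 := by
  rw [lap, dz_eq_zero_of_eqOn_const hU (fun x hx => dz_eq_zero_of_eqOn_const hU h hx) hp,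
    dx_eq_zero_of_eqOn_const hU (fun x hx => dx_eq_zero_of_eqOn_const hU h hx) hp, add_zero]

/-- The flux through a contour around the source `y` of `q`, for a continuous solution `p` of the
homogeneous equation near `y`. -/
lemma integral_flux_source {Ω : Set (ℝ × ℝ)} {L k : ℝ} {η : ℝ × ℝ → ℝ} (hΩ : IsOpen Ω)
    (hη : IsIndex Ω L η) {y : ℝ × ℝ} {r : ℝ} (hr : 0 < r)
    (hball : Metric.closedBall y (3 * r) ⊆ Ω) {ζ : ℝ × ℝ → ℂ} (hζ : IsTest univ ζ)
    (hζs : tsupport ζ ⊆ Metric.closedBall y (2 * r)) (hζ1 : ∀ x ∈ Metric.ball y r, ζ x = 1)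
    {p q : ℝ × ℝ → ℂ} {b : ℂ} (hp : ContinuousOn p (Metric.closedBall y (3 * r)))
    (hpe : ∀ φ, IsTest (Metric.ball y (3 * r)) φ → ∫ x in Ω, p x * helm k η φ x = 0)
    (hqi : IntegrableOn (fun x => q x * ζ x) Ω)
    (hqe : ∀ φ, IsTest Ω φ → ∫ x in Ω, q x * helm k η φ x = b * φ y)
    {P Pz Px Q Qz Qx : ℝ × ℝ → ℂ} {Φ Ψ : ℕ → ℝ × ℝ → ℂ}
    (hP : IsH10 Ω P Pz Px Φ) (hQ : IsH10 Ω Q Qz Qx Ψ)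
    (hPp : ∀ x ∈ Metric.closedBall y (2 * r) \ Metric.ball y r, P x = p x)
    (hQq : ∀ x ∈ Metric.closedBall y (2 * r) \ Metric.ball y r, Q x = q x) :
    ∫ x in Ω, (dz ζ x * (P x * Qz x - Q x * Pz x) + dx ζ x * (P x * Qx x - Q x * Px x))
      = b * p y := by
  set B3 := Metric.closedBall y (3 * r) with hB3
  set B2 := Metric.closedBall y (2 * r) with hB2
  have hyB : y ∈ Metric.ball y r := Metric.mem_ball_self hr
  have hB23 : B2 ⊆ Metric.ball y (3 * r) := fun x hx =>
    Metric.mem_ball.2 (lt_of_le_of_lt (Metric.mem_closedBall.1 hx) (by linarith))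
  have hΩm := hΩ.measurableSet
  obtain ⟨C₀, hC₀⟩ := (isCompact_closedBall y (3 * r)).exists_bound_of_continuousOn hp
  obtain ⟨C₁, hC₁⟩ := hη.bounded
  set κ : ℝ × ℝ → ℂ := fun x => (k : ℂ) ^ 2 * (η x : ℂ) with hκ
  have hκm : Measurable κ := (Complex.measurable_ofReal.comp hη.measurable).const_mul _
  have hκb : ∀ x ∈ Ω, ‖κ x‖ ≤ k ^ 2 * C₁ := fun x hx => by
    rw [hκ, norm_mul, norm_pow, Complex.norm_real, Complex.norm_real, Real.norm_eq_abs,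
      Real.norm_eq_abs, sq_abs]
    exact mul_le_mul_of_nonneg_left (hC₁ x hx) (sq_nonneg k)
  -- Truncation makes `p` a bounded integrable function on the whole plane, ready for convolution;
  -- near `y` nothing changes.
  set p₀ : ℝ × ℝ → ℂ := B3.indicator p with hp₀
  have hp₀eq : ∀ x ∈ B3, p₀ x = p x := fun x hx => indicator_of_mem hx p
  have hC₀' : ∀ x, ‖p₀ x‖ ≤ |C₀| := fun x => by
    by_cases hx : x ∈ B3
    · rw [hp₀eq x hx]; exact (hC₀ x hx).trans (le_abs_self _)
    · rw [hp₀, indicator_of_notMem hx, norm_zero]; exact abs_nonneg _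
  have hB3m : MeasurableSet B3 := Metric.isClosed_closedBall.measurableSet
  have hp₀int : Integrable p₀ :=
    (hp.integrableOn_compact (isCompact_closedBall y (3 * r))).integrable_indicator hB3m
  set f₀ : ℝ × ℝ → ℂ := fun x => κ x * p₀ x with hf₀
  set C₂ := |k ^ 2 * C₁| * |C₀| with hC₂
  have hf₀b : ∀ x, ‖f₀ x‖ ≤ C₂ := fun x => by
    by_cases hx : x ∈ B3
    · rw [hf₀, norm_mul]
      exact mul_le_mul ((hκb x (hball hx)).trans (le_abs_self _)) (hC₀' x) (norm_nonneg _)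
        (abs_nonneg _)
    · simp only [hf₀, hp₀, indicator_of_notMem hx, mul_zero, norm_zero]
      positivity
  have hf₀int : Integrable f₀ := by
    have : f₀ = B3.indicator f₀ := by
      ext x
      by_cases hx : x ∈ B3
      · rw [indicator_of_mem hx]
      · rw [indicator_of_notMem hx, hf₀, hp₀]; simp [indicator_of_notMem hx]
    rw [this]
    refine IntegrableOn.integrable_indicator ?_ hB3m
    exact Measure.integrableOn_of_bounded (M := C₂)
      (isCompact_closedBall y (3 * r)).measure_lt_top.ne
      (hκm.aestronglyMeasurable.mul hp₀int.1) (ae_of_all _ hf₀b)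
  obtain ⟨ρ, hρ⟩ := exists_isMollifier (half_pos hr)
  set pj : ℕ → ℝ × ℝ → ℂ := fun j => conv p₀ (ρ j) with hpj
  set fj : ℕ → ℝ × ℝ → ℂ := fun j => conv f₀ (ρ j) with hfj
  have hpjs : ∀ j, ContDiff ℝ ∞ (pj j) := fun j =>
    contDiff_conv hp₀int.locallyIntegrable (hρ.test j)
  have hfjs : ∀ j, ContDiff ℝ ∞ (fj j) := fun j =>
    contDiff_conv hf₀int.locallyIntegrable (hρ.test j)
  -- the mollified equation
  have hlap : ∀ j, ∀ x ∈ B2, lap (pj j) x = -fj j x := by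
    intro j x hx
    -- For `x` within `2r` of `y` and a mollifier of radius `r/2`, the kernel is supported within
    -- `5r/2` of `y`, where the equation of `p` holds.
    have hφ : IsTest (Metric.ball y (3 * r)) (fun t => ρ j (x - t)) := by
      have hts : tsupport (fun t => ρ j (x - t)) ⊆ (fun t => x - t) ⁻¹' tsupport (ρ j) :=
        tsupport_comp_subset_preimage (ρ j) (by fun_prop)
      have hsub : (fun t => x - t) ⁻¹' tsupport (ρ j) ⊆ Metric.closedBall x (r / 2) := by
        intro t ht
        have := hρ.tsupport_subset j ht
        rw [mem_closedBall_zero_iff] at this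
        rwa [Metric.mem_closedBall, dist_comm, dist_eq_norm]
      refine ⟨(hρ.test j).smooth.comp (contDiff_const.sub contDiff_id), ?_, ?_⟩
      · exact (isCompact_closedBall x (r / 2)).of_isClosed_subset (isClosed_tsupport _)
          (hts.trans hsub)
      · refine (hts.trans hsub).trans fun t ht => ?_
        rw [Metric.mem_ball]
        have h1 := Metric.mem_closedBall.1 ht
        have h2 := Metric.mem_closedBall.1 hx
        linarith [dist_triangle t x y]
    have heq := hpe _ hφ
    have hfull : ∫ t in Ω, p t * helm k η (fun t => ρ j (x - t)) t
        = ∫ t, (-(p₀ t * lap (ρ j) (x - t)) - f₀ t * ρ j (x - t)) := by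
      rw [← integral_indicator hΩm]
      refine integral_congr_ae (ae_of_all _ fun t => ?_)
      beta_reduce
      by_cases ht : t ∈ B3
      · rw [indicator_of_mem (hball ht), helm, lap_comp_const_sub (hρ.test j).smooth]
        simp only [hf₀, hp₀eq t ht, hκ]
        ring
      · have : t ∉ tsupport (fun t => ρ j (x - t)) := fun h =>
          ht (Metric.ball_subset_closedBall (hφ.support h))
        have e : p₀ t = 0 := indicator_of_notMem ht p
        simp only [hf₀, e]
        have e2 : p t * helm k η (fun t => ρ j (x - t)) t = 0 := by
          rw [helm, lap_eq_zero_of_notMem this,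
            image_eq_zero_of_notMem_tsupport (f := fun t => ρ j (x - t)) this]
          simp
        by_cases h : t ∈ Ω
        · rw [indicator_of_mem h, e2]; simp
        · rw [indicator_of_notMem h]; simp
    have hρl : IsTest univ (lap (ρ j)) :=
      ⟨(hρ.test j).dz.dz.smooth.add (hρ.test j).dx.dx.smooth,
        (hρ.test j).dz.dz.compact.add (hρ.test j).dx.dx.compact, subset_univ _⟩
    have hneg : Integrable fun t => -(p₀ t * lap (ρ j) (x - t)) :=
      (integrable_mul_comp_sub hp₀int.locallyIntegrable hρl x).neg
    rw [hfull, integral_sub hneg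
      (integrable_mul_comp_sub hf₀int.locallyIntegrable (hρ.test j) x), integral_neg,
      ← lap_conv hp₀int.locallyIntegrable (hρ.test j)] at heq
    simp only [hpj, hfj, conv] at heq ⊢
    linear_combination -heq
  -- derivatives of `ζ` live in the annulus
  have hann : ∀ x, (dz ζ x = 0 ∧ dx ζ x = 0 ∧ lap ζ x = 0) ∨ x ∈ B2 \ Metric.ball y r := by
    intro x
    by_cases h1 : x ∈ Metric.ball y r
    · exact Or.inl ⟨dz_eq_zero_of_eqOn_const Metric.isOpen_ball hζ1 h1,
        dx_eq_zero_of_eqOn_const Metric.isOpen_ball hζ1 h1,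
        lap_eq_zero_of_eqOn_const Metric.isOpen_ball hζ1 h1⟩
    by_cases h2 : x ∈ B2
    · exact Or.inr ⟨h2, h1⟩
    · have h3 : x ∉ tsupport ζ := fun h => h2 (hζs h)
      exact Or.inl ⟨dz_eq_zero_of_notMem h3, dx_eq_zero_of_notMem h3, lap_eq_zero_of_notMem h3⟩
  -- `E` is formally `Δ(ζQ) - ζΔQ`. It lives in the annulus, away from the singularity of `q`, so
  -- weak gradients of `Q` suffice.
  set E : ℝ × ℝ → ℂ := fun x => lap ζ x * Q x + 2 * (dz ζ x * Qz x + dx ζ x * Qx x) with hE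
  have hζl : IsTest univ (lap ζ) := ⟨hζ.dz.dz.smooth.add hζ.dx.dx.smooth,
    hζ.dz.dz.compact.add hζ.dx.dx.compact, subset_univ _⟩
  have integrable_of_test : ∀ {ψ f : ℝ × ℝ → ℂ}, IsTest univ ψ →
      MemLp f 2 (volume.restrict Ω) → Integrable (fun x => ψ x * f x) (volume.restrict Ω) :=
    fun hψ hf => memLp_two_mul_integrable hψ.memLp hf
  have hEint : Integrable E (volume.restrict Ω) :=
    (integrable_of_test hζl hQ.memLp).add
      (((integrable_of_test hζ.dz hQ.memLp_z).add (integrable_of_test hζ.dx hQ.memLp_x)).const_mul 2)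
  -- the equation of `q` tested with `ζ * pj`
  have hpjcont : ∀ j, Continuous (pj j) := fun j => (hpjs j).continuous
  have hpjb : ∀ j x, ‖pj j x‖ ≤ |C₀| := fun j x => hρ.norm_conv_le p₀ _ hC₀' j x
  have hfjb : ∀ j x, ‖fj j x‖ ≤ C₂ := fun j x => hρ.norm_conv_le f₀ _ hf₀b j x
  have hmain_bound : ∀ j, ∀ᵐ x ∂volume.restrict Ω, ‖q x * ζ x * (fj j x - κ x * pj j x)‖
      ≤ ‖q x * ζ x‖ * (C₂ + |k ^ 2 * C₁| * |C₀|) := fun j => by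
    filter_upwards [ae_restrict_mem hΩm] with x hx
    rw [norm_mul]
    refine mul_le_mul_of_nonneg_left ((norm_sub_le _ _).trans (add_le_add (hfjb j x) ?_))
      (norm_nonneg _)
    rw [norm_mul]
    exact mul_le_mul ((hκb x hx).trans (le_abs_self _)) (hpjb j x) (norm_nonneg _) (abs_nonneg _)
  have hmain_meas : ∀ j, AEStronglyMeasurable (fun x => q x * ζ x * (fj j x - κ x * pj j x))
      (volume.restrict Ω) := fun j =>
    hqi.1.mul ((hfjs j).continuous.aestronglyMeasurable.sub
      (hκm.aestronglyMeasurable.mul (hpjcont j).aestronglyMeasurable))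
  have hmain_int : ∀ j, Integrable (fun x => q x * ζ x * (fj j x - κ x * pj j x))
      (volume.restrict Ω) := fun j =>
    (hqi.norm.mul_const (C₂ + |k ^ 2 * C₁| * |C₀|)).mono' (hmain_meas j) (hmain_bound j)
  have hEj_int : ∀ j, Integrable (fun x => pj j x * E x) (volume.restrict Ω) := fun j =>
    hEint.bdd_mul (hpjcont j).aestronglyMeasurable (ae_of_all _ (hpjb j))
  -- In `-Δ(ζ p_j)` the factor `Δp_j` is known from the mollified equation. The term with `∇p_j` is
  -- supported where `Q = q`; integrating the divergence of `2 p_j Q ∇ζ` to zero moves that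
  -- derivative onto `Q`.
  have hstep : ∀ j, b * pj j y = (∫ x in Ω, q x * ζ x * (fj j x - κ x * pj j x))
      + ∫ x in Ω, pj j x * E x := by
    intro j
    have hT1 : IsTest univ (fun x => pj j x * dz ζ x) :=
      (hζ.dz.smul_contDiff (hpjs j) (subset_univ _)).mono (subset_univ _)
    have hT2 : IsTest univ (fun x => pj j x * dx ζ x) :=
      (hζ.dx.smul_contDiff (hpjs j) (subset_univ _)).mono (subset_univ _)
    have t1 := hQ.integral_dz hT1
    have t2 := hQ.integral_dx hT2
    have i1 : Integrable (fun x => dz (fun x => pj j x * dz ζ x) x * Q x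
        + pj j x * dz ζ x * Qz x) (volume.restrict Ω) :=
      (integrable_of_test hT1.dz hQ.memLp).add (integrable_of_test hT1 hQ.memLp_z)
    have i2 : Integrable (fun x => dx (fun x => pj j x * dx ζ x) x * Q x
        + pj j x * dx ζ x * Qx x) (volume.restrict Ω) :=
      (integrable_of_test hT2.dx hQ.memLp).add (integrable_of_test hT2 hQ.memLp_x)
    have i12 : Integrable (fun x => 2 * ((dz (fun x => pj j x * dz ζ x) x * Q x
        + pj j x * dz ζ x * Qz x) + (dx (fun x => pj j x * dx ζ x) x * Q x
        + pj j x * dx ζ x * Qx x))) (volume.restrict Ω) := (i1.add i2).const_mul 2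
    have t12 : ∫ x in Ω, 2 * ((dz (fun x => pj j x * dz ζ x) x * Q x
        + pj j x * dz ζ x * Qz x) + (dx (fun x => pj j x * dx ζ x) x * Q x
        + pj j x * dx ζ x * Qx x)) = 0 := by
      rw [integral_const_mul, integral_add i1 i2, t1, t2]
      simp
    have hT : IsTest Ω (fun x => pj j x * ζ x) := by
      refine ⟨(hpjs j).mul hζ.smooth, hζ.compact.mul_left, (tsupport_mul_subset_right).trans ?_⟩
      exact hζs.trans (hB23.trans (Metric.ball_subset_closedBall.trans hball))
    have hq := hqe _ hT
    rw [hζ1 y hyB, mul_one] at hq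
    have iE : Integrable (fun x => q x * ζ x * (fj j x - κ x * pj j x) + pj j x * E x)
      (volume.restrict Ω) := (hmain_int j).add (hEj_int j)
    rw [← hq, ← integral_add (hmain_int j) (hEj_int j), ← sub_zero (∫ x in Ω, _ + _), ← t12,
      ← integral_sub iE i12]
    refine integral_congr_ae (ae_of_all _ fun x => ?_)
    beta_reduce
    have hdp := differentiable_of_contDiff (hpjs j) x
    rw [helm, lap_mul (hpjs j) hζ.smooth, dz_mul hdp (differentiable_of_contDiff hζ.dz.smooth x),
      dx_mul hdp (differentiable_of_contDiff hζ.dx.smooth x)]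
    have e0 : lap ζ x = dz (dz ζ) x + dx (dx ζ) x := rfl
    have hlapx : lap (pj j) x * ζ x = -fj j x * ζ x := by
      by_cases hx : x ∈ B2
      · rw [hlap j x hx]
      · rw [image_eq_zero_of_notMem_tsupport fun h => hx (hζs h)]; simp
    rcases hann x with ⟨h1, h2, h3⟩ | hx
    · simp only [hE, h1, h2, h3, hκ]
      rw [h3] at e0
      linear_combination (-q x) * hlapx - 2 * pj j x * Q x * e0
    · simp only [hE, hQq x hx, hκ]
      rw [e0]
      linear_combination (-q x) * hlapx
  -- passage to the limit
  have hp₀c : ∀ x ∈ Metric.ball y (3 * r), ContinuousAt p₀ x := fun x hx => by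
    have : p =ᶠ[𝓝 x] p₀ := by
      filter_upwards [Metric.isOpen_ball.mem_nhds hx] with t ht
      exact (hp₀eq t (Metric.ball_subset_closedBall ht)).symm
    exact (hp.continuousAt (Filter.mem_of_superset (Metric.isOpen_ball.mem_nhds hx)
      Metric.ball_subset_closedBall)).congr this
  have hpjlim : ∀ x ∈ Metric.ball y (3 * r), Tendsto (fun j => pj j x) atTop (𝓝 (p x)) :=
    fun x hx => by
      have := hρ.tendsto p₀ x hp₀int.1 (hp₀c x hx)
      rwa [hp₀eq x (Metric.ball_subset_closedBall hx)] at this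
  -- As `η` is only measurable, `f_j → k² η p` holds merely almost everywhere; this is enough for
  -- dominated convergence against the integrable `q ζ`.
  have lim1 : Tendsto (fun j => ∫ x in Ω, q x * ζ x * (fj j x - κ x * pj j x)) atTop (𝓝 0) := by
    have := tendsto_integral_of_dominated_convergence
      (F := fun j x => q x * ζ x * (fj j x - κ x * pj j x)) (f := fun _ => (0 : ℂ))
      (μ := volume.restrict Ω) (fun x => ‖q x * ζ x‖ * (C₂ + |k ^ 2 * C₁| * |C₀|))
      hmain_meas (hqi.norm.mul_const _) hmain_bound (by
        filter_upwards [ae_restrict_of_ae (hρ.ae_tendsto f₀ hf₀int.locallyIntegrable)] with x hx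
        by_cases hxB : x ∈ B2
        · have h1 := hpjlim x (hB23 hxB)
          have h2 := (hx.sub (h1.const_mul (κ x))).const_mul (q x * ζ x)
          have e : f₀ x = κ x * p x := by
            simp only [hf₀, hp₀eq x (Metric.ball_subset_closedBall (hB23 hxB))]
          rw [e, sub_self, mul_zero] at h2
          exact h2
        · rw [image_eq_zero_of_notMem_tsupport fun h => hxB (hζs h)]
          simp)
    simpa using this
  have lim2 : Tendsto (fun j => ∫ x in Ω, pj j x * E x) atTop (𝓝 (∫ x in Ω, P x * E x)) := by
    refine tendsto_integral_of_dominated_convergence (fun x => |C₀| * ‖E x‖)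
      (fun j => (hEj_int j).1) (hEint.norm.const_mul _)
      (fun j => ae_of_all _ fun x => by
        rw [norm_mul]; exact mul_le_mul_of_nonneg_right (hpjb j x) (norm_nonneg _))
      (ae_of_all _ fun x => ?_)
    rcases hann x with ⟨h1, h2, h3⟩ | hx
    · simp [hE, h1, h2, h3]
    · rw [hPp x hx]
      exact (hpjlim x (hB23 hx.1)).mul_const _
  have hlim : b * p y = ∫ x in Ω, P x * E x := by
    have l1 := (hpjlim y (Metric.mem_ball_self (by linarith))).const_mul b
    have l2 := lim1.add lim2
    rw [zero_add] at l2
    exact tendsto_nhds_unique l1 (l2.congr fun j => (hstep j).symm)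
  -- The divergence of `P Q ∇ζ` integrates to zero. Subtracting it from `∫ P E` removes `Δζ` and
  -- leaves the antisymmetric flux `∇ζ·(P∇Q - Q∇P)`.
  have u1 := hP.integral_dz_mul hQ hζ.dz
  have u2 := hP.integral_dx_mul hQ hζ.dx
  have test_mul : ∀ {ψ f g : ℝ × ℝ → ℂ}, IsTest univ ψ → MemLp f 2 (volume.restrict Ω) →
      MemLp g 2 (volume.restrict Ω) → Integrable (fun x => ψ x * (f x * g x)) (volume.restrict Ω) :=
    fun hψ hf hg => (memLp_two_mul_integrable (hψ.mul_memLp hf) hg).congr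
      (ae_of_all _ fun x => mul_assoc _ _ _)
  have m1 : Integrable (fun x => dz (dz ζ) x * (P x * Q x)
      + dz ζ x * (Pz x * Q x + P x * Qz x)) (volume.restrict Ω) := by
    refine (test_mul hζ.dz.dz hP.memLp hQ.memLp).add ?_
    refine ((test_mul hζ.dz hP.memLp_z hQ.memLp).add (test_mul hζ.dz hP.memLp hQ.memLp_z)).congr
      (ae_of_all _ fun x => ?_)
    simp only [Pi.add_apply]
    ring
  have m2 : Integrable (fun x => dx (dx ζ) x * (P x * Q x)
      + dx ζ x * (Px x * Q x + P x * Qx x)) (volume.restrict Ω) := by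
    refine (test_mul hζ.dx.dx hP.memLp hQ.memLp).add ?_
    refine ((test_mul hζ.dx hP.memLp_x hQ.memLp).add (test_mul hζ.dx hP.memLp hQ.memLp_x)).congr
      (ae_of_all _ fun x => ?_)
    simp only [Pi.add_apply]
    ring
  have m12 : Integrable (fun x => (dz (dz ζ) x * (P x * Q x)
      + dz ζ x * (Pz x * Q x + P x * Qz x)) + (dx (dx ζ) x * (P x * Q x)
      + dx ζ x * (Px x * Q x + P x * Qx x))) (volume.restrict Ω) := m1.add m2
  have mE : Integrable (fun x => P x * E x) (volume.restrict Ω) := by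
    refine (((test_mul hζl hP.memLp hQ.memLp).add (((test_mul hζ.dz hP.memLp hQ.memLp_z).add
      (test_mul hζ.dx hP.memLp hQ.memLp_x)).const_mul 2))).congr (ae_of_all _ fun x => ?_)
    simp only [Pi.add_apply, hE]
    ring
  have u12 : ∫ x in Ω, ((dz (dz ζ) x * (P x * Q x)
      + dz ζ x * (Pz x * Q x + P x * Qz x)) + (dx (dx ζ) x * (P x * Q x)
      + dx ζ x * (Px x * Q x + P x * Qx x))) = 0 := by
    rw [integral_add m1 m2, u1, u2, add_zero]
  rw [hlim, ← sub_zero (∫ x in Ω, P x * E x), ← u12, ← integral_sub mE m12]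
  refine integral_congr_ae (ae_of_all _ fun x => ?_)
  simp only [hE, lap]
  ring

/-! ### Integrability of the logarithmic singularity -/

/-- The distance is at least `|z - z_s|`, and `log t ≤ t - 1` bounds the logarithm above. So the
singularity is dominated by that of the one-variable logarithm, plus a constant. -/
lemma integrableOn_log_edist2 (s : ℝ × ℝ) (R : ℝ) :
    IntegrableOn (fun p => Real.log (edist2 p s)) (Metric.closedBall s R) := by
  have hball : Metric.closedBall s R
      = Icc (s.1 - R) (s.1 + R) ×ˢ Icc (s.2 - R) (s.2 + R) := by
    rw [← Real.closedBall_eq_Icc, ← Real.closedBall_eq_Icc, closedBall_prod_same]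
  have hlog : IntegrableOn (fun t => |Real.log (t - s.1)|) (Icc (s.1 - R) (s.1 + R)) := by
    by_cases hR : 0 ≤ R
    · have h1 : IntervalIntegrable Real.log volume (-R) R := intervalIntegral.intervalIntegrable_log'
      have h2 := h1.comp_sub_right s.1
      rw [neg_add_eq_sub, add_comm R, intervalIntegrable_iff_integrableOn_Icc_of_le
        (by linarith)] at h2
      exact h2.abs
    · rw [Icc_eq_empty (by linarith)]
      exact integrableOn_empty
  have hdom : IntegrableOn (fun p : ℝ × ℝ => |Real.log (p.1 - s.1)| + 2 * |R|)
      (Metric.closedBall s R) := by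
    refine Integrable.add ?_ ?_
    · rw [hball, Measure.volume_eq_prod, ← Measure.prod_restrict]
      exact hlog.comp_fst _
    · exact integrableOn_const (isCompact_closedBall s R).measure_lt_top.ne
  have hmeas : Measurable (fun p : ℝ × ℝ => Real.log (edist2 p s)) := by
    unfold edist2
    fun_prop
  have hne : ∀ᵐ p : ℝ × ℝ, p.1 ≠ s.1 :=
    Measure.quasiMeasurePreserving_fst.ae (Measure.ae_ne volume s.1)
  refine Integrable.mono' hdom hmeas.aestronglyMeasurable ?_
  filter_upwards [ae_restrict_of_ae hne, ae_restrict_mem Metric.isClosed_closedBall.measurableSet]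
    with p hp hpR
  have ha : 0 < |p.1 - s.1| := abs_pos.2 (sub_ne_zero.2 hp)
  have hae : |p.1 - s.1| ≤ edist2 p s := by
    rw [edist2, ← Real.sqrt_sq_eq_abs]
    exact Real.sqrt_le_sqrt (by nlinarith [sq_nonneg (p.2 - s.2)])
  have hpos : 0 < edist2 p s := ha.trans_le hae
  have hle : edist2 p s ≤ 2 * |R| := by
    rw [Metric.mem_closedBall, Prod.dist_eq, Real.dist_eq, Real.dist_eq] at hpR
    have h1 := abs_le.1 (((le_max_left _ _).trans hpR).trans (le_abs_self R))
    have h2 := abs_le.1 (((le_max_right _ _).trans hpR).trans (le_abs_self R))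
    -- In a sup-norm ball of radius `R` the Euclidean distance is at most `√2 R`; `2R` is a
    -- convenient larger constant.
    rw [edist2, Real.sqrt_le_left (by positivity)]
    nlinarith [abs_nonneg R]
  rw [Real.norm_eq_abs]
  refine abs_le.2 ⟨?_, ?_⟩
  · have h1 := Real.log_le_log ha hae
    rw [Real.log_abs] at h1
    have h2 := neg_abs_le (Real.log (p.1 - s.1))
    have h3 := abs_nonneg R
    linarith
  · have h1 := Real.log_le_sub_one_of_pos hpos
    have h2 := abs_nonneg (Real.log (p.1 - s.1))
    linarith

/-! ### Fields radiated by point charges -/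

/-- `p` is a solution of the Dirichlet problem in the waveguide with the source `a δ_s`, continuously
differentiable in range to the left of the source; no radiation condition is imposed. -/
structure IsField (Ω : Set (ℝ × ℝ)) (L D k : ℝ) (η : ℝ × ℝ → ℝ) (s : ℝ × ℝ) (a : ℂ)
    (p : ℝ × ℝ → ℂ) : Prop where
  singularity : ∃ h : ℝ × ℝ → ℂ, ContinuousOn h Ω ∧ ∀ x ∈ Ω, x ≠ s →
    p x = a * ((-(1 / (2 * Real.pi)) * Real.log (edist2 x s) : ℝ) : ℂ) + h x
  helmholtz : ∀ φ, IsTest Ω φ → ∫ x in Ω, p x * helm k η φ x = a * φ s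
  dirichlet : ∀ χ : ℝ × ℝ → ℂ, ContDiff ℝ ∞ χ → HasCompactSupport χ → s ∉ tsupport χ →
    MemH10 Ω (fun x => χ x * p x)
  regular : ∀ z < min L s.1, ∀ x ∈ Ioo 0 D,
    DifferentiableAt ℝ p (z, x) ∧ ContinuousAt (dz p) (z, x)

lemma integrableOn_of_singularity {Ω : Set (ℝ × ℝ)} {s : ℝ × ℝ} {a : ℂ} {p h : ℝ × ℝ → ℂ}
    (hh : ContinuousOn h Ω)
    (hp : ∀ x ∈ Ω, x ≠ s → p x = a * ((-(1 / (2 * Real.pi)) * Real.log (edist2 x s) : ℝ) : ℂ) + h x)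
    {K : Set (ℝ × ℝ)} (hK : IsCompact K) (hKΩ : K ⊆ Ω) : IntegrableOn p K := by
  obtain ⟨R, hR⟩ := hK.isBounded.subset_closedBall s
  have h1 : IntegrableOn (fun x => a * ((-(1 / (2 * Real.pi)) * Real.log (edist2 x s) : ℝ) : ℂ)
      + h x) K :=
    (((((integrableOn_log_edist2 s R).mono_set hR).const_mul _).ofReal).const_mul a).add
      ((hh.mono hKΩ).integrableOn_compact hK)
  refine h1.congr ?_
  filter_upwards [ae_restrict_mem hK.measurableSet, ae_restrict_of_ae (Measure.ae_ne volume s)]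
    with x hx hxs
  exact (hp x (hKΩ hx) hxs).symm

lemma integrableOn_mul_of_hasCompactSupport {Ω : Set (ℝ × ℝ)} (hΩ : MeasurableSet Ω)
    {p ψ : ℝ × ℝ → ℂ} (hp : IntegrableOn p (tsupport ψ))
    (hm : AEStronglyMeasurable ψ (volume.restrict Ω)) {C : ℝ} (hb : ∀ x ∈ Ω, ‖ψ x‖ ≤ C)
    (hsub : tsupport ψ ⊆ Ω) : IntegrableOn (fun x => p x * ψ x) Ω := by
  have h1 : IntegrableOn (fun x => p x * ψ x) (tsupport ψ) := by
    refine Integrable.mul_bdd (c := C) hp (hm.mono_measure (Measure.restrict_mono hsub le_rfl)) ?_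
    filter_upwards [ae_restrict_mem (isClosed_tsupport ψ).measurableSet] with x hx
    exact hb x (hsub hx)
  refine IntegrableOn.of_forall_sdiff_eq_zero h1 hΩ fun x hx => ?_
  rw [image_eq_zero_of_notMem_tsupport hx.2, mul_zero]

lemma helm_eq_zero_of_notMem {k : ℝ} {η : ℝ × ℝ → ℝ} {φ : ℝ × ℝ → ℂ} {x : ℝ × ℝ}
    (h : x ∉ tsupport φ) : helm k η φ x = 0 := by
  rw [helm, lap_eq_zero_of_notMem h, image_eq_zero_of_notMem_tsupport h]
  simp

lemma tsupport_helm_subset (k : ℝ) (η : ℝ × ℝ → ℝ) (φ : ℝ × ℝ → ℂ) :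
    tsupport (helm k η φ) ⊆ tsupport φ :=
  closure_minimal (fun _ hx => by_contra fun h => hx (helm_eq_zero_of_notMem h))
    (isClosed_tsupport φ)

/-! ### Complex conjugates of fields. -/

section Conjugate

lemma fderiv_conj_apply (f : ℝ × ℝ → ℂ) (x v : ℝ × ℝ) :
    fderiv ℝ (fun t => conj (f t)) x v = conj (fderiv ℝ f x v) := by
  have := Complex.conjCLE.comp_fderiv (f := f) (x := x)
  change fderiv ℝ (fun t => conj (f t)) x = _ at this
  rw [this]
  simp

lemma dz_conj (f : ℝ × ℝ → ℂ) : dz (fun t => conj (f t)) = fun x => conj (dz f x) :=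
  funext fun x => fderiv_conj_apply f x _

lemma dx_conj (f : ℝ × ℝ → ℂ) : dx (fun t => conj (f t)) = fun x => conj (dx f x) :=
  funext fun x => fderiv_conj_apply f x _

lemma helm_conj (k : ℝ) (η : ℝ × ℝ → ℝ) (f : ℝ × ℝ → ℂ) (x : ℝ × ℝ) :
    helm k η (fun t => conj (f t)) x = conj (helm k η f x) := by
  rw [helm, lap, dz_conj, dx_conj, dz_conj, dx_conj]
  simp [helm, lap]

lemma tsupport_conj (f : ℝ × ℝ → ℂ) : tsupport (fun t => conj (f t)) = tsupport f := by
  unfold tsupport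
  congr 1
  ext x
  simp

lemma contDiff_conj {f : ℝ × ℝ → ℂ} (hf : ContDiff ℝ ∞ f) : ContDiff ℝ ∞ fun t => conj (f t) :=
  Complex.conjCLE.contDiff.comp hf

lemma IsTest.conjugate {Ω : Set (ℝ × ℝ)} {φ : ℝ × ℝ → ℂ} (h : IsTest Ω φ) :
    IsTest Ω fun t => conj (φ t) :=
  ⟨contDiff_conj h.smooth, h.compact.comp_left (g := fun c : ℂ => conj c) (map_zero _),
    by rw [tsupport_conj]; exact h.support⟩

lemma memLp_conj {μ : Measure (ℝ × ℝ)} {f : ℝ × ℝ → ℂ} (hf : MemLp f 2 μ) :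
    MemLp (fun t => conj (f t)) 2 μ :=
  hf.of_le (Complex.continuous_conj.comp_aestronglyMeasurable hf.1) (ae_of_all _ fun x => by simp)

lemma eLpNorm_conj_sub (μ : Measure (ℝ × ℝ)) (f g : ℝ × ℝ → ℂ) :
    eLpNorm ((fun t => conj (f t)) - fun t => conj (g t)) 2 μ = eLpNorm (f - g) 2 μ := by
  refine eLpNorm_congr_norm_ae (ae_of_all _ fun x => ?_)
  simp only [Pi.sub_apply]
  rw [← map_sub, RCLike.norm_conj]

lemma MemH10.conjugate {Ω : Set (ℝ × ℝ)} {w : ℝ × ℝ → ℂ} (h : MemH10 Ω w) :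
    MemH10 Ω fun t => conj (w t) := by
  obtain ⟨φ, gz, gx, h1, h2, h3, h4, h5, h6, h7⟩ := h
  refine ⟨fun j t => conj (φ j t), fun t => conj (gz t),
    fun t => conj (gx t), fun j => (h1 j).conjugate, memLp_conj h2, memLp_conj h3,
    memLp_conj h4, ?_, ?_, ?_⟩
  · simpa only [eLpNorm_conj_sub] using h5
  · simpa only [dz_conj, eLpNorm_conj_sub] using h6
  · simpa only [dx_conj, eLpNorm_conj_sub] using h7

end Conjugate

/-! ### Differences in the space `H¹₀`. -/

section Difference

lemma dz_sub {f g : ℝ × ℝ → ℂ} {x : ℝ × ℝ} (hf : DifferentiableAt ℝ f x)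
    (hg : DifferentiableAt ℝ g x) : dz (fun t => f t - g t) x = dz f x - dz g x := by
  unfold dz
  rw [fderiv_fun_sub hf hg]
  rfl

lemma dx_sub {f g : ℝ × ℝ → ℂ} {x : ℝ × ℝ} (hf : DifferentiableAt ℝ f x)
    (hg : DifferentiableAt ℝ g x) : dx (fun t => f t - g t) x = dx f x - dx g x := by
  unfold dx
  rw [fderiv_fun_sub hf hg]
  rfl

lemma IsTest.sub {Ω : Set (ℝ × ℝ)} {φ ψ : ℝ × ℝ → ℂ} (hφ : IsTest Ω φ) (hψ : IsTest Ω ψ) :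
    IsTest Ω fun t => φ t - ψ t :=
  ⟨hφ.smooth.sub hψ.smooth, hφ.compact.sub hψ.compact,
    (tsupport_sub φ ψ).trans (union_subset hφ.support hψ.support)⟩

lemma tendsto_eLpNorm_sub_sub {μ : Measure (ℝ × ℝ)} {F H : ℕ → ℝ × ℝ → ℂ} {f h : ℝ × ℝ → ℂ}
    (hF : ∀ j, MemLp (F j) 2 μ) (hH : ∀ j, MemLp (H j) 2 μ) (hf : MemLp f 2 μ) (hh : MemLp h 2 μ)
    (t1 : Tendsto (fun j => eLpNorm (F j - f) 2 μ) atTop (𝓝 0))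
    (t2 : Tendsto (fun j => eLpNorm (H j - h) 2 μ) atTop (𝓝 0)) :
    Tendsto (fun j => eLpNorm ((fun x => F j x - H j x) - fun x => f x - h x) 2 μ) atTop (𝓝 0) := by
  have t := t1.add t2
  rw [add_zero] at t
  refine tendsto_of_tendsto_of_tendsto_of_le_of_le tendsto_const_nhds t (fun _ => zero_le)
    fun j => ?_
  have e : ((fun x => F j x - H j x) - fun x => f x - h x) = (F j - f) - (H j - h) := by
    ext x; simp only [Pi.sub_apply]; ring
  rw [e]
  exact eLpNorm_sub_le ((hF j).sub hf).1 ((hH j).sub hh).1 (by norm_num)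

lemma MemH10.sub {Ω : Set (ℝ × ℝ)} {w v : ℝ × ℝ → ℂ} (hw : MemH10 Ω w) (hv : MemH10 Ω v) :
    MemH10 Ω fun t => w t - v t := by
  obtain ⟨φ, gz, gx, h1, h2, h3, h4, h5, h6, h7⟩ := hw
  obtain ⟨ψ, fz, fx, k1, k2, k3, k4, k5, k6, k7⟩ := hv
  have ez : ∀ j, dz (fun t => φ j t - ψ j t) = fun t => dz (φ j) t - dz (ψ j) t := fun j =>
    funext fun x => dz_sub (differentiable_of_contDiff (h1 j).smooth x)
      (differentiable_of_contDiff (k1 j).smooth x)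
  have ex : ∀ j, dx (fun t => φ j t - ψ j t) = fun t => dx (φ j) t - dx (ψ j) t := fun j =>
    funext fun x => dx_sub (differentiable_of_contDiff (h1 j).smooth x)
      (differentiable_of_contDiff (k1 j).smooth x)
  refine ⟨fun j t => φ j t - ψ j t, fun t => gz t - fz t, fun t => gx t - fx t,
    fun j => (h1 j).sub (k1 j), h2.sub k2, h3.sub k3, h4.sub k4, ?_, ?_, ?_⟩
  · exact tendsto_eLpNorm_sub_sub (fun j => (h1 j).memLp) (fun j => (k1 j).memLp) h2 k2 h5 k5
  · simp_rw [ez]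
    exact tendsto_eLpNorm_sub_sub (fun j => (h1 j).dz.memLp) (fun j => (k1 j).dz.memLp) h3 k3 h6 k6
  · simp_rw [ex]
    exact tendsto_eLpNorm_sub_sub (fun j => (h1 j).dx.memLp) (fun j => (k1 j).dx.memLp) h4 k4 h7 k7

end Difference

namespace IsField

variable {Ω : Set (ℝ × ℝ)} {L D k : ℝ} {η : ℝ × ℝ → ℝ} {s : ℝ × ℝ} {a b : ℂ} {p q : ℝ × ℝ → ℂ}

lemma integrableOn_compact (h : IsField Ω L D k η s a p) {K : Set (ℝ × ℝ)} (hK : IsCompact K)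
    (hKΩ : K ⊆ Ω) : IntegrableOn p K := by
  obtain ⟨g, hg, hp⟩ := h.singularity
  exact integrableOn_of_singularity hg hp hK hKΩ

lemma continuousOn (h : IsField Ω L D k η s a p) : ContinuousOn p (Ω \ {s}) := by
  obtain ⟨g, hg, hu⟩ := h.singularity
  refine ((continuousOn_const.mul ((continuousOn_log_edist2 s).mono fun p hp => hp.2)).add
    (hg.mono sdiff_subset)).congr fun p hp => hu p hp.1 hp.2

lemma integrableOn_mul_helm (h : IsField Ω L D k η s a p) (hΩ : MeasurableSet Ω)
    (hη : IsIndex Ω L η) {φ : ℝ × ℝ → ℂ} (hφ : IsTest Ω φ) :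
    IntegrableOn (fun x => p x * helm k η φ x) Ω := by
  have hcl : IsCompact (tsupport (helm k η φ)) :=
    IsCompact.of_isClosed_subset hφ.compact (isClosed_tsupport _) (tsupport_helm_subset k η φ)
  have hsub := (tsupport_helm_subset k η φ).trans hφ.support
  obtain ⟨C₁, h1⟩ := hφ.dz.dz.exists_bound
  obtain ⟨C₂, h2⟩ := hφ.dx.dx.exists_bound
  obtain ⟨C₃, h3⟩ := hφ.exists_bound
  obtain ⟨C₄, h4⟩ := hη.bounded
  have hm : Measurable (helm k η φ) := by
    unfold helm lap
    have := hφ.dz.dz.continuous.measurable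
    have := hφ.dx.dx.continuous.measurable
    have := hφ.continuous.measurable
    have := hη.measurable
    fun_prop
  refine integrableOn_mul_of_hasCompactSupport hΩ (h.integrableOn_compact hcl hsub)
    hm.aestronglyMeasurable (C := (C₁ + C₂) + k ^ 2 * C₄ * C₃) (fun x hx => ?_) hsub
  rw [helm]
  refine (norm_sub_le _ _).trans (add_le_add ?_ ?_)
  · rw [norm_neg]
    exact (norm_add_le _ _).trans (add_le_add (h1 x) (h2 x))
  · rw [norm_mul, norm_mul, norm_pow, Complex.norm_real, Complex.norm_real, Real.norm_eq_abs,
      Real.norm_eq_abs, sq_abs]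
    have := h4 x hx
    exact mul_le_mul (mul_le_mul_of_nonneg_left this (sq_nonneg k)) (h3 x) (norm_nonneg _)
      (mul_nonneg (sq_nonneg k) ((abs_nonneg _).trans this))

/-- True because `k` and `η` are real. Conjugation turns outgoing fields into incoming ones, which
is why `IsField` carries no radiation condition. -/
lemma conjugate (h : IsField Ω L D k η s a p) :
    IsField Ω L D k η s (conj a) (fun t => conj (p t)) := by
  refine ⟨?_, fun φ hφ => ?_, fun χ h1 h2 h3 => ?_, fun z hz x hx => ?_⟩
  · obtain ⟨g, hg, hp⟩ := h.singularity
    refine ⟨fun t => conj (g t), Complex.continuous_conj.comp_continuousOn hg,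
      fun x hx hxs => ?_⟩
    rw [hp x hx hxs, map_add, map_mul, Complex.conj_ofReal]
  · have := congrArg conj (h.helmholtz _ hφ.conjugate)
    rw [← integral_conj] at this
    simpa [helm_conj] using this
  · have := (h.dirichlet _ (contDiff_conj h1)
      (h2.comp_left (g := fun c : ℂ => conj c) (map_zero _))
      (by rwa [tsupport_conj])).conjugate
    simpa using this
  · obtain ⟨h1, h2⟩ := h.regular z hz x hx
    refine ⟨Complex.conjCLE.differentiableAt.comp _ h1, ?_⟩
    rw [dz_conj]
    exact Complex.continuous_conj.continuousAt.comp h2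

/-- Meant for `G - conj G`, where equal charges cancel and leave a source-free field. -/
lemma sub (hp : IsField Ω L D k η s a p) (hq : IsField Ω L D k η s b q)
    (hΩ : IsTerminating Ω L D) (hη : IsIndex Ω L η) :
    IsField Ω L D k η s (a - b) (fun t => p t - q t) := by
  have hΩm := hΩ.isOpen.measurableSet
  refine ⟨?_, fun φ hφ => ?_, fun χ h1 h2 h3 => ?_, fun z hz x hx => ?_⟩
  · obtain ⟨g, hg, hp⟩ := hp.singularity
    obtain ⟨g', hg', hq⟩ := hq.singularity
    refine ⟨fun t => g t - g' t, hg.sub hg', fun x hx hxs => ?_⟩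
    rw [hp x hx hxs, hq x hx hxs]
    ring
  · rw [sub_mul, ← hp.helmholtz φ hφ, ← hq.helmholtz φ hφ,
      ← integral_sub (hp.integrableOn_mul_helm hΩm hη hφ) (hq.integrableOn_mul_helm hΩm hη hφ)]
    simp_rw [sub_mul]
  · simpa only [mul_sub] using (hp.dirichlet χ h1 h2 h3).sub (hq.dirichlet χ h1 h2 h3)
  · obtain ⟨h1, h2⟩ := hp.regular z hz x hx
    obtain ⟨h3, h4⟩ := hq.regular z hz x hx
    refine ⟨h1.sub h3, (h2.sub h4).congr ?_⟩
    have hU : IsOpen (Iio (min L s.1) ×ˢ Ioo 0 D) := isOpen_Iio.prod isOpen_Ioo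
    filter_upwards [hU.mem_nhds (show (z, x) ∈ Iio (min L s.1) ×ˢ Ioo 0 D from ⟨hz, hx⟩)] with t ht
    exact (dz_sub (hp.regular t.1 ht.1 t.2 ht.2).1 (hq.regular t.1 ht.1 t.2 ht.2).1).symm

/-- The value at the source is irrelevant. -/
lemma congr (hp : IsField Ω L D k η s a p) (h : ∀ x, x ≠ s → q x = p x) :
    IsField Ω L D k η s a q := by
  refine ⟨?_, fun φ hφ => ?_, fun χ h1 h2 h3 => ?_, fun z hz x hx => ?_⟩
  · obtain ⟨g, hg, hp⟩ := hp.singularity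
    exact ⟨g, hg, fun x hx hxs => by rw [h x hxs, hp x hx hxs]⟩
  · rw [← hp.helmholtz φ hφ]
    refine integral_congr_ae ?_
    filter_upwards [ae_restrict_of_ae (Measure.ae_ne volume s)] with x hx
    rw [h x hx]
  · have e : (fun x => χ x * q x) = fun x => χ x * p x := by
      ext x
      by_cases hx : x = s
      · rw [hx, image_eq_zero_of_notMem_tsupport h3]; simp
      · rw [h x hx]
    rw [e]
    exact hp.dirichlet χ h1 h2 h3
  · obtain ⟨h1, h2⟩ := hp.regular z hz x hx
    have hne : ((z, x) : ℝ × ℝ) ≠ s := fun e => by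
      have : z < s.1 := lt_of_lt_of_le hz (min_le_right _ _)
      rw [← e] at this
      exact lt_irrefl _ this
    have hev : ∀ t, t ≠ s → q =ᶠ[𝓝 t] p := fun t ht => by
      filter_upwards [isOpen_compl_singleton.mem_nhds (show t ∈ ({s}ᶜ : Set (ℝ × ℝ)) from ht)]
        with t' ht' using h t' ht'
    refine ⟨h1.congr_of_eventuallyEq (hev _ hne), h2.congr ?_⟩
    filter_upwards [isOpen_compl_singleton.mem_nhds (show (z, x) ∈ ({s}ᶜ : Set (ℝ × ℝ)) from hne)]
      with t ht
    rw [dz, dz, (hev t ht).fderiv_eq]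

end IsField

lemma IsGreen.isField {Ω : Set (ℝ × ℝ)} {L D k : ℝ} {η : ℝ × ℝ → ℝ} {s : ℝ × ℝ} {u : ℝ × ℝ → ℂ}
    (hΩ : IsTerminating Ω L D) (h : IsGreen Ω L D k η s u) : IsField Ω L D k η s 1 u := by
  refine ⟨?_, fun φ hφ => ?_, h.dirichlet, fun z hz x hx => ?_⟩
  · simpa using h.singularity
  · rw [one_mul, ← h.helmholtz φ hφ]; rfl
  · exact ((h.modal_expansion hΩ hz).2.2 x hx).2.2

/-! ### The flux identity -/

lemma integrable_test_mul {U : Set (ℝ × ℝ)} {ψ f : ℝ × ℝ → ℂ} (hψ : IsTest U ψ)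
    (hf : ContinuousOn f U) : Integrable fun x => ψ x * f x := by
  have h1 : IntegrableOn (fun x => ψ x * f x) (tsupport ψ) :=
    (hψ.continuous.continuousOn.mul (hf.mono hψ.support)).integrableOn_compact hψ.compact
  refine (integrableOn_iff_integrable_of_support_subset fun x hx => ?_).1 h1
  by_contra h
  exact hx (by simp only [image_eq_zero_of_notMem_tsupport h, zero_mul])

/-- Where an `H¹₀` function is continuously differentiable, its weak derivative is the classical
one. -/
lemma IsH10.ae_eq_dz {Ω U : Set (ℝ × ℝ)} {P Pz Px p : ℝ × ℝ → ℂ} {Φ : ℕ → ℝ × ℝ → ℂ}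
    (hP : IsH10 Ω P Pz Px Φ) (hU : IsOpen U) (hUΩ : U ⊆ Ω) (hPp : ∀ x ∈ U, P x = p x)
    (hd : ∀ x ∈ U, DifferentiableAt ℝ p x) (hc : ContinuousOn (dz p) U) :
    ∀ᵐ x, x ∈ U → Pz x = dz p x := by
  have hloc : LocallyIntegrableOn Pz U := by
    refine (locallyIntegrableOn_iff hU.isLocallyClosed).2 fun K hKU hK => ?_
    have : IsFiniteMeasure (volume.restrict K) := ⟨by simpa using hK.measure_lt_top⟩
    exact (hP.memLp_z.mono_measure (Measure.restrict_mono (hKU.trans hUΩ) le_rfl)).integrable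
      (by norm_num)
  -- Fundamental lemma of the calculus of variations: both derivatives satisfy the same integration
  -- by parts against test functions in `U`.
  have := hU.ae_eq_zero_of_integral_contDiff_smul_eq_zero
    (hloc.sub (hc.locallyIntegrableOn hU.measurableSet)) (fun g hg hgc hgU => by
      have hψ : IsTest U (fun x => ((g x : ℝ) : ℂ)) := by
        refine ⟨Complex.ofRealCLM.contDiff.comp hg,
          hgc.comp_left (g := fun r : ℝ => (r : ℂ)) Complex.ofReal_zero, ?_⟩
        refine (closure_mono fun p hp => ?_).trans hgU
        simp only [Function.mem_support, ne_eq, Complex.ofReal_eq_zero] at hp ⊢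
        exact hp
      set ψ : ℝ × ℝ → ℂ := fun x => ((g x : ℝ) : ℂ) with hψd
      have hpc : ContinuousOn p U := fun x hx => (hd x hx).continuousAt.continuousWithinAt
      have i1 : Integrable (fun x => ψ x * dz p x) := integrable_test_mul hψ hc
      have i2 : Integrable (fun x => dz ψ x * p x) := integrable_test_mul hψ.dz hpc
      have i3 : Integrable (fun x => ψ x * p x) := integrable_test_mul hψ hpc
      have byparts : ∫ x, ψ x * dz p x = -∫ x, dz ψ x * p x :=
        integral_mul_fderiv_eq_neg_fderiv_mul_of_integrable i2 i1 i3
          (fun x _ => differentiable_of_contDiff hψ.smooth x) (fun x hx => hd x (hψ.support hx))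
      have hψΩ := hψ.mono hUΩ
      have j1 : Integrable (fun x => dz ψ x * P x) (volume.restrict Ω) :=
        memLp_two_mul_integrable hψ.dz.memLp hP.memLp
      have j2 : Integrable (fun x => ψ x * Pz x) (volume.restrict Ω) :=
        memLp_two_mul_integrable hψ.memLp hP.memLp_z
      have weak := hP.integral_dz (hψ.mono (subset_univ _))
      rw [integral_add j1 j2] at weak
      have e1 : ∫ x in Ω, dz ψ x * P x = ∫ x, dz ψ x * p x := by
        rw [setIntegral_eq_integral_of_forall_compl_eq_zero fun x hx => by
          rw [hψΩ.dz.eq_zero hx, zero_mul]]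
        refine integral_congr_ae (ae_of_all _ fun x => ?_)
        by_cases hx : x ∈ U
        · simp only [hPp x hx]
        · simp only [hψ.dz.eq_zero hx, zero_mul]
      have e2 : ∫ x in Ω, ψ x * Pz x = ∫ x, ψ x * Pz x :=
        setIntegral_eq_integral_of_forall_compl_eq_zero fun x hx => by
          rw [hψΩ.eq_zero hx, zero_mul]
      have j2' : Integrable (fun x => ψ x * Pz x) :=
        (integrableOn_iff_integrable_of_support_subset (s := Ω) fun x hx => by
          by_contra h
          exact hx (by simp only [hψΩ.eq_zero h, zero_mul])).1 j2
      have : ∀ x, g x • ((Pz - dz p) x) = ψ x * Pz x - ψ x * dz p x := fun x => by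
        simp only [Pi.sub_apply, Complex.real_smul, hψd]
        ring
      simp_rw [this]
      rw [integral_sub j2' i1, byparts, ← e1, ← e2]
      linear_combination weak)
  filter_upwards [this] with x hx hxU
  exact sub_eq_zero.1 (hx hxU)

lemma exists_isTest_bump (y : ℝ × ℝ) {r R : ℝ} (hr : 0 < r) (hR : r < R) :
    ∃ ζ : ℝ × ℝ → ℂ, IsTest univ ζ ∧ tsupport ζ ⊆ Metric.closedBall y R ∧
      ∀ x ∈ Metric.closedBall y r, ζ x = 1 := by
  let β : ContDiffBump y := ⟨r, R, hr, hR⟩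
  refine ⟨fun x => ((β x : ℝ) : ℂ), ⟨Complex.ofRealCLM.contDiff.comp β.contDiff,
    β.hasCompactSupport.comp_left (g := fun r : ℝ => (r : ℂ)) Complex.ofReal_zero, subset_univ _⟩,
    ?_, fun x hx => ?_⟩
  · have h1 : tsupport (fun x => ((β x : ℝ) : ℂ)) ⊆ tsupport β := closure_mono fun p hp => by
      simp only [Function.mem_support, ne_eq, Complex.ofReal_eq_zero] at hp ⊢
      exact hp
    exact h1.trans β.tsupport_eq.subset
  · simp only [β.one_of_mem_closedBall hx, Complex.ofReal_one]

/-- A smooth step, `0` to the left of `a` and `1` to the right of `b`. -/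
lemma exists_smooth_step {a b : ℝ} (hab : a < b) : ∃ θ : ℝ → ℝ, ContDiff ℝ ∞ θ ∧
    (∀ z ≤ a, θ z = 0) ∧ ∀ z, b ≤ z → θ z = 1 := by
  refine ⟨fun z => Real.smoothTransition ((z - a) / (b - a)), ?_, fun z hz => ?_, fun z hz => ?_⟩
  · exact Real.smoothTransition.contDiff.comp (by fun_prop)
  · exact Real.smoothTransition.zero_of_nonpos
      (div_nonpos_of_nonpos_of_nonneg (by linarith) (by linarith))
  · refine Real.smoothTransition.one_of_one_le ?_
    rw [one_le_div (by linarith)]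
    linarith

lemma IsTerminating.exists_bound {Ω : Set (ℝ × ℝ)} {L D : ℝ} (hΩ : IsTerminating Ω L D) (z₀ : ℝ) :
    ∃ R > 0, ∀ x ∈ Ω, z₀ ≤ x.1 → x ∈ Metric.closedBall (0 : ℝ × ℝ) R := by
  have hb : Bornology.IsBounded ((Ω ∩ {p | L ≤ p.1}) ∪ (Icc z₀ L ×ˢ Icc 0 D)) :=
    hΩ.bounded.union ((isCompact_Icc.prod isCompact_Icc).isBounded)
  obtain ⟨R, hR⟩ := hb.subset_closedBall (0 : ℝ × ℝ)
  refine ⟨max R 1, by positivity, fun x hx hz => ?_⟩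
  refine Metric.closedBall_subset_closedBall (le_max_left _ _) (hR ?_)
  by_cases h : L ≤ x.1
  · exact Or.inl ⟨hx, h⟩
  · have : x ∈ Ω ∩ {p | p.1 < L} := ⟨hx, not_le.1 h⟩
    rw [hΩ.strip] at this
    exact Or.inr ⟨⟨hz, this.1.le⟩, this.2.1.le, this.2.2.le⟩

/-- The flux density of a pair of fields through the level lines of `χ`. -/
noncomputable def fluxDensity (χ P Pz Px Q Qz Qx : ℝ × ℝ → ℂ) (x : ℝ × ℝ) : ℂ :=
  dz χ x * (Q x * Pz x - P x * Qz x) + dx χ x * (Q x * Px x - P x * Qx x)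

lemma integrable_fluxDensity {Ω : Set (ℝ × ℝ)} {P Pz Px Q Qz Qx : ℝ × ℝ → ℂ}
    {Φ Ψ : ℕ → ℝ × ℝ → ℂ} (hP : IsH10 Ω P Pz Px Φ) (hQ : IsH10 Ω Q Qz Qx Ψ) {χ : ℝ × ℝ → ℂ}
    (hχ : IsTest univ χ) : IntegrableOn (fluxDensity χ P Pz Px Q Qz Qx) Ω := by
  have := ((memLp_two_mul_integrable (hχ.dz.mul_memLp hQ.memLp) hP.memLp_z).sub
    (memLp_two_mul_integrable (hχ.dz.mul_memLp hP.memLp) hQ.memLp_z)).add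
    ((memLp_two_mul_integrable (hχ.dx.mul_memLp hQ.memLp) hP.memLp_x).sub
    (memLp_two_mul_integrable (hχ.dx.mul_memLp hP.memLp) hQ.memLp_x))
  refine this.congr (ae_of_all _ fun x => ?_)
  simp only [Pi.add_apply, Pi.sub_apply, fluxDensity]
  ring

/-! ### Green's identity with sources. -/

namespace IsField

variable {Ω : Set (ℝ × ℝ)} {L D k : ℝ} {η : ℝ × ℝ → ℝ} {s y : ℝ × ℝ} {a b : ℂ} {p q : ℝ × ℝ → ℂ}

lemma integral_eq_zero (h : IsField Ω L D k η s a p) {V : Set (ℝ × ℝ)} (hs : s ∉ V)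
    {P : ℝ × ℝ → ℂ} (hPp : ∀ x ∈ V, P x = p x) {φ : ℝ × ℝ → ℂ} (hφ : IsTest (Ω ∩ V) φ) :
    ∫ x in Ω, P x * helm k η φ x = 0 := by
  have h1 := h.helmholtz φ (hφ.mono inter_subset_left)
  rw [hφ.eq_zero fun h => hs h.2, mul_zero] at h1
  rw [← h1]
  refine integral_congr_ae (ae_of_all _ fun x => ?_)
  by_cases hx : x ∈ V
  · simp only [hPp x hx]
  · have : x ∉ tsupport φ := fun h => hx (hφ.support h).2
    simp only [helm_eq_zero_of_notMem this, mul_zero]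

/-- Conservation of the flux between a contour around the sources of two fields and the vertical
cross-sections to the left of them. -/
lemma exists_flux (hp : IsField Ω L D k η s a p) (hq : IsField Ω L D k η y b q)
    (hΩ : IsTerminating Ω L D) (hη : IsIndex Ω L η) {W : ℂ}
    {z₁ : ℝ} (hz₁ : z₁ < min L (min s.1 y.1))
    (hW : ∀ z < min L (min s.1 y.1),
      ∫ x in (0 : ℝ)..D, (q (z, x) * dz p (z, x) - p (z, x) * dz q (z, x)) = W)
    {r : ℝ} (hr : 0 < r) (hs : Metric.closedBall s (3 * r) ⊆ Ω ∩ {x | z₁ < x.1})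
    (hy : Metric.closedBall y (3 * r) ⊆ Ω ∩ {x | z₁ < x.1}) :
    ∃ P Pz Px Φ Q Qz Qx Ψ, IsH10 Ω P Pz Px Φ ∧ IsH10 Ω Q Qz Qx Ψ ∧
      (∀ x ∈ Metric.closedBall s (2 * r) ∪ Metric.closedBall y (2 * r),
        x ∉ Metric.ball s r ∪ Metric.ball y r → P x = p x ∧ Q x = q x) ∧
      ∀ Z, IsTest univ Z →
        tsupport Z ⊆ Metric.closedBall s (2 * r) ∪ Metric.closedBall y (2 * r) →
        (∀ x ∈ Metric.ball s r ∪ Metric.ball y r, Z x = 1) →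
        ∫ x in Ω, fluxDensity Z P Pz Px Q Qz Qx x = W := by
  set m := min L (min s.1 y.1) with hm
  have hms : m ≤ min L s.1 := le_min (min_le_left _ _) ((min_le_right _ _).trans (min_le_left _ _))
  have hmy : m ≤ min L y.1 := le_min (min_le_left _ _) ((min_le_right _ _).trans (min_le_right _ _))
  have hmL : m ≤ L := min_le_left _ _
  have hΩm := hΩ.isOpen.measurableSet
  -- The step function will vary only for ranges in `[z₀, z₁]`, to the left of `L` and of the balls
  -- around the sources.
  set z₀ := z₁ - 1 with hz₀
  have hz01 : z₀ < z₁ := by rw [hz₀]; linarith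
  obtain ⟨R, hR0, hR⟩ := hΩ.exists_bound z₀
  -- Nested cutoffs: `B₀` is `1` on the part of `Ω` to the right of `z₀`, and `B` is `1` on the
  -- whole support of `B₀`.
  obtain ⟨B₀, hB₀, hB₀s, hB₀1⟩ := exists_isTest_bump 0 (r := R + 1) (R := R + 2)
    (by linarith) (by linarith)
  obtain ⟨B, hB, hBs, hB1⟩ := exists_isTest_bump 0 (r := R + 3) (R := R + 4)
    (by linarith) (by linarith)
  obtain ⟨κs, hκs, hκss, hκs1⟩ := exists_isTest_bump s (r := r / 4) (R := r / 2)
    (by linarith) (by linarith)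
  obtain ⟨κy, hκy, hκys, hκy1⟩ := exists_isTest_bump y (r := r / 4) (R := r / 2)
    (by linarith) (by linarith)
  obtain ⟨θ, hθ, hθ0, hθ1⟩ := exists_smooth_step hz01
  -- Both fields receive the same cutoff. It vanishes near both sources, as the Dirichlet hypothesis
  -- requires, and equals `1` on `V`, where the flux is computed.
  set χ : ℝ × ℝ → ℂ := fun x => (1 - κs x) * (1 - κy x) * B x with hχ
  have hχsm : ContDiff ℝ ∞ χ :=
    ((contDiff_const.sub hκs.smooth).mul (contDiff_const.sub hκy.smooth)).mul hB.smooth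
  have hχc : HasCompactSupport χ := hB.compact.mul_left
  have notMem : ∀ t : ℝ × ℝ, (∀ x ∈ Metric.closedBall t (r / 4), χ x = 0) → t ∉ tsupport χ := by
    intro t ht
    rw [notMem_tsupport_iff_eventuallyEq]
    filter_upwards [Metric.closedBall_mem_nhds t (show 0 < r / 4 by linarith)] with x hx
    exact ht x hx
  have hχs : s ∉ tsupport χ := notMem s fun x hx => by simp only [hχ, hκs1 x hx]; ring
  have hχy : y ∉ tsupport χ := notMem y fun x hx => by simp only [hχ, hκy1 x hx]; ring
  set V : Set (ℝ × ℝ) := Metric.ball 0 (R + 3) \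
    (Metric.closedBall s (r / 2) ∪ Metric.closedBall y (r / 2)) with hV
  have hVo : IsOpen V :=
    Metric.isOpen_ball.sdiff (Metric.isClosed_closedBall.union Metric.isClosed_closedBall)
  have hχ1 : ∀ x ∈ V, χ x = 1 := by
    rintro x ⟨hx1, hx2⟩
    have e1 : κs x = 0 := image_eq_zero_of_notMem_tsupport fun h => hx2 (Or.inl (hκss h))
    have e2 : κy x = 0 := image_eq_zero_of_notMem_tsupport fun h => hx2 (Or.inr (hκys h))
    simp only [hχ, e1, e2, hB1 x (Metric.ball_subset_closedBall hx1)]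
    ring
  have hsV : s ∉ V := fun h => h.2 (Or.inl (Metric.mem_closedBall_self (by linarith)))
  have hyV : y ∉ V := fun h => h.2 (Or.inr (Metric.mem_closedBall_self (by linarith)))
  obtain ⟨Pz, Px, Φ, hP⟩ := (hp.dirichlet χ hχsm hχc hχs).exists_isH10
  obtain ⟨Qz, Qx, Ψ, hQ⟩ := (hq.dirichlet χ hχsm hχc hχy).exists_isH10
  set P : ℝ × ℝ → ℂ := fun x => χ x * p x with hPdef
  set Q : ℝ × ℝ → ℂ := fun x => χ x * q x with hQdef
  have hPp : ∀ x ∈ V, P x = p x := fun x hx => by simp only [hPdef, hχ1 x hx, one_mul]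
  have hQq : ∀ x ∈ V, Q x = q x := fun x hx => by simp only [hQdef, hχ1 x hx, one_mul]
  have hballs : ∀ t, Metric.closedBall t (3 * r) ⊆ Ω ∩ {x | z₁ < x.1} →
      ∀ x ∈ Metric.closedBall t (2 * r), x ∈ Ω ∧ z₁ < x.1 ∧ x ∈ Metric.closedBall (0 : ℝ × ℝ) R := by
    intro t ht x hx
    have h1 := ht (Metric.closedBall_subset_closedBall (by linarith) hx)
    exact ⟨h1.1, h1.2, hR x h1.1 (hz01.trans h1.2).le⟩
  have hballs' : ∀ x ∈ Metric.closedBall s (2 * r) ∪ Metric.closedBall y (2 * r),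
      x ∈ Ω ∧ z₁ < x.1 ∧ x ∈ Metric.closedBall (0 : ℝ × ℝ) R := fun x hx =>
    hx.elim (hballs s hs x) (hballs y hy x)
  have hRV : ∀ {R' : ℝ}, R' < R + 3 → Metric.closedBall (0 : ℝ × ℝ) R' ⊆ Metric.ball 0 (R + 3) :=
    fun h => Metric.closedBall_subset_ball h
  have hr2 : ∀ t : ℝ × ℝ, Metric.closedBall t (r / 2) ⊆ Metric.ball t r := fun t =>
    Metric.closedBall_subset_ball (by linarith)
  refine ⟨P, Pz, Px, Φ, Q, Qz, Qx, Ψ, hP, hQ, fun x hx hx' => ?_, fun Z hZ hZs hZ1 => ?_⟩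
  · have hxV : x ∈ V := ⟨hRV (by linarith) (hballs' x hx).2.2, fun h => hx'
      (h.imp (fun h => hr2 s h) fun h => hr2 y h)⟩
    exact ⟨hPp x hxV, hQq x hxV⟩
  set Θ : ℝ × ℝ → ℂ := fun x => ((θ x.1 : ℝ) : ℂ) * B₀ x with hΘ
  have hΘt : IsTest univ Θ :=
    ⟨(Complex.ofRealCLM.contDiff.comp (hθ.comp contDiff_fst)).mul hB₀.smooth,
      hB₀.compact.mul_left, subset_univ _⟩
  have hΘB : tsupport Θ ⊆ Metric.closedBall 0 (R + 2) := (tsupport_mul_subset_right).trans hB₀s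
  -- Near the sources `Θ` and `Z` are both `1`, so the difference is supported where the cut-off
  -- fields still solve the homogeneous equation.
  have hdiff : IsTest V (fun x => Θ x - Z x) := by
    have hT := hΘt.sub hZ
    refine ⟨hT.smooth, hT.compact, fun x hx => ?_⟩
    rw [hV, Set.mem_sdiff]
    refine ⟨?_, fun h => ?_⟩
    · rcases tsupport_sub Θ Z hx with h | h
      · exact hRV (by linarith) (hΘB h)
      · exact hRV (by linarith) (hballs' x (hZs h)).2.2
    · have hx' : x ∈ Metric.ball s r ∪ Metric.ball y r :=
        h.imp (fun h => hr2 s h) fun h => hr2 y h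
      refine (notMem_tsupport_iff_eventuallyEq.2 ?_) hx
      filter_upwards [(Metric.isOpen_ball.union Metric.isOpen_ball).mem_nhds hx'] with t ht
      have ht2 : t ∈ Metric.closedBall s (2 * r) ∪ Metric.closedBall y (2 * r) :=
        ht.imp (fun h => Metric.ball_subset_closedBall (Metric.ball_subset_ball (by linarith) h))
          fun h => Metric.ball_subset_closedBall (Metric.ball_subset_ball (by linarith) h)
      obtain ⟨-, h1, h2⟩ := hballs' t ht2
      simp only [hΘ, hZ1 t ht, hθ1 t.1 h1.le,
        hB₀1 t (Metric.closedBall_subset_closedBall (by linarith) h2)]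
      simp
  have hcons : ∫ x in Ω, fluxDensity (fun x => Θ x - Z x) P Pz Px Q Qz Qx x = 0 :=
    hP.integral_flux_eq_zero hQ hΩm hη (fun φ hφ => hp.integral_eq_zero hsV hPp hφ)
      (fun φ hφ => hq.integral_eq_zero hyV hQq hφ) hdiff
  have hsplit : ∀ x, fluxDensity (fun x => Θ x - Z x) P Pz Px Q Qz Qx x
      = fluxDensity Θ P Pz Px Q Qz Qx x - fluxDensity Z P Pz Px Q Qz Qx x := fun x => by
    rw [fluxDensity, dz_sub (differentiable_of_contDiff hΘt.smooth x)
      (differentiable_of_contDiff hZ.smooth x), dx_sub (differentiable_of_contDiff hΘt.smooth x)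
      (differentiable_of_contDiff hZ.smooth x), fluxDensity, fluxDensity]
    ring
  simp_rw [hsplit] at hcons
  rw [integral_sub (integrable_fluxDensity hP hQ hΘt) (integrable_fluxDensity hP hQ hZ),
    sub_eq_zero] at hcons
  rw [← hcons]
  -- the flux through the cross-sections
  have hθd : ∀ z, z ∉ Icc z₀ z₁ → deriv θ z = 0 := by
    intro z hz
    by_cases h : z < z₀
    · have : θ =ᶠ[𝓝 z] fun _ => 0 := by
        filter_upwards [Iio_mem_nhds h] with t ht using hθ0 t (le_of_lt ht)
      rw [this.deriv_eq, deriv_const]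
    · have h' : z₁ < z := not_le.1 fun h2 => hz ⟨not_lt.1 h, h2⟩
      have : θ =ᶠ[𝓝 z] fun _ => 1 := by
        filter_upwards [Ioi_mem_nhds h'] with t ht using hθ1 t (le_of_lt ht)
      rw [this.deriv_eq, deriv_const]
  -- Inside `Ω` the cutoff `B₀` is invisible: it is `1` to the right of `z₀`, and the step vanishes
  -- to the left. The gradient of `Θ` is purely longitudinal.
  have hΘder : ∀ x ∈ Ω, dz Θ x = ((deriv θ x.1 : ℝ) : ℂ) ∧ dx Θ x = 0 := by
    intro x hx
    by_cases h : x.1 < z₀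
    · have hU := isOpen_left z₀
      have h0 : ∀ t ∈ {t : ℝ × ℝ | t.1 < z₀}, Θ t = 0 := fun t ht => by
        simp only [hΘ, hθ0 t.1 (le_of_lt ht)]
        simp
      rw [dz_eq_zero_of_eqOn_const hU h0 h, dx_eq_zero_of_eqOn_const hU h0 h,
        hθd x.1 fun h' => absurd h'.1 (not_le.2 h)]
      simp
    · have hxB : x ∈ Metric.ball (0 : ℝ × ℝ) (R + 1) :=
        Metric.closedBall_subset_ball (by linarith) (hR x hx (not_lt.1 h))
      have hev : Θ =ᶠ[𝓝 x] fun t => ((θ t.1 : ℝ) : ℂ) := by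
        filter_upwards [Metric.isOpen_ball.mem_nhds hxB] with t ht
        simp only [hΘ, hB₀1 t (Metric.ball_subset_closedBall ht), mul_one]
      have hd : HasDerivAt (fun z : ℝ => ((θ z : ℝ) : ℂ)) ((deriv θ x.1 : ℝ) : ℂ) x.1 :=
        ((hθ.differentiable (by simp)) x.1).hasDerivAt.ofReal_comp
      have hf := (hd.hasFDerivAt.comp x (hasFDerivAt_fst (𝕜 := ℝ) (p := x))).fderiv
      change fderiv ℝ (fun t : ℝ × ℝ => ((θ t.1 : ℝ) : ℂ)) x = _ at hf
      rw [dz, dx, hev.fderiv_eq, hf]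
      simp
  set U : Set (ℝ × ℝ) := Iio m ×ˢ Ioo 0 D with hUdef
  have hUo : IsOpen U := isOpen_Iio.prod isOpen_Ioo
  have hUΩ : U ⊆ Ω := fun x hx => hΩ.strip_mem (lt_of_lt_of_le hx.1 hmL) hx.2
  have haeP : ∀ᵐ x, x ∈ U ∩ V → Pz x = dz p x :=
    hP.ae_eq_dz (hUo.inter hVo) (inter_subset_left.trans hUΩ) (fun x hx => hPp x hx.2)
      (fun x hx => (hp.regular x.1 (lt_of_lt_of_le hx.1.1 hms) x.2 hx.1.2).1)
      (fun x hx => (hp.regular x.1 (lt_of_lt_of_le hx.1.1 hms) x.2 hx.1.2).2.continuousWithinAt)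
  have haeQ : ∀ᵐ x, x ∈ U ∩ V → Qz x = dz q x :=
    hQ.ae_eq_dz (hUo.inter hVo) (inter_subset_left.trans hUΩ) (fun x hx => hQq x hx.2)
      (fun x hx => (hq.regular x.1 (lt_of_lt_of_le hx.1.1 hmy) x.2 hx.1.2).1)
      (fun x hx => (hq.regular x.1 (lt_of_lt_of_le hx.1.1 hmy) x.2 hx.1.2).2.continuousWithinAt)
  set w : ℝ × ℝ → ℂ := fun x =>
    ((deriv θ x.1 : ℝ) : ℂ) * (q x * dz p x - p x * dz q x) with hw
  have hdens : ∀ᵐ x ∂volume.restrict Ω, fluxDensity Θ P Pz Px Q Qz Qx x = U.indicator w x := by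
    filter_upwards [ae_restrict_of_ae haeP, ae_restrict_of_ae haeQ, ae_restrict_mem hΩm]
      with x h1 h2 hx
    obtain ⟨d1, d2⟩ := hΘder x hx
    rw [fluxDensity, d1, d2]
    by_cases hI : x.1 ∈ Icc z₀ z₁
    · have hxm : x.1 < m := lt_of_le_of_lt hI.2 hz₁
      have hxU : x ∈ U := by
        have : x ∈ Ω ∩ {p | p.1 < L} := ⟨hx, lt_of_lt_of_le hxm hmL⟩
        rw [hΩ.strip] at this
        exact ⟨hxm, this.2⟩
      have hxV : x ∈ V := by
        refine ⟨hRV (by linarith) (hR x hx hI.1), fun h => ?_⟩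
        have h' : x ∈ Metric.closedBall s (2 * r) ∪ Metric.closedBall y (2 * r) :=
          h.imp (fun h => Metric.closedBall_subset_closedBall (by linarith) h)
            fun h => Metric.closedBall_subset_closedBall (by linarith) h
        exact absurd hI.2 (not_le.2 (hballs' x h').2.1)
      rw [indicator_of_mem hxU, h1 ⟨hxU, hxV⟩, h2 ⟨hxU, hxV⟩, hPp x hxV, hQq x hxV]
      simp [hw]
    · rw [hθd x.1 hI]
      by_cases hxU : x ∈ U
      · rw [indicator_of_mem hxU]
        simp [hw, hθd x.1 hI]
      · rw [indicator_of_notMem hxU]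
        simp
  have hwint : IntegrableOn w U := by
    have h1 : IntegrableOn (U.indicator w) Ω :=
      (integrable_fluxDensity hP hQ hΘt).congr hdens
    have h2 := h1.mono_set hUΩ
    refine h2.congr ?_
    filter_upwards [ae_restrict_mem hUo.measurableSet] with x hx
    rw [indicator_of_mem hx]
  rw [integral_congr_ae hdens, setIntegral_indicator hUo.measurableSet,
    inter_eq_self_of_subset_right hUΩ, hUdef, Measure.volume_eq_prod, setIntegral_prod _ hwint]
  -- By Fubini the flux through `∇Θ` is the mean of the constant `W` with weight `θ'`, and `θ'` has
  -- integral `1`.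
  have hinner : ∀ z ∈ Iio m, ∫ x in Ioo 0 D, w (z, x) = ((deriv θ z : ℝ) : ℂ) * W := by
    intro z hz
    simp only [hw]
    rw [integral_const_mul, ← integral_Ioc_eq_integral_Ioo,
      ← intervalIntegral.integral_of_le hΩ.width_pos.le, hW z hz]
  rw [setIntegral_congr_fun measurableSet_Iio hinner, integral_mul_const, integral_complex_ofReal]
  have hθint : ∫ z in Iio m, deriv θ z = 1 := by
    rw [setIntegral_eq_of_subset_of_forall_sdiff_eq_zero measurableSet_Iio
      (fun z hz => lt_of_le_of_lt hz.2 hz₁ : Icc z₀ z₁ ⊆ Iio m) (fun z hz => hθd z hz.2),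
      integral_Icc_eq_integral_Ioc, ← intervalIntegral.integral_of_le hz01.le,
      intervalIntegral.integral_deriv_eq_sub (fun z _ => hθ.differentiable (by simp) z)
        ((hθ.continuous_deriv (by simp)).intervalIntegrable _ _),
      hθ0 z₀ le_rfl, hθ1 z₁ le_rfl, sub_zero]
  rw [hθint]
  simp

lemma exists_radius (hΩ : IsTerminating Ω L D) (hs : s ∈ Ω) (hy : y ∈ Ω) :
    ∃ z₁ < min L (min s.1 y.1), ∃ r > 0,
      Metric.closedBall s (3 * r) ⊆ Ω ∩ {x | z₁ < x.1} ∧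
      Metric.closedBall y (3 * r) ⊆ Ω ∩ {x | z₁ < x.1} ∧
      (s ≠ y → Disjoint (Metric.closedBall s (3 * r)) (Metric.closedBall y (3 * r))) := by
  obtain ⟨z₁, hz₁⟩ := exists_lt (min L (min s.1 y.1))
  have hzs : z₁ < s.1 := hz₁.trans_le ((min_le_right _ _).trans (min_le_left _ _))
  have hzy : z₁ < y.1 := hz₁.trans_le ((min_le_right _ _).trans (min_le_right _ _))
  have ho : IsOpen (Ω ∩ {x : ℝ × ℝ | z₁ < x.1}) :=
    hΩ.isOpen.inter (isOpen_lt continuous_const continuous_fst)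
  obtain ⟨r₁, hr₁, h₁⟩ := Metric.nhds_basis_closedBall.mem_iff.1 (ho.mem_nhds ⟨hs, hzs⟩)
  obtain ⟨r₂, hr₂, h₂⟩ := Metric.nhds_basis_closedBall.mem_iff.1 (ho.mem_nhds ⟨hy, hzy⟩)
  obtain ⟨r₃, hr₃, h₃⟩ : ∃ r > 0, s ≠ y →
      Disjoint (Metric.closedBall s r) (Metric.closedBall y r) := by
    by_cases h : s = y
    · exact ⟨1, one_pos, fun h' => absurd h h'⟩
    · refine ⟨dist s y / 3, by have := dist_pos.2 h; positivity, fun _ => ?_⟩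
      have := dist_pos.2 h
      exact Metric.closedBall_disjoint_closedBall (by linarith)
  have hle1 : min r₁ (min r₂ r₃) ≤ r₁ := min_le_left _ _
  have hle2 : min r₁ (min r₂ r₃) ≤ r₂ := (min_le_right _ _).trans (min_le_left _ _)
  have hle3 : min r₁ (min r₂ r₃) ≤ r₃ := (min_le_right _ _).trans (min_le_right _ _)
  refine ⟨z₁, hz₁, min r₁ (min r₂ r₃) / 3, by positivity, ?_, ?_, fun h => ?_⟩
  all_goals rw [mul_div_cancel₀ _ (three_ne_zero)]
  · exact (Metric.closedBall_subset_closedBall hle1).trans h₁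
  · exact (Metric.closedBall_subset_closedBall hle2).trans h₂
  · exact (h₃ h).mono (Metric.closedBall_subset_closedBall hle3)
      (Metric.closedBall_subset_closedBall hle3)

lemma integrableOn_mul_test (h : IsField Ω L D k η s a p) (hΩ : IsTerminating Ω L D)
    {ζ : ℝ × ℝ → ℂ} (hζ : IsTest univ ζ) (hs : tsupport ζ ⊆ Ω) :
    IntegrableOn (fun x => p x * ζ x) Ω := by
  obtain ⟨C, hC⟩ := hζ.exists_bound
  exact integrableOn_mul_of_hasCompactSupport hΩ.isOpen.measurableSet
    (h.integrableOn_compact hζ.compact hs) hζ.continuous.aestronglyMeasurable (fun x _ => hC x) hs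

/-- Kirchhoff-Helmholtz identity for two point charges at different points. -/
lemma flux_eq (hp : IsField Ω L D k η s a p) (hq : IsField Ω L D k η y b q)
    (hΩ : IsTerminating Ω L D) (hη : IsIndex Ω L η) (hs : s ∈ Ω) (hy : y ∈ Ω) (hsy : s ≠ y) {W : ℂ}
    (hW : ∀ z < min L (min s.1 y.1),
      ∫ x in (0 : ℝ)..D, (q (z, x) * dz p (z, x) - p (z, x) * dz q (z, x)) = W) :
    W = a * q s - b * p y := by
  obtain ⟨z₁, hz₁, r, hr, hsb, hyb, hdis⟩ := exists_radius hΩ hs hy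
  have hdis := hdis hsy
  obtain ⟨P, Pz, Px, Φ, Q, Qz, Qx, Ψ, hP, hQ, heq, hflux⟩ := hp.exists_flux hq hΩ hη hz₁ hW hr hsb hyb
  obtain ⟨ζs, hζs, hζss, hζs1⟩ := exists_isTest_bump s hr (by linarith : r < 2 * r)
  obtain ⟨ζy, hζy, hζys, hζy1⟩ := exists_isTest_bump y hr (by linarith : r < 2 * r)
  have sub23 : ∀ t : ℝ × ℝ, Metric.closedBall t (2 * r) ⊆ Metric.closedBall t (3 * r) := fun t =>
    Metric.closedBall_subset_closedBall (by linarith)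
  have sub13 : ∀ t : ℝ × ℝ, Metric.ball t r ⊆ Metric.closedBall t (3 * r) := fun t =>
    Metric.ball_subset_closedBall.trans (Metric.closedBall_subset_closedBall (by linarith))
  have hsΩ := hsb.trans inter_subset_left
  have hyΩ := hyb.trans inter_subset_left
  have anns : ∀ x ∈ Metric.closedBall s (2 * r) \ Metric.ball s r, P x = p x ∧ Q x = q x :=
    fun x hx => heq x (Or.inl hx.1) fun h => h.elim hx.2 fun h =>
      disjoint_left.1 hdis (sub23 s hx.1) (sub13 y h)
  have anny : ∀ x ∈ Metric.closedBall y (2 * r) \ Metric.ball y r, P x = p x ∧ Q x = q x :=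
    fun x hx => heq x (Or.inr hx.1) fun h => h.elim (fun h =>
      disjoint_left.1 hdis (sub13 s h) (sub23 y hx.1)) hx.2
  have hsy' : s ∉ Metric.closedBall y (3 * r) := fun h =>
    disjoint_left.1 hdis (Metric.mem_closedBall_self (by linarith)) h
  have hys' : y ∉ Metric.closedBall s (3 * r) := fun h =>
    disjoint_left.1 hdis h (Metric.mem_closedBall_self (by linarith))
  -- Near `y` the field `p` is regular and `q` singular; near `s` the roles are exchanged, which
  -- reverses the sign of the flux.
  have ey := integral_flux_source hΩ.isOpen hη hr hyΩ hζy hζys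
    (fun x hx => hζy1 x (Metric.ball_subset_closedBall hx))
    (hp.continuousOn.mono fun x hx => ⟨hyΩ hx, fun h => hsy' (h ▸ hx)⟩)
    (fun φ hφ => hp.integral_eq_zero (V := Metric.ball y (3 * r))
      (fun h => hsy' (Metric.ball_subset_closedBall h)) (fun _ _ => rfl)
      ⟨hφ.smooth, hφ.compact, subset_inter (hφ.support.trans
        (Metric.ball_subset_closedBall.trans hyΩ)) hφ.support⟩)
    (hq.integrableOn_mul_test hΩ hζy ((hζys.trans (sub23 y)).trans hyΩ)) hq.helmholtz hP hQ
    (fun x hx => (anny x hx).1) (fun x hx => (anny x hx).2)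
  have es := integral_flux_source hΩ.isOpen hη hr hsΩ hζs hζss
    (fun x hx => hζs1 x (Metric.ball_subset_closedBall hx))
    (hq.continuousOn.mono fun x hx => ⟨hsΩ hx, fun h => hys' (h ▸ hx)⟩)
    (fun φ hφ => hq.integral_eq_zero (V := Metric.ball s (3 * r))
      (fun h => hys' (Metric.ball_subset_closedBall h)) (fun _ _ => rfl)
      ⟨hφ.smooth, hφ.compact, subset_inter (hφ.support.trans
        (Metric.ball_subset_closedBall.trans hsΩ)) hφ.support⟩)
    (hp.integrableOn_mul_test hΩ hζs ((hζss.trans (sub23 s)).trans hsΩ)) hp.helmholtz hQ hP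
    (fun x hx => (anns x hx).2) (fun x hx => (anns x hx).1)
  have hZ : IsTest univ (fun x => ζs x + ζy x) :=
    ⟨hζs.smooth.add hζy.smooth, hζs.compact.add hζy.compact, subset_univ _⟩
  have hZf := hflux _ hZ ((tsupport_add ζs ζy).trans (union_subset_union hζss hζys)) (by
    rintro x (hx | hx)
    · have : ζy x = 0 := image_eq_zero_of_notMem_tsupport fun h =>
        disjoint_left.1 hdis (sub13 s hx) (sub23 y (hζys h))
      simp only [hζs1 x (Metric.ball_subset_closedBall hx), this, add_zero]
    · have : ζs x = 0 := image_eq_zero_of_notMem_tsupport fun h =>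
        disjoint_left.1 hdis (sub23 s (hζss h)) (sub13 y hx)
      simp only [hζy1 x (Metric.ball_subset_closedBall hx), this, zero_add])
  have i1 := integrable_fluxDensity hQ hP hζs
  have i2 := integrable_fluxDensity hP hQ hζy
  rw [← hZf, ← es]
  have ey' : -(b * p y) = ∫ x in Ω, fluxDensity ζy P Pz Px Q Qz Qx x := by
    rw [← ey, ← integral_neg]
    refine integral_congr_ae (ae_of_all _ fun x => ?_)
    simp only [fluxDensity]
    ring
  rw [sub_eq_add_neg, ey']
  have es' : ∫ x in Ω, (dz ζs x * (Q x * Pz x - P x * Qz x) + dx ζs x * (Q x * Px x - P x * Qx x))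
      = ∫ x in Ω, fluxDensity ζs P Pz Px Q Qz Qx x := rfl
  rw [es', ← integral_add (integrable_fluxDensity hP hQ hζs) i2]
  refine integral_congr_ae (ae_of_all _ fun x => ?_)
  simp only [fluxDensity]
  rw [dz_add (differentiable_of_contDiff hζs.smooth x) (differentiable_of_contDiff hζy.smooth x),
    dx_add (differentiable_of_contDiff hζs.smooth x) (differentiable_of_contDiff hζy.smooth x)]
  ring

/-- Kirchhoff-Helmholtz identity for a source-free field and a point charge. -/
lemma flux_eq_of_continuousOn (hp : IsField Ω L D k η y 0 p) (hpc : ContinuousOn p Ω)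
    (hq : IsField Ω L D k η y b q) (hΩ : IsTerminating Ω L D) (hη : IsIndex Ω L η) (hy : y ∈ Ω)
    {W : ℂ} (hW : ∀ z < min L y.1,
      ∫ x in (0 : ℝ)..D, (q (z, x) * dz p (z, x) - p (z, x) * dz q (z, x)) = W) :
    W = -(b * p y) := by
  obtain ⟨z₁, hz₁, r, hr, hyb, -, -⟩ := exists_radius hΩ hy hy
  -- Both source positions are taken at `y`, the first with charge `0`. A single bump then suffices,
  -- and continuity of `p` through `y` makes it the regular partner.
  obtain ⟨P, Pz, Px, Φ, Q, Qz, Qx, Ψ, hP, hQ, heq, hflux⟩ := hp.exists_flux hq hΩ hη hz₁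
    (by simpa using hW) hr hyb hyb
  simp only [union_self] at heq hflux
  obtain ⟨ζ, hζ, hζs, hζ1⟩ := exists_isTest_bump y hr (by linarith : r < 2 * r)
  have hyΩ := hyb.trans inter_subset_left
  have ey := integral_flux_source hΩ.isOpen hη hr hyΩ hζ hζs
    (fun x hx => hζ1 x (Metric.ball_subset_closedBall hx)) (hpc.mono hyΩ)
    (fun φ hφ => by
      rw [hp.helmholtz φ (hφ.mono (Metric.ball_subset_closedBall.trans hyΩ)), zero_mul])
    (hq.integrableOn_mul_test hΩ hζ ((hζs.trans
      (Metric.closedBall_subset_closedBall (by linarith))).trans hyΩ)) hq.helmholtz hP hQ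
    (fun x hx => (heq x hx.1 hx.2).1) (fun x hx => (heq x hx.1 hx.2).2)
  rw [← hflux ζ hζ hζs fun x hx => hζ1 x (Metric.ball_subset_closedBall hx), ← ey, ← integral_neg]
  refine integral_congr_ae (ae_of_all _ fun x => ?_)
  simp only [fluxDensity]
  ring

end IsField

/-! ### Boundary functionals in terms of modes -/

/-- An absolutely convergent sine series. -/
noncomputable def sineSum (D : ℝ) (a : ℕ → ℂ) (x : ℝ) : ℂ := ∑' n, a n * (X D n x : ℂ)

lemma continuous_sineSum (D : ℝ) {a : ℕ → ℂ} (ha : Summable fun n => ‖a n‖) :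
    Continuous (sineSum D a) := by
  refine continuous_tsum (fun n => by fun_prop) (ha.mul_right (√(2 / D))) fun n x => ?_
  rw [norm_mul, Complex.norm_real, Real.norm_eq_abs]
  exact mul_le_mul_of_nonneg_left (abs_X_le D n x) (norm_nonneg _)

lemma conj_sineSum (D : ℝ) (a : ℕ → ℂ) (x : ℝ) :
    conj (sineSum D a x) = sineSum D (fun n => conj (a n)) x := by
  rw [sineSum, sineSum, Complex.conj_tsum]
  refine tsum_congr fun n => ?_
  rw [map_mul, Complex.conj_ofReal]

lemma integral_sineSum_mul {D : ℝ} (hD : 0 < D) {a b : ℕ → ℂ} (ha : Summable fun n => ‖a n‖)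
    (hb : Summable fun n => ‖b n‖) (h0 : a 0 = 0) :
    ∫ x in (0 : ℝ)..D, sineSum D a x * sineSum D b x = ∑' n, a n * b n :=
  hasSum_integral_sine_mul hD ha hb h0

lemma summable_mul_of_norm {a b : ℕ → ℂ} (ha : Summable fun n => ‖a n‖)
    (hb : Summable fun n => ‖b n‖) : Summable fun n => a n * b n :=
  Summable.of_norm ((ha.mul_of_nonneg hb (fun _ => norm_nonneg _) fun _ => norm_nonneg _).comp_injective
    (i := fun n : ℕ => (n, n)) (fun n m h => (Prod.ext_iff.1 h).1) |>.congr fun n => by simp)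

lemma intervalIntegral_congr_Ioo {D : ℝ} (hD : 0 < D) {f g : ℝ → ℂ} (h : EqOn f g (Ioo 0 D)) :
    ∫ x in (0 : ℝ)..D, f x = ∫ x in (0 : ℝ)..D, g x := by
  rw [intervalIntegral.integral_of_le hD.le, intervalIntegral.integral_of_le hD.le,
    integral_Ioc_eq_integral_Ioo, integral_Ioc_eq_integral_Ioo]
  exact setIntegral_congr_fun measurableSet_Ioo h

lemma intervalIntegrable_congr_Ioo {D : ℝ} (hD : 0 < D) {f g : ℝ → ℂ} (h : EqOn f g (Ioo 0 D))
    (hg : Continuous g) : IntervalIntegrable f volume 0 D := by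
  have h1 : IntegrableOn g (Ioo 0 D) := hg.integrableOn_Icc.mono_set Ioo_subset_Icc_self
  rw [intervalIntegrable_iff_integrableOn_Ioc_of_le hD.le, integrableOn_Ioc_iff_integrableOn_Ioo]
  exact h1.congr_fun h.symm measurableSet_Ioo

lemma mu_le_mu {D : ℝ} (hD : 0 < D) {n m : ℕ} (h : n ≤ m) : mu D n ≤ mu D m := by
  have : (n : ℝ) ≤ m := by exact_mod_cast h
  unfold mu
  gcongr

/-- Propagating modes have real wavenumbers, evanescent ones imaginary wavenumbers. -/
lemma conj_beta (D k : ℝ) (n : ℕ) :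
    conj (beta D k n) = if mu D n < k ^ 2 then beta D k n else -beta D k n := by
  unfold beta
  split_ifs with h <;> simp

/-- The exponent is imaginary for propagating modes and real for evanescent ones, so the flux
against a conjugate field sees only the former. -/
lemma conj_modeExp_sub (D k : ℝ) (n : ℕ) : conj (modeExp D k n) - modeExp D k n
    = if mu D n < k ^ 2 then 2 * Complex.I * beta D k n else 0 := by
  rw [modeExp, map_neg, map_mul, conj_beta, Complex.conj_I]
  split_ifs <;> ring

section

variable {Ω : Set (ℝ × ℝ)} {L D k : ℝ} {η : ℝ × ℝ → ℝ} {s y : ℝ × ℝ} {u v : ℝ × ℝ → ℂ} {z : ℝ}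

lemma IsGreen.eqOn_sineSum (hΩ : IsTerminating Ω L D) (h : IsGreen Ω L D k η s u)
    (hz : z < min L s.1) : EqOn (fun x => u (z, x)) (sineSum D fun n => coeff D u n z) (Ioo 0 D) :=
  fun x hx => ((h.modal_expansion hΩ hz).2.2 x hx).1

lemma IsGreen.eqOn_sineSum_dz (hΩ : IsTerminating Ω L D) (h : IsGreen Ω L D k η s u)
    (hz : z < min L s.1) : EqOn (fun x => dz u (z, x))
      (sineSum D fun n => modeExp D k n * coeff D u n z) (Ioo 0 D) :=
  fun x hx => ((h.modal_expansion hΩ hz).2.2 x hx).2.1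

/-- Two outgoing fields exchange no flux. -/
lemma IsGreen.flux_eq_zero (hΩ : IsTerminating Ω L D) (hu : IsGreen Ω L D k η s u)
    (hv : IsGreen Ω L D k η y v) (hzs : z < min L s.1) (hzy : z < min L y.1) :
    IntervalIntegrable (fun x => v (z, x) * dz u (z, x) - u (z, x) * dz v (z, x)) volume 0 D ∧
    ∫ x in (0 : ℝ)..D, (v (z, x) * dz u (z, x) - u (z, x) * dz v (z, x)) = 0 := by
  have hD := hΩ.width_pos
  obtain ⟨su, sdu, -⟩ := hu.modal_expansion hΩ hzs
  obtain ⟨sv, sdv, -⟩ := hv.modal_expansion hΩ hzy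
  have e : EqOn (fun x => v (z, x) * dz u (z, x) - u (z, x) * dz v (z, x))
      (fun x => sineSum D (fun n => coeff D v n z) x
          * sineSum D (fun n => modeExp D k n * coeff D u n z) x
        - sineSum D (fun n => coeff D u n z) x
          * sineSum D (fun n => modeExp D k n * coeff D v n z) x) (Ioo 0 D) := by
    intro x hx
    have h1 := hu.eqOn_sineSum hΩ hzs hx
    have h2 := hu.eqOn_sineSum_dz hΩ hzs hx
    have h3 := hv.eqOn_sineSum hΩ hzy hx
    have h4 := hv.eqOn_sineSum_dz hΩ hzy hx
    beta_reduce at h1 h2 h3 h4 ⊢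
    rw [h1, h2, h3, h4]
  have c1 := continuous_sineSum D su
  have c2 := continuous_sineSum D sdu
  have c3 := continuous_sineSum D sv
  have c4 := continuous_sineSum D sdv
  refine ⟨intervalIntegrable_congr_Ioo hD e (by fun_prop), ?_⟩
  rw [intervalIntegral_congr_Ioo hD e, intervalIntegral.integral_sub
    ((c3.fun_mul c2).intervalIntegrable _ _) ((c1.fun_mul c4).intervalIntegrable _ _),
    integral_sineSum_mul hD sv sdu (coeff_zero D v z),
    integral_sineSum_mul hD su sdv (coeff_zero D u z), sub_eq_zero]
  -- Both fields have the same exponent in mode `n`, so their Wronskian vanishes mode by mode.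
  exact tsum_congr fun n => by ring

/-- The flux of an outgoing field against an incoming one is carried by the propagating modes. -/
lemma IsGreen.flux_conj (hΩ : IsTerminating Ω L D) (hu : IsGreen Ω L D k η s u)
    (hv : IsGreen Ω L D k η y v) (hzs : z < min L s.1) (hzy : z < min L y.1) {M : ℕ}
    (hM : mu D M < k ^ 2) (hM' : k ^ 2 < mu D (M + 1)) :
    IntervalIntegrable (fun x => v (z, x) * conj (dz u (z, x)) - conj (u (z, x)) * dz v (z, x))
      volume 0 D ∧
    ∫ x in (0 : ℝ)..D, (v (z, x) * conj (dz u (z, x)) - conj (u (z, x)) * dz v (z, x))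
      = 2 * Complex.I * ∑ n ∈ Finset.Icc 1 M,
        beta D k n * conj (coeff D u n z) * coeff D v n z := by
  have hD := hΩ.width_pos
  obtain ⟨su, sdu, -⟩ := hu.modal_expansion hΩ hzs
  obtain ⟨sv, sdv, -⟩ := hv.modal_expansion hΩ hzy
  have e : EqOn (fun x => v (z, x) * conj (dz u (z, x)) - conj (u (z, x)) * dz v (z, x))
      (fun x => sineSum D (fun n => coeff D v n z) x
          * sineSum D (fun n => conj (modeExp D k n * coeff D u n z)) x
        - sineSum D (fun n => conj (coeff D u n z)) x
          * sineSum D (fun n => modeExp D k n * coeff D v n z) x) (Ioo 0 D) := by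
    intro x hx
    have h1 := hu.eqOn_sineSum hΩ hzs hx
    have h2 := hu.eqOn_sineSum_dz hΩ hzs hx
    have h3 := hv.eqOn_sineSum hΩ hzy hx
    have h4 := hv.eqOn_sineSum_dz hΩ hzy hx
    beta_reduce at h1 h2 h3 h4 ⊢
    rw [h1, h2, h3, h4, conj_sineSum, conj_sineSum]
  have su' : Summable fun n => ‖conj (coeff D u n z)‖ := by simpa using su
  have sdu' : Summable fun n => ‖conj (modeExp D k n * coeff D u n z)‖ := by simpa using sdu
  have c1 := continuous_sineSum D su'
  have c2 := continuous_sineSum D sdu'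
  have c3 := continuous_sineSum D sv
  have c4 := continuous_sineSum D sdv
  refine ⟨intervalIntegrable_congr_Ioo hD e (by fun_prop), ?_⟩
  rw [intervalIntegral_congr_Ioo hD e, intervalIntegral.integral_sub
    ((c3.fun_mul c2).intervalIntegrable _ _) ((c1.fun_mul c4).intervalIntegrable _ _),
    integral_sineSum_mul hD sv sdu' (coeff_zero D v z),
    integral_sineSum_mul hD su' sdv (by simp [coeff_zero]),
    ← (summable_mul_of_norm sv sdu').tsum_sub (summable_mul_of_norm su' sdv)]
  have hterm : ∀ n, coeff D v n z * conj (modeExp D k n * coeff D u n z)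
      - conj (coeff D u n z) * (modeExp D k n * coeff D v n z)
      = (if mu D n < k ^ 2 then 2 * Complex.I * beta D k n else 0)
        * (conj (coeff D u n z) * coeff D v n z) := fun n => by
    rw [← conj_modeExp_sub, map_mul]
    ring
  simp_rw [hterm]
  rw [tsum_eq_sum (s := Finset.Icc 1 M), Finset.mul_sum]
  · refine Finset.sum_congr rfl fun n hn => ?_
    rw [if_pos ((mu_le_mu hD (Finset.mem_Icc.1 hn).2).trans_lt hM)]
    ring
  -- Outside `1, …, M` there is only index `0`, with zero coefficient, and the evanescent modes from
  -- `M + 1` on.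
  · intro n hn
    rcases Nat.eq_zero_or_pos n with rfl | hn0
    · simp [coeff_zero]
    · have : M + 1 ≤ n := by
        by_contra h
        exact hn (Finset.mem_Icc.2 ⟨hn0, by omega⟩)
      rw [if_neg (not_lt.2 (hM'.le.trans (mu_le_mu hD this))), zero_mul]

/-- Conjugation reverses the phase of a propagating mode, so the phases cancel. Hence the flux
through the array equals that through every cross-section to the left of `L` and of the sources. -/
lemma IsGreen.conj_coeff_mul_coeff (hu : IsGreen Ω L D k η s u) (hv : IsGreen Ω L D k η y v) {z' : ℝ}
    (hzs : z < min L s.1) (hzy : z < min L y.1) (hzs' : z' < min L s.1) (hzy' : z' < min L y.1)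
    {n : ℕ} (hn : mu D n < k ^ 2) :
    conj (coeff D u n z) * coeff D v n z = conj (coeff D u n z') * coeff D v n z' := by
  rw [hu.coeff_eq n hzs hzs', hv.coeff_eq n hzy hzy', map_mul, ← Complex.exp_conj, map_mul,
    Complex.conj_ofReal]
  have h : conj (modeExp D k n) = -modeExp D k n := by
    rw [modeExp, map_neg, map_mul, conj_beta, if_pos hn, Complex.conj_I]
    ring
  rw [h]
  have : Complex.exp (-modeExp D k n * ((z - z' : ℝ) : ℂ))
      * Complex.exp (modeExp D k n * ((z - z' : ℝ) : ℂ)) = 1 := by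
    rw [← Complex.exp_add]
    simp
  linear_combination (conj (coeff D u n z') * coeff D v n z') * this

end

/-! ### The Kirchhoff-Helmholtz identity -/

section

variable {Ω : Set (ℝ × ℝ)} {L D k : ℝ} {η : ℝ × ℝ → ℝ} {G : ℝ × ℝ → ℝ × ℝ → ℂ} {s y : ℝ × ℝ} {za : ℝ}
  {M : ℕ}

/-- Since `ν = (-1, 0)`, `∂_ν = -∂_z`; this is the flux of `conj G(·,s)` against `G(·,y)`. -/
lemma khIntegrand_eq (za : ℝ) (G : ℝ × ℝ → ℝ × ℝ → ℂ) (s y : ℝ × ℝ) (x : ℝ) :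
    khIntegrand za G s y x = G (za, x) y * conj (dz (fun p => G p s) (za, x))
      - conj (G (za, x) s) * dz (fun p => G p y) (za, x) := by
  have h : ∀ f : ℝ × ℝ → ℂ, dnu f (za, x) = -dz f (za, x) := fun f => by
    rw [dnu, dz, ← map_neg]
    simp
  rw [khIntegrand, h, h, map_neg]
  ring

/-- The modal form of the boundary functional. -/
lemma khFunctional_eq_sum (hΩ : IsTerminating Ω L D) (hs : IsGreen Ω L D k η s fun p => G p s)
    (hy : IsGreen Ω L D k η y fun p => G p y) (hza : za < L) (hzs : za < s.1) (hzy : za < y.1)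
    (hM : mu D M < k ^ 2) (hM' : k ^ 2 < mu D (M + 1)) :
    IntervalIntegrable (khIntegrand za G s y) volume 0 D ∧
    khFunctional D za G s y = 2 * Complex.I * ∑ n ∈ Finset.Icc 1 M,
      beta D k n * conj (greenCoeff D za G n s) * greenCoeff D za G n y := by
  have h := hs.flux_conj hΩ hy (lt_min hza hzs) (lt_min hza hzy) hM hM'
  simp_rw [← khIntegrand_eq] at h
  exact h

/-- The flux of `conj G(·, s)` against `G(·, y)` through any cross-section to the left of both
sources is the boundary functional of the array. -/
lemma integral_flux_conj_eq_khFunctional (hΩ : IsTerminating Ω L D)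
    (hs : IsGreen Ω L D k η s fun p => G p s)
    (hy : IsGreen Ω L D k η y fun p => G p y) (hza : za < L) (hzs : za < s.1) (hzy : za < y.1)
    (hM : mu D M < k ^ 2) (hM' : k ^ 2 < mu D (M + 1)) {z : ℝ} (hz : z < min L (min s.1 y.1)) :
    ∫ x in (0 : ℝ)..D, (G (z, x) y * conj (dz (fun p => G p s) (z, x))
      - conj (G (z, x) s) * dz (fun p => G p y) (z, x)) = khFunctional D za G s y := by
  have h1 : z < min L s.1 :=
    hz.trans_le (le_min (min_le_left _ _) ((min_le_right _ _).trans (min_le_left _ _)))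
  have h2 : z < min L y.1 :=
    hz.trans_le (le_min (min_le_left _ _) ((min_le_right _ _).trans (min_le_right _ _)))
  have h := (hs.flux_conj hΩ hy h1 h2 hM hM').2
  rw [(khFunctional_eq_sum hΩ hs hy hza hzs hzy hM hM').2]
  refine h.trans (congrArg _ (Finset.sum_congr rfl fun n hn => ?_))
  have hn' : mu D n < k ^ 2 := (mu_le_mu hΩ.width_pos (Finset.mem_Icc.1 hn).2).trans_lt hM
  have := hs.conj_coeff_mul_coeff hy h1 h2 (lt_min hza hzs) (lt_min hza hzy) hn'
  simp only [greenCoeff]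
  linear_combination beta D k n * this

/-- Reciprocity. -/
lemma green_symm (hΩ : IsTerminating Ω L D) (hη : IsIndex Ω L η)
    (hG : ∀ s ∈ Ω, IsGreen Ω L D k η s fun p => G p s) (hs : s ∈ Ω) (hy : y ∈ Ω) :
    G y s = G s y := by
  by_cases hsy : s = y
  · rw [hsy]
  -- Two outgoing fields have `W = 0`, so the two source terms must be equal.
  have := ((hG s hs).isField hΩ).flux_eq ((hG y hy).isField hΩ) hΩ hη hs hy hsy (W := 0)
    (fun z hz => ((hG s hs).flux_eq_zero hΩ (hG y hy)
      (hz.trans_le (le_min (min_le_left _ _) ((min_le_right _ _).trans (min_le_left _ _))))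
      (hz.trans_le (le_min (min_le_left _ _) ((min_le_right _ _).trans (min_le_right _ _))))).2)
  linear_combination this

/-- The Kirchhoff-Helmholtz identity. -/
lemma khFunctional_eq (hΩ : IsTerminating Ω L D) (hη : IsIndex Ω L η)
    (hG : ∀ s ∈ Ω, IsGreen Ω L D k η s fun p => G p s) (hs : s ∈ Ω) (hy : y ∈ Ω) (hsy : y ≠ s)
    (hza : za < L) (hzs : za < s.1) (hzy : za < y.1)
    (hM : mu D M < k ^ 2) (hM' : k ^ 2 < mu D (M + 1)) :
    khFunctional D za G s y = G y s - conj (G y s) := by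
  have := ((hG s hs).isField hΩ).conjugate.flux_eq ((hG y hy).isField hΩ) hΩ hη hs hy hsy.symm
    (W := khFunctional D za G s y) (fun z hz => by
      simp only [dz_conj]
      exact integral_flux_conj_eq_khFunctional hΩ (hG s hs) (hG y hy) hza hzs hzy hM hM' hz)
  rw [this, map_one, green_symm hΩ hη hG hs hy]
  ring

/-- The Kirchhoff-Helmholtz identity at the source, where the imaginary part of the Green's function
is continuous. -/
lemma tendsto_im_green (hΩ : IsTerminating Ω L D) (hη : IsIndex Ω L η)
    (hG : ∀ s ∈ Ω, IsGreen Ω L D k η s fun p => G p s) (hs : s ∈ Ω)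
    (hza : za < L) (hzs : za < s.1) (hM : mu D M < k ^ 2) (hM' : k ^ 2 < mu D (M + 1)) :
    Tendsto (fun p => 2 * Complex.I * ((G p s).im : ℂ)) (𝓝[≠] s)
      (𝓝 (khFunctional D za G s s)) := by
  have hgs := hG s hs
  obtain ⟨h, hh, hGh⟩ := hgs.singularity
  -- The logarithmic part is real, so the imaginary part has no singularity.
  have him : ∀ p ∈ Ω, p ≠ s → (G p s).im = (h p).im := fun p hp hps => by
    have := congrArg Complex.im (hGh p hp hps)
    simpa using this
  -- The continuous representative of `G - conj G`: its value at `s` is prescribed by the regular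
  -- part `h`, whatever `G s s` is.
  set w : ℝ × ℝ → ℂ := fun p => if p = s then 2 * Complex.I * ((h s).im : ℂ)
    else G p s - conj (G p s) with hw
  have hsubconj : ∀ c : ℂ, c - conj c = 2 * Complex.I * (c.im : ℂ) := fun c => by
    rw [Complex.sub_conj]
    push_cast
    ring
  have hwh : ∀ p ∈ Ω, w p = 2 * Complex.I * ((h p).im : ℂ) := fun p hp => by
    by_cases hps : p = s
    · simp [hw, hps]
    · simp only [hw, if_neg hps]
      rw [hsubconj, him p hp hps]
  have hcont : ContinuousOn (fun p => 2 * Complex.I * ((h p).im : ℂ)) Ω :=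
    continuousOn_const.mul
      ((Complex.continuous_ofReal.comp Complex.continuous_im).comp_continuousOn hh)
  have hwc : ContinuousOn w Ω := hcont.congr hwh
  have hf := hgs.isField hΩ
  have hd : IsField Ω L D k η s 0 w := by
    have := (hf.sub hf.conjugate hΩ hη).congr (q := w) (fun x hx => by simp only [hw, if_neg hx])
    simpa using this
  -- The flux of `w` against `G` is that of `G` against itself, which is zero, minus that of `conj
  -- G` against `G`, which is the boundary functional.
  have key := hd.flux_eq_of_continuousOn hwc hf hΩ hη hs (W := -khFunctional D za G s s)
    (fun z hz => by
      have hz' : z < min L (min s.1 s.1) := by simpa using hz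
      have i1 := hgs.flux_eq_zero hΩ hgs hz hz
      have i2 := hgs.flux_conj hΩ hgs hz hz hM hM'
      have i3 := integral_flux_conj_eq_khFunctional hΩ hgs hgs hza hzs hzs hM hM' hz'
      rw [← i3, ← zero_sub, ← i1.2, ← intervalIntegral.integral_sub i1.1 i2.1]
      refine intervalIntegral_congr_Ioo hΩ.width_pos fun x hx => ?_
      have hne : ((z, x) : ℝ × ℝ) ≠ s := fun e => by
        have : z < s.1 := hz.trans_le (min_le_right _ _)
        rw [← e] at this
        exact lt_irrefl _ this
      have hev : w =ᶠ[𝓝 (z, x)] fun p => G p s - conj (G p s) := by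
        filter_upwards [isOpen_compl_singleton.mem_nhds
          (show (z, x) ∈ ({s}ᶜ : Set (ℝ × ℝ)) from hne)] with t ht
        simp only [hw, if_neg (show t ≠ s from ht)]
      have hdw : dz w (z, x)
          = dz (fun p => G p s) (z, x) - conj (dz (fun p => G p s) (z, x)) := by
        have h1 := (hf.regular z hz x hx).1
        have h2 := (hf.conjugate.regular z hz x hx).1
        have := dz_sub h1 h2
        rw [dz_conj] at this
        rw [← this, dz, dz, hev.fderiv_eq]
      rw [hdw, hev.eq_of_nhds]
      ring)
  rw [one_mul, neg_inj, hwh s hs] at key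
  rw [key]
  refine Tendsto.congr' ?_ ((hcont.continuousAt (hΩ.isOpen.mem_nhds hs)).tendsto.mono_left
    nhdsWithin_le_nhds)
  filter_upwards [self_mem_nhdsWithin, nhdsWithin_le_nhds (hΩ.isOpen.mem_nhds hs)] with p hp hpΩ
  rw [him p hpΩ hp]

/-! ### Imaging functionals. -/

lemma passiveImage_eq (D k za : ℝ) (M : ℕ) (G : ℝ × ℝ → ℝ × ℝ → ℂ) (s y : ℝ × ℝ) :
    passiveImage D k za M G s y = ∑ n ∈ Finset.Icc 1 M,
      beta D k n * conj (greenCoeff D za G n s) * greenCoeff D za G n y := rfl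

/-- Reciprocity turns propagation from the array to the scatterer into propagation back, so the data
separate into two factors. It is used on the open interval only, where the array points lie in `Ω`.
-/
lemma activeQ_eq (hΩ : IsTerminating Ω L D) (hη : IsIndex Ω L η)
    (hG : ∀ s ∈ Ω, IsGreen Ω L D k η s fun p => G p s) (hs : s ∈ Ω) (hza : za < L) (n m : ℕ) :
    activeQ D za G s n m = greenCoeff D za G n s * greenCoeff D za G m s := by
  have hD := hΩ.width_pos
  have inner : ∀ xr, ∫ xs in (0 : ℝ)..D, activeData za G s xs xr * (X D n xs : ℂ) * (X D m xr : ℂ)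
      = greenCoeff D za G n s * (G (za, xr) s * (X D m xr : ℂ)) := by
    intro xr
    rw [greenCoeff, coeff, ← intervalIntegral.integral_mul_const]
    refine intervalIntegral_congr_Ioo hD fun xs hxs => ?_
    simp only [activeData]
    rw [green_symm hΩ hη hG (hΩ.strip_mem hza hxs) hs]
    ring
  simp_rw [activeQ, inner]
  rw [intervalIntegral.integral_const_mul]
  rfl

lemma activeImage_eq (hΩ : IsTerminating Ω L D) (hη : IsIndex Ω L η)
    (hG : ∀ s ∈ Ω, IsGreen Ω L D k η s fun p => G p s) (hs : s ∈ Ω) (hza : za < L) (y : ℝ × ℝ) :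
    activeImage D k za M G s y = passiveImage D k za M G s y ^ 2 := by
  rw [activeImage, passiveImage_eq, sq, Finset.sum_mul_sum]
  refine Finset.sum_congr rfl fun n _ => Finset.sum_congr rfl fun m _ => ?_
  rw [activeQ_eq hΩ hη hG hs hza, map_mul]
  ring

lemma intervalIntegrable_green_mul_X (hΩ : IsTerminating Ω L D)
    (hs : IsGreen Ω L D k η s fun p => G p s) (hza : za < L) (hzs : za < s.1) (n : ℕ) :
    IntervalIntegrable (fun x => G (za, x) s * (X D n x : ℂ)) volume 0 D := by
  have hz := lt_min hza hzs
  have c := continuous_sineSum D (hs.modal_expansion hΩ hz).1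
  refine intervalIntegrable_congr_Ioo hΩ.width_pos
    (g := fun x => sineSum D (fun n => coeff D (fun p => G p s) n za) x * (X D n x : ℂ))
    (fun x hx => ?_) (by fun_prop)
  have := hs.eqOn_sineSum hΩ hz hx
  beta_reduce at this ⊢
  rw [this]

lemma integrableOn_activeData (hΩ : IsTerminating Ω L D) (hη : IsIndex Ω L η)
    (hG : ∀ s ∈ Ω, IsGreen Ω L D k η s fun p => G p s) (hs : s ∈ Ω) (hza : za < L) (hzs : za < s.1)
    (n m : ℕ) : IntegrableOn (fun q : ℝ × ℝ => activeData za G s q.1 q.2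
      * (X D n q.1 : ℂ) * (X D m q.2 : ℂ)) (Ioo 0 D ×ˢ Ioo 0 D) := by
  have hint : ∀ n, IntegrableOn (fun x => G (za, x) s * (X D n x : ℂ)) (Ioo 0 D) := fun n => by
    have := intervalIntegrable_green_mul_X hΩ (hG s hs) hza hzs n
    rwa [intervalIntegrable_iff_integrableOn_Ioc_of_le hΩ.width_pos.le,
      integrableOn_Ioc_iff_integrableOn_Ioo] at this
  have hprod := Integrable.mul_prod (hint n) (hint m)
  rw [Measure.prod_restrict, ← Measure.volume_eq_prod] at hprod
  refine IntegrableOn.congr_fun hprod (fun q hq => ?_) (measurableSet_Ioo.prod measurableSet_Ioo)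
  simp only [activeData]
  rw [green_symm hΩ hη hG (hΩ.strip_mem hza hq.1) hs]
  ring

end

end Waveguide

theorem proposition3p1 (Ω : Set (ℝ × ℝ)) (L D : ℝ) (hΩ : Waveguide.IsTerminating Ω L D)
    (η : ℝ × ℝ → ℝ) (hη : Waveguide.IsIndex Ω L η)
    (k : ℝ) (M : ℕ) (hM : Waveguide.mu D M < k ^ 2) (hM' : k ^ 2 < Waveguide.mu D (M + 1))
    (G : ℝ × ℝ → ℝ × ℝ → ℂ)
    (hG : ∀ s ∈ Ω, Waveguide.IsGreen Ω L D k η s (fun p => G p s))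
    (za : ℝ) (hza : za < L) :
    -- all the derivatives and integrals below exist
    (∀ s ∈ Ω, za < s.1 →
      (∀ x ∈ Ioo 0 D, DifferentiableAt ℝ (fun p => G p s) (za, x)) ∧
      (∀ n, IntervalIntegrable (fun x => G (za, x) s * (Waveguide.X D n x : ℂ)) volume 0 D) ∧
      (∀ n m, IntegrableOn (fun q : ℝ × ℝ => Waveguide.activeData za G s q.1 q.2
        * (Waveguide.X D n q.1 : ℂ) * (Waveguide.X D m q.2 : ℂ)) (Ioo 0 D ×ˢ Ioo 0 D))) ∧
    (∀ s ∈ Ω, ∀ y ∈ Ω, za < s.1 → za < y.1 →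
      IntervalIntegrable (Waveguide.khIntegrand za G s y) volume 0 D) ∧
    -- the Kirchhoff-Helmholtz identity
    (∀ s ∈ Ω, ∀ y ∈ Ω, za < s.1 → za < y.1 → y ≠ s →
      Waveguide.khFunctional D za G s y = G y s - conj (G y s) ∧
      Waveguide.khFunctional D za G s y = 2 * Complex.I * ((G y s).im : ℂ) ∧
      Waveguide.khFunctional D za G s y = G s y - conj (G s y)) ∧
    (∀ s ∈ Ω, za < s.1 →
      Tendsto (fun p => 2 * Complex.I * ((G p s).im : ℂ)) (𝓝[≠] s)
        (𝓝 (Waveguide.khFunctional D za G s s))) ∧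
    -- its modal form
    (∀ s ∈ Ω, ∀ y ∈ Ω, za < s.1 → za < y.1 →
      Waveguide.khFunctional D za G s y =
        2 * Complex.I * ∑ n ∈ Finset.Icc 1 M, Waveguide.beta D k n
          * conj (Waveguide.greenCoeff D za G n s) * Waveguide.greenCoeff D za G n y) ∧
    -- passive imaging of a source at `s`
    (∀ s ∈ Ω, ∀ y ∈ Ω, za < s.1 → za < y.1 → y ≠ s →
      Waveguide.passiveImage D k za M G s y = ((G y s).im : ℂ)) ∧
    (∀ s ∈ Ω, za < s.1 →
      Tendsto (fun p => ((G p s).im : ℂ)) (𝓝[≠] s)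
        (𝓝 (Waveguide.passiveImage D k za M G s s))) ∧
    -- active imaging of a point scatterer at `t`
    (∀ t ∈ Ω, ∀ y ∈ Ω, za < t.1 → za < y.1 → y ≠ t →
      Waveguide.activeImage D k za M G t y = ((G y t).im : ℂ) ^ 2) ∧
    (∀ t ∈ Ω, za < t.1 →
      Tendsto (fun p => ((G p t).im : ℂ) ^ 2) (𝓝[≠] t)
        (𝓝 (Waveguide.activeImage D k za M G t t))) := by
  have hsubconj : ∀ c : ℂ, c - conj c = 2 * Complex.I * (c.im : ℂ) := fun c => by
    rw [Complex.sub_conj]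
    push_cast
    ring
  have h2I : (2 * Complex.I : ℂ) ≠ 0 := by simp
  have hkh : ∀ s ∈ Ω, ∀ y ∈ Ω, za < s.1 → za < y.1 → y ≠ s →
      Waveguide.khFunctional D za G s y = G y s - conj (G y s) :=
    fun s hs y hy hzs hzy hne =>
      Waveguide.khFunctional_eq hΩ hη hG hs hy hne hza hzs hzy hM hM'
  -- The passive projections unfold to the modal coefficients of `G(·,s)`, so the modal sum is the
  -- passive functional by definition.
  have hmodal : ∀ s ∈ Ω, ∀ y ∈ Ω, za < s.1 → za < y.1 →
      Waveguide.khFunctional D za G s y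
        = 2 * Complex.I * Waveguide.passiveImage D k za M G s y :=
    fun s hs y hy hzs hzy =>
      (Waveguide.khFunctional_eq_sum hΩ (hG s hs) (hG y hy) hza hzs hzy hM hM').2
  have hpassive : ∀ s ∈ Ω, ∀ y ∈ Ω, za < s.1 → za < y.1 → y ≠ s →
      Waveguide.passiveImage D k za M G s y = ((G y s).im : ℂ) :=
    fun s hs y hy hzs hzy hne => by
      have := hkh s hs y hy hzs hzy hne
      rw [hmodal s hs y hy hzs hzy, hsubconj] at this
      exact mul_left_cancel₀ h2I this
  have hlim := fun s hs hzs =>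
    Waveguide.tendsto_im_green (s := s) hΩ hη hG hs hza hzs hM hM'
  have hlim' : ∀ s ∈ Ω, za < s.1 → Tendsto (fun p => ((G p s).im : ℂ)) (𝓝[≠] s)
      (𝓝 (Waveguide.passiveImage D k za M G s s)) := fun s hs hzs => by
    have := (hlim s hs hzs).const_mul (2 * Complex.I)⁻¹
    rw [hmodal s hs s hs hzs hzs, inv_mul_cancel_left₀ h2I] at this
    exact this.congr fun p => inv_mul_cancel_left₀ h2I _
  refine ⟨fun s hs hzs => ⟨fun x hx => ?_, fun n => ?_, fun n m => ?_⟩, ?_, ?_, hlim, hmodal,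
    hpassive, hlim', ?_, ?_⟩
  · exact (((hG s hs).modal_expansion hΩ (lt_min hza hzs)).2.2 x hx).2.2.1
  · exact Waveguide.intervalIntegrable_green_mul_X hΩ (hG s hs) hza hzs n
  · exact Waveguide.integrableOn_activeData hΩ hη hG hs hza hzs n m
  · exact fun s hs y hy hzs hzy =>
      (Waveguide.khFunctional_eq_sum hΩ (hG s hs) (hG y hy) hza hzs hzy hM hM').1
  · refine fun s hs y hy hzs hzy hne => ⟨hkh s hs y hy hzs hzy hne, ?_, ?_⟩
    · rw [hkh s hs y hy hzs hzy hne, hsubconj]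
    · rw [hkh s hs y hy hzs hzy hne, Waveguide.green_symm hΩ hη hG hs hy]
  · intro t ht y hy hzt hzy hne
    rw [Waveguide.activeImage_eq hΩ hη hG ht hza, hpassive t ht y hy hzt hzy hne]
  · intro t ht hzt
    rw [Waveguide.activeImage_eq hΩ hη hG ht hza]
    exact (hlim' t ht hzt).pow 2
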